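/- Fix a finite set $\sigma$ of labels with $|\sigma|>1$. A graph is a triple $H=(V,E,\lambda)$ with $V$ a finite non-empty set, $E\subseteq V^2$ and $\lambda:E\to\sigma$. A homomorphism $G\to H$ is a map of the vertices that preserves edges and their labels. A one-way path is a graph $u_1\xrightarrow{R_1}\cdots\xrightarrow{R_{m-1}}u_m$ with $m\ge 1$ pairwise distinct vertices and no other vertices or edges. A downward tree is a rooted tree with all edges directed from parent to child. A probabilistic graph $(H,\pi)$ is a graph $H$ with a rational probability $\pi(e)\in[0,1]$, written as a fraction of integers in binary, for each edge $e$. For a graph $G$, let $$\Pr(G\leadsto H)=\sum_{E'}\ \prod_{e\in E'}\pi(e)\prod_{e\in E\setminus E'}(1-\pi(e)),$$ where $E'$ ranges over the subsets of $E$ such that $G$ has a homomorphism to the graph $(V,E',\lambda|_{E'})$. 1. There is a deterministic Turing machine that, given a one-way path $G$ and a probabilistic graph $(H,\pi)$ with $H$ a downward tree, both with labels in $\sigma$, computes $\Pr(G\leadsto H)$, as a fraction of integers in binary, in time polynomial in the size of the whole input $(G,(H,\pi))$. 2. Let $G=u_1\xrightarrow{R_1}\cdots\xrightarrow{R_{m-1}}u_m$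 be a one-way path and $(H,\pi)$ a probabilistic graph with $H=(V,E,\lambda)$ a downward tree. Let $\phi$ be the positive DNF with variable set $E$ that has one clause $\bigwedge_{1\le i<m}(a_i,a_{i+1})$ for each downward path $a_1\xrightarrow{R_1}\cdots\xrightarrow{R_{m-1}}a_m$ of $H$. Then: (a) $\phi$ captures the lineage of $G$ on $H$: a valuation $\nu:E\to\{0,1\}$ satisfies $\phi$ if and only if $G$ has a homomorphism to the graph obtained from $H$ by keeping exactly the edges $e$ with $\nu(e)=1$. (b) $\phi$ is $\beta$-acyclic: the hypergraph with vertex set $E$ whose hyperedges are the non-empty sets of variables of the clauses of $\phi$ can be brought to a hypergraph without hyperedges by repeatedly choosing a vertex $v$ such that the hyperedges containing $v$ are totally ordered by inclusion, and removing $v$ from the vertex set and from all hyperedges (dropping the hyperedge if it becomes empty). (c) The probability that $\phi$ is true, when each variable $e\in E$ is independently true with probability $\pi(e)$, equals $\Pr(G\leadsto H)$. -/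

import Mathlib

/-- A directed graph on the vertex set `V` with edge labels in `σ` and without multi-edges:
`edge u v = some R` means that `(u, v)` is an edge with label `R`, and `edge u v = none` means that
`(u, v)` is not an edge. -/
structure LabeledGraph (σ V : Type) where
  edge : V → V → Option σ

namespace LabeledGraph

variable {σ U V : Type}

/-- The set of edges, as a set of pairs of vertices. -/
def edges [Fintype V] (H : LabeledGraph σ V) : Finset (V × V) :=
  Finset.univ.filter fun e => (H.edge e.1 e.2).isSome

theorem mem_edges [Fintype V] {H : LabeledGraph σ V} {u v : V} :
    (u, v) ∈ H.edges ↔ (H.edge u v).isSome := by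
  simp [edges]

theorem mem_edges_of_eq [Fintype V] {H : LabeledGraph σ V} {u v : V} {R : σ}
    (h : H.edge u v = some R) : (u, v) ∈ H.edges := by
  simp [edges, h]

open Classical in
/-- The subgraph of `H` (on the same vertices) whose edges are those in `E'`, with their labels. -/
noncomputable def subgraph [Fintype V] (H : LabeledGraph σ V) (E' : Finset H.edges) :
    LabeledGraph σ V where
  edge u v := if ∃ h : (u, v) ∈ H.edges, (⟨(u, v), h⟩ : H.edges) ∈ E' then H.edge u v else none

/-- There is a homomorphism from `G` to `H`: a map of the vertices that preserves edges and their
labels. -/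
def HasHom (G : LabeledGraph σ U) (H : LabeledGraph σ V) : Prop :=
  ∃ h : U → V, ∀ u v R, G.edge u v = some R → H.edge (h u) (h v) = some R

/-- `G` is the one-way path `a 0 → a 1 → ⋯ → a m`, the `k`-th edge being labeled `R k`;
the `a i` are pairwise distinct, and there are no other vertices and no other edges. -/
def IsOneWayPathAlong (G : LabeledGraph σ V) {m : ℕ} (a : Fin (m + 1) ≃ V) (R : Fin m → σ) : Prop :=
  ∀ (i j : Fin (m + 1)) (S : σ),
    G.edge (a i) (a j) = some S ↔ ∃ k : Fin m, i = k.castSucc ∧ j = k.succ ∧ S = R k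

/-- One-way paths (a single vertex without edges is one). -/
def IsOneWayPath (G : LabeledGraph σ V) : Prop :=
  ∃ (m : ℕ) (a : Fin (m + 1) ≃ V) (R : Fin m → σ), G.IsOneWayPathAlong a R

/-- Downward trees: there is a root without incoming edge, every other vertex has exactly one
incoming edge (from its parent), and every vertex is reachable from the root. -/
def IsDownwardTree (H : LabeledGraph σ V) : Prop :=
  ∃ r : V, (∀ u, H.edge u r = none) ∧
    (∀ v, v ≠ r → ∃! u, (H.edge u v).isSome) ∧
    ∀ v, Relation.ReflTransGen (fun x y => (H.edge x y).isSome) r v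

end LabeledGraph

/-- A rational probability, represented by a fraction `num / den` in `[0, 1]`
(not necessarily in lowest terms). -/
structure RatProb where
  num : ℕ
  den : ℕ
  den_pos : 0 < den
  num_le_den : num ≤ den

/-- The rational number represented by a fraction. -/
def RatProb.val (p : RatProb) : ℚ := (p.num : ℚ) / (p.den : ℚ)

/-- A probabilistic graph `(H, π)`: every edge of `H` carries a rational probability. -/
structure ProbGraph (σ V : Type) [Fintype V] where
  graph : LabeledGraph σ V
  prob : graph.edges → RatProb

namespace ProbGraph

variable {σ U V : Type} [Fintype V]

open Classical in
/-- The probability of the possible world of `H` whose set of edges is `E'`. -/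
noncomputable def worldProb (H : ProbGraph σ V) (E' : Finset H.graph.edges) : ℚ :=
  (∏ e ∈ E', (H.prob e).val) * ∏ e ∈ Finset.univ \ E', (1 - (H.prob e).val)

open Classical in
/-- The probability that there is a homomorphism from `G` to a random possible world of `H`. -/
noncomputable def homProb (G : LabeledGraph σ U) (H : ProbGraph σ V) : ℚ :=
  ∑ E' : Finset H.graph.edges with G.HasHom (H.graph.subgraph E'), H.worldProb E'

end ProbGraph

/-! ### The problem of computing the probability of a homomorphism -/

/-- A class of labeled graphs. -/
abbrev GraphClass (σ : Type) := ∀ V : Type, LabeledGraph σ V → Prop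

/-- An input of the probabilistic homomorphism problem for the classes `𝒢` and `ℋ`: a query graph in
`𝒢` and a probabilistic instance graph in `ℋ`, both with a nonempty vertex set `{0, …, n - 1}`. -/
structure PHomInput (σ : Type) (𝒢 ℋ : GraphClass σ) where
  querySize : ℕ
  instSize : ℕ
  querySize_pos : 0 < querySize
  instSize_pos : 0 < instSize
  query : LabeledGraph σ (Fin querySize)
  inst : ProbGraph σ (Fin instSize)
  query_mem : 𝒢 _ query
  inst_mem : ℋ _ inst.graph

/-- The (finite, when `σ` is finite) alphabet used to write inputs and outputs. -/
inductive TapeSymbol (σ : Type) where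
  | bit (b : Bool)
  | label (R : σ)
  | noEdge
  | endNumber
  | endRow
  | endGraph

section Encoding

variable {σ : Type}

/-- A natural number is written in binary (least significant bit first). -/
def encodeNumber (n : ℕ) : List (TapeSymbol σ) :=
  (Computability.encodeNat n).map TapeSymbol.bit ++ [TapeSymbol.endNumber]

/-- A rational probability is written as its numerator followed by its denominator. -/
def encodeRatProb (p : RatProb) : List (TapeSymbol σ) :=
  encodeNumber p.num ++ encodeNumber p.den

/-- A matrix is written row by row. -/
def encodeMatrix {n : ℕ} (entry : Fin n → Fin n → List (TapeSymbol σ)) : List (TapeSymbol σ) :=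
  ((List.finRange n).flatMap fun u =>
    ((List.finRange n).flatMap fun v => entry u v) ++ [TapeSymbol.endRow]) ++ [TapeSymbol.endGraph]

/-- A graph is written as its adjacency matrix, with the label of every edge. -/
def encodeGraph {n : ℕ} (G : LabeledGraph σ (Fin n)) : List (TapeSymbol σ) :=
  encodeMatrix fun u v =>
    match G.edge u v with
    | some R => [TapeSymbol.label R]
    | none => [TapeSymbol.noEdge]

/-- A probabilistic graph is written as its adjacency matrix, with the label and the probability of
every edge. -/
def encodeProbGraph {n : ℕ} (H : ProbGraph σ (Fin n)) : List (TapeSymbol σ) :=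
  encodeMatrix fun u v =>
    if h : (u, v) ∈ H.graph.edges then
      TapeSymbol.label ((H.graph.edge u v).get (LabeledGraph.mem_edges.1 h)) ::
        encodeRatProb (H.prob ⟨(u, v), h⟩)
    else [TapeSymbol.noEdge]

/-- An input is written as the query graph followed by the probabilistic instance graph. -/
def encodePHomInput {𝒢 ℋ : GraphClass σ} (x : PHomInput σ 𝒢 ℋ) : List (TapeSymbol σ) :=
  encodeGraph x.query ++ encodeProbGraph x.inst

end Encoding

/-- The probabilistic homomorphism problem for query graphs in `𝒢` and instance graphs in `ℋ` is in
PTIME: some deterministic Turing machine, running in time polynomial in the length of the encoding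
of the whole input (query and instance), writes a fraction equal to the probability that the query
graph has a homomorphism to the instance graph. -/
def PHomInPTIME (σ : Type) (𝒢 ℋ : GraphClass σ) : Prop :=
  ∃ f : PHomInput σ 𝒢 ℋ → RatProb,
    (∀ x, (f x).val = ProbGraph.homProb x.query x.inst) ∧
    Nonempty (Turing.TM2ComputableInPolyTime (encodePHomInput (𝒢 := 𝒢) (ℋ := ℋ))
      (encodeRatProb (σ := σ)) f)

/-! ### Hypergraphs, positive DNFs and lineages -/

/-- A hypergraph, that is, a finite set of vertices with a set of nonempty subsets of it. -/
structure FinHypergraph (X : Type) where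
  verts : Finset X
  edges : Set (Finset X)
  subset_verts : ∀ e ∈ edges, e ⊆ verts
  nonempty : ∀ e ∈ edges, e.Nonempty

namespace FinHypergraph

variable {X : Type}

open Classical in
/-- The hypergraph obtained by removing the vertex `v` from the vertices and from all hyperedges,
and dropping the empty hyperedge if it appears. -/
noncomputable def remove (𝓗 : FinHypergraph X) (v : X) : FinHypergraph X where
  verts := 𝓗.verts.erase v
  edges := {e' | e'.Nonempty ∧ ∃ e ∈ 𝓗.edges, e' = e.erase v}
  subset_verts := by
    rintro _ ⟨-, e, he, rfl⟩
    exact Finset.erase_subset_erase v (𝓗.subset_verts e he)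
  nonempty := fun _ h => h.1

/-- The hyperedges that contain the vertex `v` are totally ordered by inclusion. -/
def IsBetaLeaf (𝓗 : FinHypergraph X) (v : X) : Prop :=
  v ∈ 𝓗.verts ∧ ∀ e ∈ 𝓗.edges, ∀ f ∈ 𝓗.edges, v ∈ e → v ∈ f → e ⊆ f ∨ f ⊆ e

/-- `β`-elimination orders of a hypergraph. -/
inductive IsBetaEliminationOrder : FinHypergraph X → List X → Prop
  | nil (𝓗 : FinHypergraph X) : 𝓗.edges = ∅ → IsBetaEliminationOrder 𝓗 []
  | cons (𝓗 : FinHypergraph X) (v : X) (l : List X) : 𝓗.edges ≠ ∅ → 𝓗.IsBetaLeaf v →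
      IsBetaEliminationOrder (𝓗.remove v) l → IsBetaEliminationOrder 𝓗 (v :: l)

def IsBetaAcyclic (𝓗 : FinHypergraph X) : Prop :=
  ∃ l : List X, IsBetaEliminationOrder 𝓗 l

end FinHypergraph

/-- A positive DNF on the variables `X`: a finite disjunction of clauses, indexed by `ι`,
each of which is a conjunction of variables. -/
structure PosDNF (X : Type) where
  ι : Type
  finite_ι : Finite ι
  clause : ι → Finset X

namespace PosDNF

variable {X : Type}

/-- The valuation `ν` satisfies the formula. -/
def Satisfies (φ : PosDNF X) (ν : X → Bool) : Prop :=
  ∃ i, ∀ x ∈ φ.clause i, ν x = true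

/-- The hypergraph on all variables whose hyperedges are the (nonempty) clauses. -/
def hypergraph [Fintype X] (φ : PosDNF X) : FinHypergraph X where
  verts := Finset.univ
  edges := {e | e.Nonempty ∧ ∃ i, φ.clause i = e}
  subset_verts := fun e _ => Finset.subset_univ e
  nonempty := fun _ h => h.1

def IsBetaAcyclic [Fintype X] (φ : PosDNF X) : Prop :=
  φ.hypergraph.IsBetaAcyclic

open Classical in
/-- The probability of the formula when each variable `x` is independently true with
probability `π x`. -/
noncomputable def prob [Fintype X] (φ : PosDNF X) (π : X → ℚ) : ℚ :=
  ∑ ν : X → Bool with φ.Satisfies ν,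
    (∏ x with ν x = true, π x) * ∏ x with ν x = false, (1 - π x)

end PosDNF

namespace LabeledGraph

variable {σ U V : Type} [Fintype V]

/-- The possible world `ν(H)`, in which an edge `e` of `H` is kept iff `ν e = 1`. -/
noncomputable def world (H : LabeledGraph σ V) (ν : H.edges → Bool) : LabeledGraph σ V :=
  H.subgraph (Finset.univ.filter fun e => ν e = true)

/-- The positive DNF `φ`, whose variables are the edges of `H`, captures the lineage of `G`
on `H`. -/
def CapturesLineage (H : LabeledGraph σ V) (φ : PosDNF H.edges) (G : LabeledGraph σ U) : Prop :=
  ∀ ν : H.edges → Bool, φ.Satisfies ν ↔ G.HasHom (H.world ν)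

/-- The paths `a 0 → a 1 → ⋯ → a m` of `H` (directed downward if `H` is a downward tree) whose
sequence of labels is `R 0, …, R (m - 1)`. -/
def MatchingPath (H : LabeledGraph σ V) {m : ℕ} (R : Fin m → σ) : Type :=
  {a : Fin (m + 1) → V // ∀ k : Fin m, H.edge (a k.castSucc) (a k.succ) = some (R k)}

open Classical in
/-- The set of edges of a matching path. -/
noncomputable def MatchingPath.edgeSet {H : LabeledGraph σ V} {m : ℕ} {R : Fin m → σ}
    (p : H.MatchingPath R) : Finset H.edges :=
  Finset.univ.image fun k : Fin m =>
    (⟨(p.1 k.castSucc, p.1 k.succ), mem_edges_of_eq (p.2 k)⟩ : H.edges)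

/-- The positive DNF with one clause per matching path, namely the conjunction of the edges of the
path. -/
noncomputable def pathDNF (H : LabeledGraph σ V) {m : ℕ} (R : Fin m → σ) : PosDNF H.edges where
  ι := H.MatchingPath R
  finite_ι := by unfold MatchingPath; infer_instance
  clause := MatchingPath.edgeSet

end LabeledGraph

/-! In a downward tree every vertex has one parent, so a match of the path query is determined by
its last vertex `w`: it consists of the `m` edges directly above `w`. Homomorphisms into a possible
world are exactly the matching paths all of whose edges are kept, which gives the lineage statement,
and the equality of probabilities follows by summing over valuations (`capturesLineage_pathDNF`,
`homProb_eq_prob`).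

For `β`-acyclicity, each non-empty clause is an upward chain of edges starting at its lowest edge. A
deepest edge that occurs in some clause is the start of every clause containing it, and chains with
a common start are nested. Removing that edge leaves a family of chains, so deepest-first
elimination succeeds (`isBetaAcyclic_of_upChain`).

The algorithm does not use this elimination order. It first marks the vertices at which a match of
the query ends in the full tree. It then computes, bottom-up, the probability that no marked vertex
below `v` has all its `m` edges present, given how many consecutive present edges lie just above
`v`. The subtrees of distinct children use disjoint sets of edges, so their contributions are
independent and multiply (`expect_not_bad`); at the root this yields the complement of the required
probability (`homProb_eq_tab`). All values at `v` share a denominator that contains the denominator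
of each edge below `v` at most once (`denTab_le`). Numbers therefore keep polynomially many digits.

Polynomial time is proved on an actual machine. Structured programs on four stacks compile to `TM2`
machines (`Exec.runsIn`). Data are binary trees in prefix code, and `PolyT` is closed under
composition, pairing, case distinction and folds whose intermediate results stay polynomially small.
The only fold whose size bound needs the meaning of the computed values is that of the probability
table (`PolyT.phomAlg`). -/

/-! ### A structured language for machines with four stacks -/

section Machine

/-- Contents of the four stacks. -/
abbrev Stacks (Γ : Type) := Fin 4 → List Γ

/-- Structured programs for a machine with four stacks. -/
inductive Cmd (Γ : Type) : Type
  | push (k : Fin 4) (a : Γ)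
  | pop (k : Fin 4)
  | seq (c d : Cmd Γ)
  | cases (k : Fin 4) (f : Option Γ → Cmd Γ)
  | loop (k : Fin 4) (p : Option Γ → Bool) (c : Cmd Γ)

namespace Cmd

variable {Γ : Type}

/-- `Exec c S S' t`: the program `c` transforms the stacks `S` into `S'` in `t` steps. -/
inductive Exec : Cmd Γ → Stacks Γ → Stacks Γ → ℕ → Prop
  | push (k a S) : Exec (push k a) S (Function.update S k (a :: S k)) 1
  | pop (k S) : Exec (pop k) S (Function.update S k (S k).tail) 1
  | seq {c d S S' S'' t t'} : Exec c S S' t → Exec d S' S'' t' → Exec (seq c d) S S'' (t + t')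
  | cases {k f S S' t} : Exec (f (S k).head?) S S' t → Exec (cases k f) S S' (t + 1)
  | loop_false {k p c S} : p (S k).head? = false → Exec (loop k p c) S S 1
  | loop_true {k p c S S' S'' t t'} : p (S k).head? = true → Exec c S S' t →
      Exec (loop k p c) S' S'' t' → Exec (loop k p c) S S'' (t + t' + 1)

/-- The labels of the machine running a program. -/
def Lab : Cmd Γ → Type
  | push _ _ => Unit
  | pop _ => Unit
  | seq c d => Lab c ⊕ Lab d
  | cases _ f => Unit ⊕ Σ o, Lab (f o)
  | loop _ _ c => Unit ⊕ Lab c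

/-- The first label of a program. -/
def start : (c : Cmd Γ) → Lab c
  | push _ _ => ()
  | pop _ => ()
  | seq c _ => Sum.inl (start c)
  | cases _ _ => Sum.inl ()
  | loop _ _ _ => Sum.inl ()

theorem finite_lab [Finite Γ] : (c : Cmd Γ) → Finite (Lab c)
  | push _ _ => inferInstanceAs (Finite Unit)
  | pop _ => inferInstanceAs (Finite Unit)
  | seq c d =>
    have := finite_lab c
    have := finite_lab d
    inferInstanceAs (Finite (Lab c ⊕ Lab d))
  | cases _ f =>
    have := fun o => finite_lab (f o)
    inferInstanceAs (Finite (Unit ⊕ Σ o, Lab (f o)))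
  | loop _ _ c =>
    have := finite_lab c
    inferInstanceAs (Finite (Unit ⊕ Lab c))

/-- Statements of the machine: the internal state holds the symbol seen last. -/
abbrev MStmt (Γ Λ : Type) := Turing.TM2.Stmt (K := Fin 4) (fun _ => Γ) Λ (Option Γ)

abbrev MCfg (Γ Λ : Type) := Turing.TM2.Cfg (K := Fin 4) (fun _ => Γ) Λ (Option Γ)

/-- The statements of a program whose labels are placed in `Λ` by `emb`, and which continues at
`exit`. -/
def code {Λ : Type} : (c : Cmd Γ) → (Lab c → Λ) → Λ → Lab c → MStmt Γ Λ
  | push k a, _, exit, _ => .push k (fun _ => a) (.goto fun _ => exit)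
  | pop k, _, exit, _ => .pop k (fun v _ => v) (.goto fun _ => exit)
  | seq c d, emb, _, Sum.inl l => code c (emb ∘ Sum.inl) (emb (Sum.inr (start d))) l
  | seq _ d, emb, exit, Sum.inr l => code d (emb ∘ Sum.inr) exit l
  | cases k f, emb, _, Sum.inl _ =>
    .peek k (fun _ o => o) (.goto fun o => emb (Sum.inr ⟨o, start (f o)⟩))
  | cases _ f, emb, exit, Sum.inr ⟨o, l⟩ => code (f o) (fun l => emb (Sum.inr ⟨o, l⟩)) exit l
  | loop k p c, emb, exit, Sum.inl _ =>
    .peek k (fun _ o => o) (.goto fun o => if p o then emb (Sum.inr (start c)) else exit)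
  | loop _ _ c, emb, _, Sum.inr l => code c (emb ∘ Sum.inr) (emb (Sum.inl ())) l

/-- `c` is reached from `b` in exactly `t` steps. -/
def RunsIn {Λ : Type} (M : Λ → MStmt Γ Λ) (t : ℕ) (b c : MCfg Γ Λ) : Prop :=
  (flip bind (Turing.TM2.step M))^[t] (some b) = some c

theorem RunsIn.trans {Λ : Type} {M : Λ → MStmt Γ Λ} {t t' : ℕ} {b c d : MCfg Γ Λ}
    (h : RunsIn M t b c) (h' : RunsIn M t' c d) : RunsIn M (t + t') b d := by
  unfold RunsIn at *
  rw [add_comm, Function.iterate_add_apply, h, h']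

theorem RunsIn.one {Λ : Type} {M : Λ → MStmt Γ Λ} {b c : MCfg Γ Λ}
    (h : Turing.TM2.step M b = some c) : RunsIn M 1 b c := h

/-- Quantifying over the embedding of the labels and over the exit label lets the induction treat a
subprogram in place inside the whole machine. The internal register may hold anything on entry,
since every branching statement reloads it by a `peek`. -/
theorem Exec.runsIn {Λ : Type} {M : Λ → MStmt Γ Λ} {c : Cmd Γ} {S S' : Stacks Γ} {t : ℕ}
    (h : Exec c S S' t) : ∀ (emb : Lab c → Λ) (exit : Λ), (∀ l, M (emb l) = code c emb exit l) →
      ∀ v, ∃ v', RunsIn M t ⟨some (emb (start c)), v, S⟩ ⟨some exit, v', S'⟩ := by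
  induction h with
  | push k a S =>
    intro emb exit hM v
    refine ⟨v, RunsIn.one ?_⟩
    simp [hM, code]
  | pop k S =>
    intro emb exit hM v
    refine ⟨v, RunsIn.one ?_⟩
    simp [hM, code]
  | @seq c d S S' S'' t t' _ _ ih ih' =>
    intro emb exit hM v
    obtain ⟨v', h⟩ := ih (emb ∘ Sum.inl) (emb (Sum.inr (start d))) (fun l => hM (Sum.inl l)) v
    obtain ⟨v'', h'⟩ := ih' (emb ∘ Sum.inr) exit (fun l => hM (Sum.inr l)) v'
    exact ⟨v'', h.trans h'⟩
  | @cases k f S S' t _ ih =>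
    intro emb exit hM v
    obtain ⟨v', h⟩ := ih (fun l => emb (Sum.inr ⟨_, l⟩)) exit (fun l => hM (Sum.inr ⟨_, l⟩))
      (S k).head?
    refine ⟨v', ?_⟩
    rw [add_comm]
    refine RunsIn.trans (RunsIn.one ?_) h
    exact congrArg (fun q => some (Turing.TM2.stepAux q v S)) (hM (Sum.inl ()))
  | @loop_false k p c S hp =>
    intro emb exit hM v
    refine ⟨(S k).head?, RunsIn.one ?_⟩
    refine (congrArg (fun q => some (Turing.TM2.stepAux q v S)) (hM (Sum.inl ()))).trans ?_
    simp [code, hp]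
  | @loop_true k p c S S' S'' t t' hp _ _ ih ih' =>
    intro emb exit hM v
    obtain ⟨v', h⟩ := ih (emb ∘ Sum.inr) (emb (Sum.inl ())) (fun l => hM (Sum.inr l)) (S k).head?
    obtain ⟨v'', h'⟩ := ih' emb exit hM v'
    refine ⟨v'', ?_⟩
    rw [add_comm]
    refine RunsIn.trans (RunsIn.one ?_) (h.trans h')
    refine (congrArg (fun q => some (Turing.TM2.stepAux q v S)) (hM (Sum.inl ()))).trans ?_
    simp [code, hp]
    rfl

/-- The machine that runs the program `c` and halts, with input on stack `1` and output on
stack `2`. -/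
noncomputable def machine [Fintype Γ] (c : Cmd Γ) : Turing.FinTM2 where
  K := Fin 4
  k₀ := 1
  k₁ := 2
  Γ _ := Γ
  Λ := Option (Lab c)
  main := some (start c)
  ΛFin := by
    have := finite_lab c
    exact Fintype.ofFinite _
  σ := Option Γ
  initialState := none
  m
    | some l => code c some none l
    | none => .load (fun _ => none) .halt

/-- A program that computes `f` on the encodings in polynomial time yields a Turing machine. -/
theorem computableInPolyTime [Fintype Γ] {α β : Type} {ea : α → List Γ} {eb : β → List Γ}
    {f : α → β} (c : Cmd Γ) (p : Polynomial ℕ)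
    (h : ∀ x, ∃ t ≤ p.eval (ea x).length,
      Exec c ![[], ea x, [], []] ![[], [], eb (f x), []] t) :
    Nonempty (Turing.TM2ComputableInPolyTime ea eb f) := by
  choose t ht hex using h
  -- The extra step runs the label `none`, which resets the internal register as the halting
  -- configuration demands.
  refine ⟨{ tm := machine c, inputAlphabet := Equiv.refl _, outputAlphabet := Equiv.refl _,
            time := p + 1, outputsFun := fun x => ⟨⟨t x + 1, ?_⟩, ?_⟩ }⟩
  · obtain ⟨v', hr⟩ := (hex x).runsIn (M := (machine c).m) some none (fun l => rfl) none
    have h2 := hr.trans (RunsIn.one (M := (machine c).m) (b := ⟨some none, v', _⟩)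
      (c := ⟨none, none, ![[], [], eb (f x), []]⟩) rfl)
    unfold RunsIn at h2
    have e1 : Turing.initList (machine c) (List.map (Equiv.refl Γ).invFun (ea x)) =
        ⟨some (some (start c)), none, ![[], ea x, [], []]⟩ := by
      refine congrArg (fun s => (⟨some (some (start c)), none, s⟩ : MCfg Γ (Option (Lab c)))) ?_
      funext (k : Fin 4)
      fin_cases k <;> simp [machine] <;> rfl
    have e2 : Turing.haltList (machine c) (List.map (Equiv.refl Γ).invFun (eb (f x))) =
        ⟨none, none, ![[], [], eb (f x), []]⟩ := by
      refine congrArg (fun s => (⟨none, none, s⟩ : MCfg Γ (Option (Lab c)))) ?_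
      funext (k : Fin 4)
      fin_cases k <;> simp [machine] <;> rfl
    refine Eq.trans ?_ (h2.trans ?_)
    · exact congrArg (fun z => (flip bind (Turing.TM2.step (machine c).m))^[t x + 1] (some z)) e1
    · exact (congrArg some e2).symm
  · simpa using ht x

end Cmd

end Machine

/-! ### Binary trees on the stacks -/

section Trees

/-- Binary trees, in which all data are represented. -/
inductive BT : Type
  | leaf
  | node (a b : BT)

namespace BT

/-- The number of nodes and leaves. -/
def size : BT → ℕ
  | leaf => 1
  | node a b => a.size + b.size + 1

/-- The prefix code of a tree. -/
def str {σ : Type} : BT → List (TapeSymbol σ)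
  | leaf => [.bit false]
  | node a b => .bit true :: (a.str ++ b.str)

theorem length_str {σ : Type} (x : BT) : (x.str (σ := σ)).length = x.size := by
  induction x with
  | leaf => rfl
  | node a b iha ihb => simp [str, size, iha, ihb]

theorem size_pos (x : BT) : 0 < x.size := by cases x <;> simp [size]

end BT

end Trees

/-! ### Stack programs that move, copy, exchange and delete trees -/

namespace Cmd

section Run

variable {σ Γ : Type}

/-- The program `c` transforms `S` into `S'` in at most `n` steps. -/
def Run (c : Cmd Γ) (S S' : Stacks Γ) (n : ℕ) : Prop := ∃ t ≤ n, Exec c S S' t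

theorem Run.mono {c : Cmd Γ} {S S' : Stacks Γ} {n n' : ℕ} (h : Run c S S' n) (hn : n ≤ n') :
    Run c S S' n' :=
  let ⟨t, ht, hx⟩ := h
  ⟨t, ht.trans hn, hx⟩

theorem Run.seq {c d : Cmd Γ} {S S' S'' : Stacks Γ} {n n' : ℕ} (h : Run c S S' n)
    (h' : Run d S' S'' n') : Run (seq c d) S S'' (n + n') :=
  let ⟨t, ht, hx⟩ := h
  let ⟨t', ht', hx'⟩ := h'
  ⟨t + t', add_le_add ht ht', hx.seq hx'⟩

theorem Run.push {k : Fin 4} {a : Γ} {S S' : Stacks Γ}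
    (h : Function.update S k (a :: S k) = S') : Run (push k a) S S' 1 :=
  ⟨1, le_rfl, h ▸ Exec.push k a S⟩

theorem Run.pop {k : Fin 4} {S S' : Stacks Γ}
    (h : Function.update S k (S k).tail = S') : Run (pop k) S S' 1 :=
  ⟨1, le_rfl, h ▸ Exec.pop k S⟩

theorem Run.cases {k : Fin 4} {f : Option Γ → Cmd Γ} {S S' : Stacks Γ} {n : ℕ} {o : Option Γ}
    (ho : (S k).head? = o) (h : Run (f o) S S' n) : Run (cases k f) S S' (n + 1) := by
  subst ho
  obtain ⟨t, ht, hx⟩ := h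
  exact ⟨t + 1, by omega, hx.cases⟩

theorem Run.loop_false {k : Fin 4} {p : Option Γ → Bool} {c : Cmd Γ} {S : Stacks Γ}
    (h : p (S k).head? = false) : Run (loop k p c) S S 1 :=
  ⟨1, le_rfl, Exec.loop_false h⟩

theorem Run.loop_true {k : Fin 4} {p : Option Γ → Bool} {c : Cmd Γ} {S S' S'' : Stacks Γ}
    {n n' : ℕ} (h : p (S k).head? = true) (h1 : Run c S S' n) (h2 : Run (loop k p c) S' S'' n') :
    Run (loop k p c) S S'' (n + n' + 1) :=
  let ⟨t, ht, hx⟩ := h1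
  let ⟨t', ht', hx'⟩ := h2
  ⟨t + t' + 1, by omega, Exec.loop_true h hx hx'⟩

theorem update_zero (a b c d x : List Γ) :
    Function.update (![a, b, c, d] : Stacks Γ) 0 x = ![x, b, c, d] := by
  funext k; fin_cases k <;> rfl

theorem update_one (a b c d x : List Γ) :
    Function.update (![a, b, c, d] : Stacks Γ) 1 x = ![a, x, c, d] := by
  funext k; fin_cases k <;> rfl

theorem update_two (a b c d x : List Γ) :
    Function.update (![a, b, c, d] : Stacks Γ) 2 x = ![a, b, x, d] := by
  funext k; fin_cases k <;> rfl

theorem update_three (a b c d x : List Γ) :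
    Function.update (![a, b, c, d] : Stacks Γ) 3 x = ![a, b, c, x] := by
  funext k; fin_cases k <;> rfl

theorem Run.push0 (x : Γ) (a b c d : List Γ) : Run (Cmd.push 0 x) ![a, b, c, d] ![x :: a, b, c, d] 1 :=
  Run.push (update_zero ..)

theorem Run.push1 (x : Γ) (a b c d : List Γ) : Run (Cmd.push 1 x) ![a, b, c, d] ![a, x :: b, c, d] 1 :=
  Run.push (update_one ..)

theorem Run.push2 (x : Γ) (a b c d : List Γ) : Run (Cmd.push 2 x) ![a, b, c, d] ![a, b, x :: c, d] 1 :=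
  Run.push (update_two ..)

theorem Run.push3 (x : Γ) (a b c d : List Γ) : Run (Cmd.push 3 x) ![a, b, c, d] ![a, b, c, x :: d] 1 :=
  Run.push (update_three ..)

theorem Run.pop0 (x : Γ) (a b c d : List Γ) : Run (Cmd.pop 0) ![x :: a, b, c, d] ![a, b, c, d] 1 :=
  Run.pop (update_zero ..)

theorem Run.pop1 (x : Γ) (a b c d : List Γ) : Run (Cmd.pop 1) ![a, x :: b, c, d] ![a, b, c, d] 1 :=
  Run.pop (update_one ..)

theorem Run.pop3 (x : Γ) (a b c d : List Γ) : Run (Cmd.pop 3) ![a, b, c, x :: d] ![a, b, c, d] 1 :=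
  Run.pop (update_three ..)

/-- Pop all symbols of stack `i` and push them on stack `j`. -/
def drain (i j : Fin 4) : Cmd Γ :=
  loop i Option.isSome (cases i fun
    | some a => seq (pop i) (push j a)
    | none => pop i)

theorem Run.drain {i j : Fin 4} (hij : i ≠ j) (w : List Γ) : ∀ (S S' : Stacks Γ), S i = w →
    Function.update (Function.update S i []) j (w.reverse ++ S j) = S' →
    Run (drain i j) S S' (4 * w.length + 1) := by
  induction w with
  | nil =>
    intro S S' hS hS'
    have : S = S' := by
      subst hS'
      funext k
      by_cases hk : k = j
      · subst hk; simp
      · by_cases hk' : k = i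
        · subst hk'; simp [hk, hS]
        · simp [hk, hk']
    subst this
    exact Run.loop_false (by simp [hS])
  | cons a w ih =>
    intro S S' hS hS'
    have h2 := ih (Function.update (Function.update S i w) j (a :: S j)) S' (by simp [hij])
      (by
        subst hS'
        funext k
        by_cases hk : k = j
        · subst hk; simp
        · by_cases hk' : k = i
          · subst hk'; simp [hk]
          · simp [hk, hk'])
    refine Run.mono (Run.loop_true (n := 3) (by simp [hS]) ?_ h2) (by simp; omega)
    refine Run.cases (n := 2) (o := some a) (by simp [hS]) ?_
    refine Run.seq (n := 1) (n' := 1) (Run.pop rfl) (Run.push ?_)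
    simp [hS, hij.symm]

theorem Run.drain10 (a b c d : List Γ) :
    Run (Cmd.drain 1 0) ![a, b, c, d] ![b.reverse ++ a, [], c, d] (4 * b.length + 1) :=
  Run.drain (by decide) b _ _ rfl (by rw [update_one, update_zero]; rfl)

theorem Run.drain12 (a b c d : List Γ) :
    Run (Cmd.drain 1 2) ![a, b, c, d] ![a, [], b.reverse ++ c, d] (4 * b.length + 1) :=
  Run.drain (by decide) b _ _ rfl (by rw [update_one, update_two]; rfl)

theorem Run.drain21 (a b c d : List Γ) :
    Run (Cmd.drain 2 1) ![a, b, c, d] ![a, c.reverse ++ b, [], d] (4 * c.length + 1) :=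
  Run.drain (by decide) c _ _ rfl (by rw [update_two, update_one]; rfl)

theorem Run.drain23 (a b c d : List Γ) :
    Run (Cmd.drain 2 3) ![a, b, c, d] ![a, b, [], c.reverse ++ d] (4 * c.length + 1) :=
  Run.drain (by decide) c _ _ rfl (by rw [update_two, update_three]; rfl)

theorem Run.drain30 (a b c d : List Γ) :
    Run (Cmd.drain 3 0) ![a, b, c, d] ![d.reverse ++ a, b, c, []] (4 * d.length + 1) :=
  Run.drain (by decide) d _ _ rfl (by rw [update_three, update_zero]; rfl)

/-- Pop all symbols of stack `1`. -/
def clear : Cmd Γ := loop 1 Option.isSome (pop 1)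

theorem Run.clear (a b c d : List Γ) :
    Run Cmd.clear ![a, b, c, d] ![a, [], c, d] (2 * b.length + 1) := by
  induction b with
  | nil => exact Run.loop_false rfl
  | cons x b ih =>
    exact Run.mono (Run.loop_true rfl (Run.pop1 x a b c d) ih) (by simp; omega)

/-- Move the contents of stack `1` to both stacks `0` and `2`. -/
def drainBoth : Cmd Γ :=
  loop 1 Option.isSome (cases 1 fun
    | some a => seq (pop 1) (seq (push 0 a) (push 2 a))
    | none => pop 1)

theorem Run.drainBoth (a b c d : List Γ) : Run Cmd.drainBoth ![a, b, c, d]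
    ![b.reverse ++ a, [], b.reverse ++ c, d] (5 * b.length + 1) := by
  induction b generalizing a c with
  | nil => exact Run.loop_false rfl
  | cons x b ih =>
    have := ih (x :: a) (x :: c)
    simp only [List.reverse_cons, List.append_assoc, List.singleton_append]
    refine Run.mono (Run.loop_true rfl (Run.cases (o := some x) rfl ?_) this) (n := 4 + (5 * b.length + 1) + 1)
      (by simp; omega)
    exact (Run.pop1 x a b c d).seq ((Run.push0 x a b c d).seq (Run.push2 x _ b c d))

/-- Move the tree on top of stack `0` to stack `1`, using stack `3` as a counter. -/
def moveLoop : Cmd (TapeSymbol σ) :=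
  loop 3 Option.isSome (cases 0 fun
    | some (.bit true) => seq (pop 0) (seq (push 1 (.bit true)) (push 3 (.bit true)))
    | some (.bit false) => seq (pop 0) (seq (push 1 (.bit false)) (pop 3))
    | _ => pop 3)

/-- Stack `3` holds one mark per tree still to be read: a node turns one pending tree into two, a
leaf completes one. Hence the end of the prefix code is found without a delimiter. Stating it
relative to an arbitrary continuation lets the two subtrees of a node be chained. -/
theorem Run.moveLoop (x : BT) : ∀ (r s c d : List (TapeSymbol σ)) (S' n),
    Run Cmd.moveLoop ![r, x.str.reverse ++ s, c, d] S' n →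
    Run Cmd.moveLoop ![x.str ++ r, s, c, .bit true :: d] S' (5 * x.size + n) := by
  induction x with
  | leaf =>
    intro r s c d S' n h
    refine Run.mono (Run.loop_true rfl (Run.cases (n := 3) (o := some (.bit false)) rfl ?_) h)
      (by simp [BT.size])
    exact (Run.pop0 _ _ _ _ _).seq ((Run.push1 _ _ _ _ _).seq (Run.pop3 _ _ _ _ _))
  | node a b iha ihb =>
    intro r s c d S' n h
    have h1 := iha (b.str ++ r) (.bit true :: s) c (.bit true :: d) S' _
      (ihb r (a.str.reverse ++ .bit true :: s) c d S' n (by simpa [BT.str] using h))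
    have e : (BT.node a b).str ++ r = .bit true :: (a.str ++ (b.str ++ r)) := by simp [BT.str]
    rw [e]
    refine Run.mono (Run.loop_true rfl (Run.cases (n := 3) (o := some (.bit true)) rfl ?_) h1)
      (by simp [BT.size]; omega)
    exact (Run.pop0 _ _ _ _ _).seq ((Run.push1 _ _ _ _ _).seq (Run.push3 _ _ _ _ _))

/-- Move the tree on top of stack `0` to stack `1`. -/
def move : Cmd (TapeSymbol σ) := seq (push 3 (.bit true)) moveLoop

theorem Run.move (x : BT) (r s c : List (TapeSymbol σ)) :
    Run Cmd.move ![x.str ++ r, s, c, []] ![r, x.str.reverse ++ s, c, []] (5 * x.size + 2) :=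
  ((Run.push3 _ _ _ _ _).seq (Run.moveLoop x r s c [] _ 1 (Run.loop_false rfl))).mono (by omega)

/-- Duplicate the tree on top of stack `0`. -/
def dup : Cmd (TapeSymbol σ) :=
  seq move (seq drainBoth (seq (drain 2 1) (drain 1 0)))

theorem Run.dup (x : BT) (r : List (TapeSymbol σ)) :
    Run Cmd.dup ![x.str ++ r, [], [], []] ![x.str ++ (x.str ++ r), [], [], []]
      (20 * x.size + 10) := by
  have h1 := Run.move x r [] []
  -- One copy returns to stack `0` at once; the other passes through stacks `2` and `1`, since each
  -- transfer reverses it.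
  have h2 := Run.drainBoth r (x.str.reverse ++ []) [] []
  have h3 := Run.drain21 (x.str ++ r) [] x.str []
  have h4 := Run.drain10 (x.str ++ r) x.str.reverse [] []
  simp only [List.append_nil, List.reverse_reverse, List.length_reverse, BT.length_str] at *
  exact (h1.seq (h2.seq (h3.seq h4))).mono (by omega)

/-- Exchange the two trees on top of stack `0`. -/
def swap : Cmd (TapeSymbol σ) :=
  seq move (seq (drain 1 2) (seq move (seq (drain 2 3) (seq (drain 3 0) (drain 1 0)))))

theorem Run.swap (x y : BT) (r : List (TapeSymbol σ)) :
    Run Cmd.swap ![x.str ++ (y.str ++ r), [], [], []] ![y.str ++ (x.str ++ r), [], [], []]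
      (20 * (x.size + y.size) + 20) := by
  have h1 := Run.move x (y.str ++ r) [] []
  have h2 := Run.drain12 (y.str ++ r) x.str.reverse [] []
  have h3 := Run.move y r [] x.str
  have h4 := Run.drain23 r y.str.reverse x.str []
  have h5 := Run.drain30 r y.str.reverse [] x.str.reverse
  have h6 := Run.drain10 (x.str ++ r) y.str.reverse [] []
  simp only [List.append_nil, List.reverse_reverse, List.length_reverse, BT.length_str] at *
  exact (h1.seq (h2.seq (h3.seq (h4.seq (h5.seq h6))))).mono (by omega)

/-- Delete the tree on top of stack `0`. -/
def del : Cmd (TapeSymbol σ) := seq move clear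

theorem Run.del (x : BT) (r : List (TapeSymbol σ)) :
    Run Cmd.del ![x.str ++ r, [], [], []] ![r, [], [], []] (10 * x.size + 10) := by
  have h1 := Run.move x r [] []
  have h2 := Run.clear r x.str.reverse [] []
  simp only [List.append_nil, List.length_reverse, BT.length_str] at *
  exact (h1.seq h2).mono (by omega)

/-- Push a word on stack `0`, its last symbol first. -/
def pushWord : List Γ → Cmd Γ
  | [] => loop 0 (fun _ => false) (pop 0)
  | a :: w => seq (pushWord w) (push 0 a)

theorem Run.pushWord (w a b c d : List Γ) :
    Run (Cmd.pushWord w) ![a, b, c, d] ![w ++ a, b, c, d] (w.length + 1) := by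
  induction w with
  | nil => exact Run.loop_false rfl
  | cons x w ih => exact (ih.seq (Run.push0 x _ b c d)).mono (by simp)

end Run

end Cmd

/-! ### Functions computable in polynomial time on data represented by trees -/

section PolyTime

/-- Data represented by trees. -/
class Enc (α : Type) where
  enc : α → BT

open Enc

instance : Enc Unit := ⟨fun _ => .leaf⟩

instance {α β : Type} [Enc α] [Enc β] : Enc (α × β) := ⟨fun x => .node (enc x.1) (enc x.2)⟩

/-- Lists are represented by right combs. -/
def encList {α : Type} [Enc α] : List α → BT
  | [] => .leaf
  | a :: l => .node (enc a) (encList l)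

instance {α : Type} [Enc α] : Enc (List α) := ⟨encList⟩

/-- The size of the representation. -/
def sz {α : Type} [Enc α] (x : α) : ℕ := (enc x).size

section sz
variable {α β : Type} [Enc α] [Enc β]

theorem sz_pos (x : α) : 0 < sz x := BT.size_pos _

@[simp] theorem sz_unit (x : Unit) : sz x = 1 := rfl

@[simp] theorem sz_prod (x : α × β) : sz x = sz x.1 + sz x.2 + 1 := rfl

@[simp] theorem sz_nil : sz ([] : List α) = 1 := rfl

@[simp] theorem sz_cons (a : α) (l : List α) : sz (a :: l) = sz a + sz l + 1 := rfl

/-- Each of the two combs ends in a leaf, their concatenation in a single one. -/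
theorem sz_append (l l' : List α) : sz (l ++ l') + 1 = sz l + sz l' := by
  induction l with
  | nil => simp; omega
  | cons a l ih => simp; omega

@[simp] theorem sz_reverse (l : List α) : sz l.reverse = sz l := by
  induction l with
  | nil => rfl
  | cons a l ih =>
    have := sz_append l.reverse [a]
    simp at *; omega

theorem length_lt_sz (l : List α) : l.length < sz l := by
  induction l with
  | nil => simp
  | cons a l ih => simp; omega

theorem sz_le_of_mem {a : α} {l : List α} (h : a ∈ l) : sz a ≤ sz l := by
  induction l with
  | nil => simp at h
  | cons b l ih =>
    rcases List.mem_cons.1 h with rfl | h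
    · simp; omega
    · have := ih h; simp; omega

theorem sz_le_of_prefix {l' l : List α} (h : l' <+: l) : sz l' ≤ sz l := by
  obtain ⟨l'', rfl⟩ := h
  have := sz_append l' l''
  have := sz_pos l''
  omega

theorem sz_le_mul (l : List α) (N : ℕ) (h : ∀ a ∈ l, sz a ≤ N) : sz l ≤ l.length * (N + 1) + 1 := by
  induction l with
  | nil => simp
  | cons a l ih =>
    have h1 := ih fun b hb => h b (List.mem_cons_of_mem _ hb)
    have h2 := h a List.mem_cons_self
    simp only [sz_cons, List.length_cons, add_mul]
    omega

end sz

theorem polyEval_mono (p : Polynomial ℕ) {m n : ℕ} (h : m ≤ n) : p.eval m ≤ p.eval n := by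
  rw [Polynomial.eval_eq_sum_range, Polynomial.eval_eq_sum_range]
  gcongr

/-- The function `f` is computed in polynomial time on top of stack `0`, whatever lies below. -/
def PolyT (σ : Type) {α β : Type} [Enc α] [Enc β] (f : α → β) : Prop :=
  ∃ (c : Cmd (TapeSymbol σ)) (p : Polynomial ℕ), ∀ x,
    (∀ r, Cmd.Run c ![(enc x).str ++ r, [], [], []] ![(enc (f x)).str ++ r, [], [], []]
      (p.eval (sz x))) ∧ sz (f x) ≤ p.eval (sz x)

/-- `f x` is bounded by a polynomial in the size of `x`. -/
def PolyBd {α : Type} [Enc α] (f : α → ℕ) : Prop :=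
  ∃ p : Polynomial ℕ, ∀ x, f x ≤ p.eval (sz x)

namespace PolyBd

variable {α β : Type} [Enc α] [Enc β]

theorem of_le {f g : α → ℕ} (hg : PolyBd g) (h : ∀ x, f x ≤ g x) : PolyBd f :=
  let ⟨p, hp⟩ := hg
  ⟨p, fun x => (h x).trans (hp x)⟩

theorem sz : PolyBd (sz : α → ℕ) := ⟨.X, by simp⟩

theorem const (n : ℕ) : PolyBd fun _ : α => n := ⟨.C n, by simp⟩

theorem add {f g : α → ℕ} (hf : PolyBd f) (hg : PolyBd g) : PolyBd fun x => f x + g x :=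
  let ⟨p, hp⟩ := hf
  let ⟨q, hq⟩ := hg
  ⟨p + q, fun x => by simpa using add_le_add (hp x) (hq x)⟩

theorem mul {f g : α → ℕ} (hf : PolyBd f) (hg : PolyBd g) : PolyBd fun x => f x * g x :=
  let ⟨p, hp⟩ := hf
  let ⟨q, hq⟩ := hg
  ⟨p * q, fun x => by simpa using Nat.mul_le_mul (hp x) (hq x)⟩

theorem poly {f : α → ℕ} (hf : PolyBd f) (q : Polynomial ℕ) : PolyBd fun x => q.eval (f x) :=
  let ⟨p, hp⟩ := hf
  ⟨q.comp p, fun x => by simpa using polyEval_mono q (hp x)⟩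

theorem comp {f : β → ℕ} (hf : PolyBd f) {g : α → β} (hg : PolyBd fun x => _root_.sz (g x)) :
    PolyBd fun x => f (g x) :=
  let ⟨p, hp⟩ := hf
  (hg.poly p).of_le fun x => hp (g x)

end PolyBd

namespace PolyT

variable {σ : Type} {α β γ δ : Type} [Enc α] [Enc β] [Enc γ] [Enc δ]

/-- Time and output size may be bounded separately; the sum of the two polynomials serves for both.
-/
theorem mk {f : α → β} (c : Cmd (TapeSymbol σ)) {t : α → ℕ} (ht : PolyBd t)
    (hs : PolyBd fun x => sz (f x)) (h : ∀ x r, Cmd.Run c ![(enc x).str ++ r, [], [], []]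
      ![(enc (f x)).str ++ r, [], [], []] (t x)) : PolyT σ f := by
  obtain ⟨p, hp⟩ := ht
  obtain ⟨q, hq⟩ := hs
  refine ⟨c, p + q, fun x => ⟨fun r => (h x r).mono ((hp x).trans ?_), (hq x).trans ?_⟩⟩ <;> simp

theorem exists_run {f : α → β} (hf : PolyT σ f) : ∃ (c : Cmd (TapeSymbol σ)) (t : α → ℕ),
    PolyBd t ∧ ∀ x r, Cmd.Run c ![(enc x).str ++ r, [], [], []]
      ![(enc (f x)).str ++ r, [], [], []] (t x) := by
  obtain ⟨c, p, h⟩ := hf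
  exact ⟨c, fun x => p.eval (sz x), ⟨p, fun _ => le_rfl⟩, fun x r => (h x).1 r⟩

theorem polyBd {f : α → β} (hf : PolyT σ f) : PolyBd fun x => sz (f x) := by
  obtain ⟨c, p, h⟩ := hf
  exact ⟨p, fun x => (h x).2⟩

theorem of_eq {f g : α → β} (hf : PolyT σ f) (h : ∀ x, f x = g x) : PolyT σ g :=
  funext h ▸ hf

/-- Functions that do not change the representation. -/
theorem cast {f : α → β} (h : ∀ x, enc (f x) = enc x) : PolyT σ f := by
  refine mk (Cmd.pushWord []) (t := fun _ => 1) (PolyBd.const 1)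
    (PolyBd.sz.of_le fun x => (congrArg BT.size (h x)).le) fun x r => ?_
  rw [h]
  exact Cmd.Run.loop_false rfl

protected theorem id : PolyT σ (fun x : α => x) := cast fun _ => rfl

theorem comp {g : β → γ} {f : α → β} (hg : PolyT σ g) (hf : PolyT σ f) :
    PolyT σ fun x => g (f x) := by
  obtain ⟨c, t, ht, h⟩ := hf.exists_run
  obtain ⟨c', t', ht', h'⟩ := hg.exists_run
  exact mk (.seq c c') (ht.add (ht'.comp hf.polyBd)) (hg.polyBd.comp hf.polyBd)
    fun x r => (h x r).seq (h' (f x) r)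

theorem const (b : β) : PolyT σ fun _ : α => b := by
  refine mk (.seq Cmd.del (Cmd.pushWord (enc b).str))
    (t := fun x => (10 * sz x + 10) + ((enc b).str (σ := σ).length + 1))
    ((((PolyBd.const 10).mul PolyBd.sz).add (PolyBd.const _)).add (PolyBd.const _))
    (PolyBd.const _) fun x r => (Cmd.Run.del (enc x) r).seq (Cmd.Run.pushWord _ _ _ _ _)

/-- The second component is computed first, on a copy of the input, so that the first ends up on top
of it; one node symbol then completes the prefix code of the pair. -/
theorem pair {f : α → β} {g : α → γ} (hf : PolyT σ f) (hg : PolyT σ g) :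
    PolyT σ fun x => (f x, g x) := by
  obtain ⟨c, t, ht, h⟩ := hf.exists_run
  obtain ⟨c', t', ht', h'⟩ := hg.exists_run
  refine mk (.seq .dup (.seq c' (.seq .swap (.seq c (.push 0 (.bit true))))))
    (t := fun x => 20 * sz x + 10 + (t' x + (20 * (sz (g x) + sz x) + 20 + (t x + 1))))
    ((((PolyBd.const 20).mul PolyBd.sz).add (PolyBd.const _)).add (ht'.add
      ((((PolyBd.const _).mul (hg.polyBd.add PolyBd.sz)).add (PolyBd.const _)).add
        (ht.add (PolyBd.const _)))))
    ((hf.polyBd.add hg.polyBd).add (PolyBd.const 1)) fun x r => ?_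
  have e : (enc (f x, g x)).str ++ r =
      TapeSymbol.bit (σ := σ) true :: ((enc (f x)).str ++ ((enc (g x)).str ++ r)) := by
    simp [enc, BT.str]
  rw [e]
  exact (Cmd.Run.dup _ _).seq ((h' x _).seq ((Cmd.Run.swap _ _ _).seq
    ((h x _).seq (Cmd.Run.push0 _ _ _ _ _))))

theorem str_prod (a : α) (b : β) (r : List (TapeSymbol σ)) : (enc (a, b)).str ++ r =
    .bit true :: ((enc a).str ++ ((enc b).str ++ r)) := by
  simp [enc, BT.str]

theorem str_cons (a : α) (l : List α) (r : List (TapeSymbol σ)) : (enc (a :: l)).str ++ r =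
    .bit true :: ((enc a).str ++ ((enc l).str ++ r)) := by
  simp [enc, encList, BT.str]

theorem snd : PolyT σ (Prod.snd : α × β → β) := by
  refine mk (.seq (.pop 0) .del) (t := fun x => 1 + (10 * sz x + 10))
    ((PolyBd.const 1).add (((PolyBd.const 10).mul PolyBd.sz).add (PolyBd.const _)))
    (PolyBd.sz.of_le fun x => by simp; omega) fun x r => ?_
  rw [← Prod.eta x, str_prod]
  refine ((Cmd.Run.pop0 _ _ _ _ _).seq (Cmd.Run.del _ _)).mono ?_
  have : (enc x.1).size ≤ sz x := by rw [sz_prod]; exact Nat.le_add_right_of_le (Nat.le_add_right _ _)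
  simp only [Prod.eta]
  omega

theorem fst : PolyT σ (Prod.fst : α × β → α) := by
  refine mk (.seq (.pop 0) (.seq .swap .del))
    (t := fun x => 1 + ((20 * sz x + 20) + (10 * sz x + 10)))
    ((PolyBd.const 1).add ((((PolyBd.const 20).mul PolyBd.sz).add (PolyBd.const _)).add
      (((PolyBd.const 10).mul PolyBd.sz).add (PolyBd.const _))))
    (PolyBd.sz.of_le fun x => by simp; omega) fun x r => ?_
  rw [← Prod.eta x, str_prod]
  refine ((Cmd.Run.pop0 _ _ _ _ _).seq ((Cmd.Run.swap _ _ _).seq (Cmd.Run.del _ _))).mono ?_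
  have : (enc x.1).size + (enc x.2).size ≤ sz x := by rw [sz_prod]; exact Nat.le_add_right _ _
  simp only [Prod.eta]
  omega

/-- Case distinction on a list. -/
theorem listCase {l : α → List β} {g : α → γ} {h : α → β → List β → γ} (hl : PolyT σ l)
    (hg : PolyT σ g) (hh : PolyT σ fun x : (β × List β) × α => h x.2 x.1.1 x.1.2) :
    PolyT σ fun x => match l x with
      | [] => g x
      | b :: l' => h x b l' := by
  have h0 := hl.pair (PolyT.id (σ := σ) (α := α))
  obtain ⟨c0, t0, ht0, hc0⟩ := h0.exists_run
  obtain ⟨c1, t1, ht1, hc1⟩ := hg.exists_run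
  obtain ⟨c2, t2, ht2, hc2⟩ := hh.exists_run
  obtain ⟨p2, hp2⟩ := ht2
  obtain ⟨q2, hq2⟩ := hh.polyBd
  have hB : PolyBd fun x => sz (l x) + sz x + 1 := h0.polyBd
  -- Popping the node of the pair `(l x, x)` exposes the first symbol of the list. If it is a node,
  -- one further mark makes what follows the code of `((b, l'), x)`; if it is a leaf, popping it
  -- leaves the input alone.
  refine mk (.seq c0 (.seq (.pop 0) (.cases 0 fun
      | some (.bit true) => .seq (.push 0 (.bit true)) c2
      | _ => .seq (.pop 0) c1)))
    (t := fun x => t0 x + (1 + ((1 + (t1 x + p2.eval (sz (l x) + sz x + 1))) + 1)))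
    (ht0.add ((PolyBd.const 1).add (((PolyBd.const _).add (ht1.add (hB.poly _))).add
      (PolyBd.const _))))
    ((hg.polyBd.add (hB.poly q2)).of_le fun x => ?_) fun x r => ?_
  · split
    · exact Nat.le_add_right _ _
    · next b l' e =>
      refine (hq2 ((b, l'), x)).trans (Nat.le_add_left_of_le (le_of_eq ?_))
      simp [e]
  · refine (hc0 x r).seq ?_
    rw [str_prod]
    refine (Cmd.Run.pop0 _ _ _ _ _).seq ?_
    cases e : l x with
    | nil =>
      refine Cmd.Run.cases (o := some (.bit false)) rfl ?_
      exact Cmd.Run.mono (n := 1 + t1 x)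
        ((Cmd.Run.pop0 (TapeSymbol.bit false) _ _ _ _).seq (hc1 x r)) (by omega)
    | cons b l' =>
      refine Cmd.Run.cases (o := some (.bit true)) rfl ?_
      have h2 := hc2 ((b, l'), x) r
      rw [str_prod, str_prod] at h2
      rw [str_cons]
      refine ((Cmd.Run.push0 (TapeSymbol.bit true) _ _ _ _).seq h2).mono ?_
      have := hp2 ((b, l'), x)
      simp only [sz_prod, sz_cons] at this ⊢
      omega

/-- The test of the loop that computes a fold. -/
def isNode : Option (TapeSymbol σ) → Bool
  | some (.bit true) => true
  | _ => false

/-- Loop invariant: the rest of the list lies above the pair of accumulator and parameter. A pushed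
mark joins them into the input of `c`, and popping the mark of its output restores the invariant.
The cost of `c` is only assumed at splittings of the list, because only the accumulators that really
occur have bounded size. -/
theorem run_foldLoop {step : δ → γ → β → γ} {c : Cmd (TapeSymbol σ)} (x : δ) (N : ℕ)
    (r : List (TapeSymbol σ)) (l : List β) : ∀ a : γ,
    (∀ l₁ b l₂, l = l₁ ++ b :: l₂ →
      Cmd.Run c ![(enc ((b, l₂), (l₁.foldl (step x) a, x))).str ++ r, [], [], []]
        ![(enc (l₂, (step x (l₁.foldl (step x) a) b, x))).str ++ r, [], [], []] N) →
    Cmd.Run (.loop 0 isNode (.seq (.push 0 (.bit true)) (.seq c (.pop 0))))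
      ![(enc l).str ++ ((enc (a, x)).str ++ r), [], [], []]
      ![.bit false :: ((enc (l.foldl (step x) a, x)).str ++ r), [], [], []]
      (l.length * (N + 3) + 1) := by
  induction l with
  | nil => intro a _; exact (Cmd.Run.loop_false rfl).mono (by simp)
  | cons b l ih =>
    intro a h
    have h1 := h [] b l rfl
    have h2 := ih (step x a b) fun l₁ b' l₂ e => by
      have := h (b :: l₁) b' l₂ (by simp [e])
      simpa using this
    rw [List.foldl_nil, str_prod (b, l) (a, x), str_prod b l, str_prod l] at h1
    rw [str_cons]
    refine (Cmd.Run.loop_true rfl ((Cmd.Run.push0 (TapeSymbol.bit true) _ _ _ _).seq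
      (h1.seq (Cmd.Run.pop0 _ _ _ _ _))) h2).mono ?_
    simp only [List.length_cons, add_mul]
    omega

/-- Folds whose intermediate results have polynomial size. -/
theorem foldl {l : α → List β} {init : α → γ} {step : α → γ → β → γ} (hl : PolyT σ l)
    (hi : PolyT σ init) (hs : PolyT σ fun p : α × γ × β => step p.1 p.2.1 p.2.2)
    {B : α → ℕ} (hB : PolyBd B)
    (hb : ∀ x l', l' <+: l x → sz (l'.foldl (step x) (init x)) ≤ B x) :
    PolyT σ fun x => (l x).foldl (step x) (init x) := by
  have h0 := hl.pair (hi.pair (PolyT.id (σ := σ) (α := α)))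
  have h1 : PolyT σ fun p : (β × List β) × (γ × α) => (p.1.2, (step p.2.2 p.2.1 p.1.1, p.2.2)) :=
    pair (snd.comp fst) (pair (hs.comp (pair (snd.comp snd)
      (pair (fst.comp snd) (fst.comp fst)))) (snd.comp snd))
  obtain ⟨c0, t0, ht0, hc0⟩ := h0.exists_run
  obtain ⟨c1, p1, hc1⟩ := h1
  obtain ⟨c2, t2, ⟨p2, hp2⟩, hc2⟩ := (fst (σ := σ) (α := γ) (β := α)).exists_run
  -- This bounds the input of one round: list element and remaining list, accumulator, parameter.
  have hN : PolyBd fun x => sz (l x) + (B x + sz x + 1) + 1 :=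
    (hl.polyBd.add ((hB.add PolyBd.sz).add (PolyBd.const 1))).add (PolyBd.const 1)
  refine mk (.seq c0 (.seq (.pop 0) (.seq (.loop 0 isNode (.seq (.push 0 (.bit true))
      (.seq c1 (.pop 0)))) (.seq (.pop 0) c2))))
    (t := fun x => t0 x + (1 + ((sz (l x) * (p1.eval (sz (l x) + (B x + sz x + 1) + 1) + 3) + 1) +
      (1 + p2.eval (sz (l x) + (B x + sz x + 1) + 1)))))
    (ht0.add ((PolyBd.const 1).add (((hl.polyBd.mul ((hN.poly p1).add (PolyBd.const 3))).add
      (PolyBd.const 1)).add ((PolyBd.const 1).add (hN.poly p2)))))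
    (hB.of_le fun x => hb x _ List.prefix_rfl) fun x r => ?_
  refine (hc0 x r).seq ?_
  rw [str_prod]
  refine (Cmd.Run.pop0 _ _ _ _ _).seq ?_
  have hloop := run_foldLoop (step := step) (c := c1) x
    (p1.eval (sz (l x) + (B x + sz x + 1) + 1)) r (l x) (init x) fun l₁ b l₂ e => by
      refine ((hc1 ((b, l₂), (l₁.foldl (step x) (init x), x))).1 r).mono (polyEval_mono _ ?_)
      have h3 := hb x l₁ ⟨_, e.symm⟩
      have h4 := sz_append l₁ (b :: l₂)
      have h5 := sz_pos l₁
      rw [e]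
      simp only [sz_prod, sz_cons] at h4 ⊢
      omega
  refine (hloop.mono ?_).seq ((Cmd.Run.pop0 _ _ _ _ _).seq ((hc2 _ r).mono ((hp2 _).trans
    (polyEval_mono _ ?_))))
  · have := (length_lt_sz (l x)).le
    gcongr
  · have h3 := hb x _ List.prefix_rfl
    simp only [sz_prod]
    omega

end PolyT

end PolyTime

/-! ### Lists, Booleans, options and finite types in polynomial time -/

section PolyTimeLists

open Enc

instance {α : Type} [Enc α] : Enc (Option α) := ⟨fun o => enc o.toList⟩

instance : Enc Bool := ⟨fun b => enc (cond b [()] [])⟩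

instance : Enc ℕ := ⟨fun n => enc n.bits⟩

/-- Elements of a finite type are represented in unary. -/
noncomputable abbrev finEnc (α : Type) [Fintype α] : Enc α :=
  ⟨fun a => enc (List.replicate (Fintype.equivFin α a).val ())⟩

@[simp] theorem sz_none {α : Type} [Enc α] : sz (none : Option α) = 1 := rfl

@[simp] theorem sz_some {α : Type} [Enc α] (a : α) : sz (some a) = sz a + 2 := rfl

theorem sz_bool_le (b : Bool) : sz b ≤ 3 := by cases b <;> decide

namespace PolyT

variable {σ : Type} {α β γ δ ε : Type} [Enc α] [Enc β] [Enc γ] [Enc δ] [Enc ε]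

/-- Programs see only representations, so changing the type without changing the tree is free. This
transfers list case distinction to options, Booleans and numbers. -/
theorem congr_enc {f : α → β} {g : α → γ} (hg : PolyT σ g) (h : ∀ x, enc (f x) = enc (g x)) :
    PolyT σ f := by
  obtain ⟨c, p, hc⟩ := hg
  refine ⟨c, p, fun x => ?_⟩
  rw [h, show sz (f x) = sz (g x) from congrArg BT.size (h x)]
  exact hc x

/-- A program has finitely many branches, so the unary argument is inspected only up to depth `n`;
beyond it the branch for `n` is taken. -/
theorem natCases (n : ℕ) : ∀ (F : ℕ → α → β), (∀ i, PolyT σ (F i)) →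
    PolyT σ fun p : List Unit × α => F (min p.1.length n) p.2 := by
  induction n with
  | zero => intro F hF; exact ((hF 0).comp snd).of_eq (by simp)
  | succ n ih =>
    intro F hF
    refine (listCase (l := Prod.fst) (g := fun p => F 0 p.2)
      (h := fun p _ l' => F (min l'.length n + 1) p.2) fst ((hF 0).comp snd)
      ((ih (fun i => F (i + 1)) fun i => hF _).comp
        (pair (snd.comp fst) (snd.comp snd)))).of_eq fun p => ?_
    cases h : p.1 with
    | nil => simp
    | cons a l => simp [Nat.succ_min_succ]

/-- Case distinction on a finite type. -/
theorem finCases {Γ : Type} [Fintype Γ] [Nonempty Γ] {f : Γ → α → β}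
    (hf : ∀ a, PolyT σ (f a)) :
    let _ := finEnc Γ
    PolyT σ fun p : Γ × α => f p.1 p.2 := by
  let n := Fintype.card Γ
  -- The arbitrary element fills indices that represent no element of `Γ` and are never met.
  let G : ℕ → Γ := fun i => if h : i < n then (Fintype.equivFin Γ).symm ⟨i, h⟩
    else Classical.arbitrary Γ
  let _ := finEnc Γ
  have h1 := natCases (σ := σ) n (fun i => f (G i)) fun i => hf _
  have h2 : PolyT σ fun p : Γ × α =>
      (List.replicate (Fintype.equivFin Γ p.1).val (), p.2) := cast fun p => rfl
  refine (h1.comp h2).of_eq fun p => ?_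
  have : (Fintype.equivFin Γ p.1).val < n := (Fintype.equivFin Γ p.1).isLt
  simp [G, this.le, this]

theorem cond {c : α → Bool} {f g : α → β} (hc : PolyT σ c) (hf : PolyT σ f) (hg : PolyT σ g) :
    PolyT σ fun x => bif c x then f x else g x := by
  have h1 : PolyT σ fun x => (bif c x then [()] else []) := hc.congr_enc fun _ => rfl
  refine (listCase h1 hg (h := fun x _ _ => f x) (hf.comp snd)).of_eq fun x => ?_
  cases c x <;> rfl

theorem optionCase {o : α → Option β} {f : α → γ} {g : α → β → γ} (ho : PolyT σ o)
    (hf : PolyT σ f) (hg : PolyT σ fun p : α × β => g p.1 p.2) :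
    PolyT σ fun x => match o x with
      | none => f x
      | some b => g x b := by
  have h1 : PolyT σ fun x => (o x).toList := ho.congr_enc fun _ => rfl
  refine (listCase h1 hf (h := fun x b _ => g x b)
    (hg.comp (pair snd (fst.comp fst)))).of_eq fun x => ?_
  cases o x <;> rfl

theorem some {f : α → β} (hf : PolyT σ f) : PolyT σ fun x => Option.some (f x) :=
  (hf.pair (const ())).congr_enc fun _ => rfl

theorem cons {f : α → β} {g : α → List β} (hf : PolyT σ f) (hg : PolyT σ g) :
    PolyT σ fun x => f x :: g x :=
  (hf.pair hg).congr_enc fun _ => rfl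

theorem not {f : α → Bool} (hf : PolyT σ f) : PolyT σ fun x => !f x :=
  (cond hf (const false) (const true)).of_eq fun x => by cases f x <;> rfl

theorem and {f g : α → Bool} (hf : PolyT σ f) (hg : PolyT σ g) : PolyT σ fun x => f x && g x :=
  (cond hf hg (const false)).of_eq fun x => by cases f x <;> rfl

theorem or {f g : α → Bool} (hf : PolyT σ f) (hg : PolyT σ g) : PolyT σ fun x => f x || g x :=
  (cond hf (const true) hg).of_eq fun x => by cases f x <;> rfl

theorem tail {f : α → List β} (hf : PolyT σ f) : PolyT σ fun x => (f x).tail :=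
  (listCase hf (const []) (h := fun _ _ l => l) (snd.comp fst)).of_eq fun x => by
    cases f x <;> rfl

theorem headD {f : α → List β} {d : α → β} (hf : PolyT σ f) (hd : PolyT σ d) :
    PolyT σ fun x => (f x).headD (d x) :=
  (listCase hf hd (h := fun _ b _ => b) (fst.comp fst)).of_eq fun x => by
    cases f x <;> rfl

/-- Folds in which the sizes of the intermediate results, measured by `μ`, grow slowly. -/
theorem foldl_of_growth {l : α → List β} {init : α → γ} {step : α → γ → β → γ} (hl : PolyT σ l)
    (hi : PolyT σ init) (hs : PolyT σ fun p : α × γ × β => step p.1 p.2.1 p.2.2)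
    (μ : γ → ℕ) (Q : Polynomial ℕ) (hμ : ∀ s, sz s ≤ Q.eval (μ s)) {M K : α → ℕ}
    (hM : PolyBd M) (hK : PolyBd K) (h0 : ∀ x, μ (init x) ≤ M x)
    (h1 : ∀ x s b, μ (step x s b) ≤ μ s + sz b + K x) :
    PolyT σ fun x => (l x).foldl (step x) (init x) := by
  -- A round increases the measure by an additive amount, so the rounds sum to a polynomial; a
  -- constant factor per round would compound.
  have key : ∀ x (l' : List β) s, μ (l'.foldl (step x) s) ≤ μ s + sz l' + l'.length * K x := by
    intro x l'
    induction l' with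
    | nil => intro s; simp
    | cons b l' ih =>
      intro s
      have := ih (step x s b)
      have := h1 x s b
      simp only [List.foldl_cons, sz_cons, List.length_cons, add_mul]
      omega
  refine foldl (B := fun x => Q.eval (M x + sz (l x) + sz (l x) * K x)) hl hi hs
    (((hM.add hl.polyBd).add (hl.polyBd.mul hK)).poly Q) fun x l' hl' => ?_
  refine (hμ _).trans (polyEval_mono Q ((key x l' _).trans ?_))
  have e1 := sz_le_of_prefix hl'
  have e2 := (length_lt_sz l').le.trans e1
  gcongr
  exact h0 x

theorem foldl_of_le {l : α → List β} {init : α → γ} {step : α → γ → β → γ} (hl : PolyT σ l)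
    (hi : PolyT σ init) (hs : PolyT σ fun p : α × γ × β => step p.1 p.2.1 p.2.2) (K : ℕ)
    (h1 : ∀ x s b, sz (step x s b) ≤ sz s + sz b + K) :
    PolyT σ fun x => (l x).foldl (step x) (init x) :=
  foldl_of_growth hl hi hs sz .X (by simp) hi.polyBd (PolyBd.const K) (fun _ => le_rfl) h1

theorem reverse {l : α → List β} (hl : PolyT σ l) : PolyT σ fun x => (l x).reverse :=
  (foldl_of_le hl (const []) (step := fun _ s b => b :: s)
    (cons (snd.comp snd) (fst.comp snd)) 1 (by intros; simp; omega)).of_eq fun x => by simp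

theorem foldr_of_growth {l : α → List β} {init : α → γ} {step : α → β → γ → γ} (hl : PolyT σ l)
    (hi : PolyT σ init) (hs : PolyT σ fun p : α × β × γ => step p.1 p.2.1 p.2.2)
    (μ : γ → ℕ) (Q : Polynomial ℕ) (hμ : ∀ s, sz s ≤ Q.eval (μ s)) {M K : α → ℕ}
    (hM : PolyBd M) (hK : PolyBd K) (h0 : ∀ x, μ (init x) ≤ M x)
    (h1 : ∀ x s b, μ (step x b s) ≤ μ s + sz b + K x) :
    PolyT σ fun x => (l x).foldr (step x) (init x) :=
  (foldl_of_growth hl.reverse hi (step := fun x s b => step x b s)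
    (hs.comp (pair fst (pair (snd.comp snd) (fst.comp snd)))) μ Q hμ hM hK h0 h1).of_eq
    fun x => by simp

theorem foldr_of_le {l : α → List β} {init : α → γ} {step : α → β → γ → γ} (hl : PolyT σ l)
    (hi : PolyT σ init) (hs : PolyT σ fun p : α × β × γ => step p.1 p.2.1 p.2.2) (K : ℕ)
    (h1 : ∀ x s b, sz (step x b s) ≤ sz s + sz b + K) :
    PolyT σ fun x => (l x).foldr (step x) (init x) :=
  foldr_of_growth hl hi hs sz .X (by simp) hi.polyBd (PolyBd.const K) (fun _ => le_rfl) h1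

theorem append {f g : α → List β} (hf : PolyT σ f) (hg : PolyT σ g) :
    PolyT σ fun x => f x ++ g x :=
  (foldr_of_le hf hg (step := fun _ b s => b :: s)
    (cons (fst.comp snd) (snd.comp snd)) 1 (by intros; simp; omega)).of_eq fun x => by simp

/-- The values of `g` may be polynomially larger than their arguments, so additive growth is not
available. Instead every element occurring in the list is at most as large as the list, which bounds
each value uniformly. -/
theorem map {l : α → List β} {g : α → β → γ} (hl : PolyT σ l)
    (hg : PolyT σ fun p : α × β => g p.1 p.2) : PolyT σ fun x => (l x).map (g x) := by
  obtain ⟨q, hq⟩ := hg.polyBd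
  have hC : PolyBd fun x => sz x + sz (l x) + 1 :=
    (PolyBd.sz.add hl.polyBd).add (PolyBd.const 1)
  refine (reverse (foldl (step := fun x s b => g x b :: s) (init := fun _ => []) hl (const [])
    (cons (hg.comp (pair fst (snd.comp snd))) (fst.comp snd))
    (B := fun x => sz (l x) * (q.eval (sz x + sz (l x) + 1) + 1) + 1)
    ((hl.polyBd.mul ((hC.poly q).add (PolyBd.const 1))).add (PolyBd.const 1))
    fun x l' hl' => ?_)).of_eq fun x => ?_
  · have e : l'.foldl (fun s b => g x b :: s) [] = (l'.map (g x)).reverse := by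
      rw [← List.foldl_map (f := g x) (g := fun s c => c :: s)]; simp
    rw [e, sz_reverse]
    have e1 := sz_le_of_prefix hl'
    have e2 := (length_lt_sz l').le.trans e1
    refine (sz_le_mul _ (q.eval (sz x + sz (l x) + 1)) fun c hc => ?_).trans ?_
    · obtain ⟨b, hb, rfl⟩ := List.mem_map.1 hc
      have e3 := sz_le_of_mem hb
      refine (hq (x, b)).trans (polyEval_mono q ?_)
      rw [sz_prod]
      simp only
      omega
    · rw [List.length_map]
      gcongr
  · have e : (l x).foldl (fun s b => g x b :: s) [] = ((l x).map (g x)).reverse := by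
      rw [← List.foldl_map (f := g x) (g := fun s c => c :: s)]; simp
    rw [e, List.reverse_reverse]

theorem all {l : α → List β} {g : α → β → Bool} (hl : PolyT σ l)
    (hg : PolyT σ fun p : α × β => g p.1 p.2) : PolyT σ fun x => (l x).all (g x) :=
  (foldr_of_le hl (const true) (step := fun x b s => g x b && s)
    (and (hg.comp (pair fst (fst.comp snd))) (snd.comp snd)) 3
    (by intro x s b; have := sz_bool_le (g x b && s); omega)).of_eq fun x => by
      induction l x <;> simp [*]

theorem any {l : α → List β} {g : α → β → Bool} (hl : PolyT σ l)
    (hg : PolyT σ fun p : α × β => g p.1 p.2) : PolyT σ fun x => (l x).any (g x) :=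
  (foldr_of_le hl (const false) (step := fun x b s => g x b || s)
    (or (hg.comp (pair fst (fst.comp snd))) (snd.comp snd)) 3
    (by intro x s b; have := sz_bool_le (g x b || s); omega)).of_eq fun x => by
      induction l x <;> simp [*]

/-- Fold over the first list; the state carries the unread part of the second list and the pairs
formed so far, in reverse order. -/
theorem zip {f : α → List β} {g : α → List γ} (hf : PolyT σ f) (hg : PolyT σ g) :
    PolyT σ fun x => (f x).zip (g x) := by
  let step : List γ × List (β × γ) → β → List γ × List (β × γ) := fun s b =>
    match s.1 with
    | [] => s
    | c :: l => (l, (b, c) :: s.2)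
  have hs : PolyT σ fun p : α × (List γ × List (β × γ)) × β => step p.2.1 p.2.2 :=
    listCase (l := fun p : α × (List γ × List (β × γ)) × β => p.2.1.1) (g := fun p => p.2.1)
      (h := fun p c l => (l, (p.2.2, c) :: p.2.1.2)) (fst.comp (fst.comp snd)) (fst.comp snd)
      (pair (snd.comp fst) (cons (pair (snd.comp (snd.comp snd)) (fst.comp fst))
        (snd.comp (fst.comp (snd.comp snd)))))
  refine (reverse (snd.comp (foldl_of_le (step := fun _ => step) hf (pair hg (const [])) hs 2 fun x s b => ?_))).of_eq
    fun x => ?_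
  · obtain ⟨l, m⟩ := s
    cases l <;> simp [step] <;> omega
  · have : ∀ (l : List β) (m : List γ) (acc : List (β × γ)),
        (l.foldl step (m, acc)).2.reverse = acc.reverse ++ l.zip m := by
      intro l
      induction l with
      | nil => simp
      | cons b l ih =>
        intro m acc
        cases m with
        | nil => simpa [step] using ih [] acc
        | cons c m => simpa [step] using ih m ((b, c) :: acc)
    simpa using this (f x) (g x) []

theorem zipWith {f : α → List β} {g : α → List γ} {h : α → β → γ → δ} (hf : PolyT σ f)
    (hg : PolyT σ g) (hh : PolyT σ fun p : α × β × γ => h p.1 p.2.1 p.2.2) :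
    PolyT σ fun x => (f x).zipWith (h x) (g x) :=
  (map (zip hf hg) (g := fun x p => h x p.1 p.2) hh).of_eq fun x => by
    rw [List.zip, List.map_zipWith]

/-- The columns of a matrix given by its rows. -/
def _root_.transposeRows (l : List (List β)) : List (List β) :=
  l.foldr (fun row acc => List.zipWith List.cons row acc) ((l.headD []).map fun _ => [])

theorem transpose {f : α → List (List β)} (hf : PolyT σ f) :
    PolyT σ fun x => transposeRows (f x) := by
  refine foldr_of_le hf (map (headD hf (const [])) (g := fun _ _ => []) (const []))
    (step := fun _ row acc => List.zipWith List.cons row acc)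
    (zipWith (fst.comp snd) (snd.comp snd) (h := fun _ a b => a :: b)
      (cons (fst.comp snd) (snd.comp snd))) 0 fun x s b => ?_
  induction b generalizing s with
  | nil => simp
  | cons a b ih =>
    cases s with
    | nil => simp
    | cons c s => have := ih s; simp at *; omega

end PolyT

end PolyTimeLists

/-! ### Binary arithmetic in polynomial time -/

section PolyTimeNat

open Enc

theorem Nat.foldr_bit_bits (n : ℕ) : n.bits.foldr Nat.bit 0 = n := by
  induction n using Nat.binaryRec' with
  | zero => simp
  | bit b n h ih => rw [Nat.bits_append_bit n b h, List.foldr_cons, ih]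

/-- Both notations list the bits from the least significant one without superfluous zeros, so the
tape encoding can be treated through `Nat.bits`. -/
theorem encodeNat_eq_bits (n : ℕ) : Computability.encodeNat n = n.bits := by
  have key : ∀ p : PosNum, Computability.encodePosNum p = (p : ℕ).bits := by
    intro p
    induction p with
    | one => simp [Computability.encodePosNum]
    | bit0 p ih =>
      have h : ((PosNum.bit0 p : PosNum) : ℕ) = Nat.bit false p := by simp [Nat.bit]; omega
      rw [h, Nat.bits_append_bit _ _ (fun h => absurd h (PosNum.cast_pos p).ne'), ← ih]
      rfl
    | bit1 p ih =>
      have h : ((PosNum.bit1 p : PosNum) : ℕ) = Nat.bit true p := by simp [Nat.bit]; omega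
      rw [h, Nat.bits_append_bit _ _ (fun _ => rfl), ← ih]
      rfl
  have h2 : ∀ m : Num, Computability.encodeNum m = (m : ℕ).bits := by
    intro m
    cases m with
    | zero => simp [Computability.encodeNum]
    | pos p => exact key p
  rw [Computability.encodeNat, h2, Num.to_of_nat]

theorem sz_nat_le (n : ℕ) : sz n ≤ 4 * n.size + 1 := by
  have : ∀ l : List Bool, sz l ≤ 4 * l.length + 1 := by
    intro l
    have := sz_le_mul l 3 fun b _ => sz_bool_le b
    omega
  exact (this n.bits).trans (by rw [Nat.size_eq_bits_len])

theorem size_le_sz (n : ℕ) : n.size < sz n := by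
  rw [← Nat.size_eq_bits_len]
  exact length_lt_sz n.bits

namespace PolyT

variable {σ : Type} {α β γ : Type} [Enc α] [Enc β] [Enc γ]

theorem bits {f : α → ℕ} (hf : PolyT σ f) : PolyT σ fun x => (f x).bits :=
  hf.congr_enc fun _ => rfl

/-- Prepending the bit is correct except for the bit `false` in front of zero, where the canonical
list of bits must remain empty. -/
theorem natBit {b : α → Bool} {f : α → ℕ} (hb : PolyT σ b) (hf : PolyT σ f) :
    PolyT σ fun x => Nat.bit (b x) (f x) := by
  have h : PolyT σ fun x => match (f x).bits with
      | [] => bif b x then [true] else []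
      | c :: l => b x :: c :: l :=
    (listCase hf.bits (cond hb (const [true]) (const [])) (h := fun x c l => b x :: c :: l)
      (cons (hb.comp snd) (cons (fst.comp fst) (snd.comp fst)))).of_eq fun x => by
        cases (f x).bits <;> rfl
  refine h.congr_enc fun x => ?_
  change enc (Nat.bit (b x) (f x)).bits = _
  cases e : (f x).bits with
  | nil =>
    have : f x = 0 := by rw [← Nat.foldr_bit_bits (f x), e]; rfl
    rw [this]
    cases b x <;> simp
  | cons c l =>
    rw [Nat.bits_append_bit _ _ fun h0 => by simp [h0] at e, e]

theorem size_bit_le (b : Bool) (n : ℕ) : (Nat.bit b n).size ≤ n.size + 1 := by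
  rw [Nat.size_le, pow_succ]
  have := Nat.lt_size_self n
  cases b <;> simp [Nat.bit] <;> omega

theorem sz_natPair_le (s : ℕ × ℕ) :
    sz s ≤ ((8 * .X + 3 : Polynomial ℕ)).eval (max s.1.size s.2.size) := by
  have := sz_nat_le s.1
  have := sz_nat_le s.2
  simp
  omega

/-- The bits of two numbers, padded with zeros. -/
def _root_.padZip (l m : List Bool) : List (Bool × Bool) :=
  (l ++ m.map fun _ => false).zip (m ++ l.map fun _ => false)

theorem padZip {f g : α → List Bool} (hf : PolyT σ f) (hg : PolyT σ g) :
    PolyT σ fun x => _root_.padZip (f x) (g x) :=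
  zip (append hf (map hg (const false))) (append hg (map hf (const false)))

theorem _root_.foldr_bit_append_false (l : List Bool) (m : List Bool) :
    (l ++ m.map fun _ => false).foldr Nat.bit 0 = l.foldr Nat.bit 0 := by
  have : (m.map fun _ => false).foldr Nat.bit 0 = 0 := by
    induction m with
    | nil => rfl
    | cons a m ih => simp at *; simp [ih]
  rw [List.foldr_append, this]

theorem _root_.padZip_fst (l m : List Bool) :
    ((_root_.padZip l m).map Prod.fst).foldr Nat.bit 0 = l.foldr Nat.bit 0 := by
  rw [_root_.padZip, List.map_fst_zip (by simp [add_comm]), foldr_bit_append_false]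

theorem _root_.padZip_snd (l m : List Bool) :
    ((_root_.padZip l m).map Prod.snd).foldr Nat.bit 0 = m.foldr Nat.bit 0 := by
  rw [_root_.padZip, List.map_snd_zip (by simp [add_comm]), foldr_bit_append_false]

/-- One step of the addition of two binary numbers: from `(s, s + 1)` to `(s', s' + 1)`. -/
def addStep (b : Bool × Bool) (s : ℕ × ℕ) : ℕ × ℕ :=
  bif b.1 && b.2 then (Nat.bit false s.2, Nat.bit true s.2)
  else bif b.1 || b.2 then (Nat.bit true s.1, Nat.bit false s.2)
  else (Nat.bit false s.1, Nat.bit true s.1)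

/-- The right fold meets the most significant bits first, before the carry from below is known.
Hence the sums without and with an incoming carry are both maintained. -/
theorem add {f g : α → ℕ} (hf : PolyT σ f) (hg : PolyT σ g) : PolyT σ fun x => f x + g x := by
  have hs : PolyT σ fun p : α × (Bool × Bool) × (ℕ × ℕ) => addStep p.2.1 p.2.2 := by
    have b1 : PolyT σ fun p : α × (Bool × Bool) × (ℕ × ℕ) => p.2.1.1 := fst.comp (fst.comp snd)
    have b2 : PolyT σ fun p : α × (Bool × Bool) × (ℕ × ℕ) => p.2.1.2 := snd.comp (fst.comp snd)
    have s1 : PolyT σ fun p : α × (Bool × Bool) × (ℕ × ℕ) => p.2.2.1 := fst.comp (snd.comp snd)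
    have s2 : PolyT σ fun p : α × (Bool × Bool) × (ℕ × ℕ) => p.2.2.2 := snd.comp (snd.comp snd)
    exact cond (and b1 b2) (pair (natBit (const false) s2) (natBit (const true) s2))
      (cond (or b1 b2) (pair (natBit (const true) s1) (natBit (const false) s2))
        (pair (natBit (const false) s1) (natBit (const true) s1)))
  have h : PolyT σ fun x => (_root_.padZip (f x).bits (g x).bits).foldr addStep (0, 1) := by
    refine foldr_of_growth (step := fun _ => addStep) (padZip hf.bits hg.bits) (const (0, 1)) hs
      (fun s => max s.1.size s.2.size) _ sz_natPair_le (M := fun _ => 1) (K := fun _ => 1)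
      (PolyBd.const 1) (PolyBd.const 1) (fun x => by simp) fun x s b => ?_
    have h1 := size_bit_le true s.1
    have h2 := size_bit_le false s.1
    have h3 := size_bit_le true s.2
    have h4 := size_bit_le false s.2
    obtain ⟨b1, b2⟩ := b
    cases b1 <;> cases b2 <;> simp only [addStep, Bool.and_true, Bool.and_false, Bool.or_true,
      Bool.or_false, cond_true, cond_false] <;> omega
  have key : ∀ l : List (Bool × Bool), l.foldr addStep (0, 1) =
      ((l.map Prod.fst).foldr Nat.bit 0 + (l.map Prod.snd).foldr Nat.bit 0,
      (l.map Prod.fst).foldr Nat.bit 0 + (l.map Prod.snd).foldr Nat.bit 0 + 1) := by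
    intro l
    induction l with
    | nil => rfl
    | cons b l ih =>
      obtain ⟨b1, b2⟩ := b
      rw [List.foldr_cons, ih]
      cases b1 <;> cases b2 <;> simp [addStep, Nat.bit] <;> omega
  refine (fst.comp h).of_eq fun x => ?_
  rw [key, padZip_fst, padZip_snd, Nat.foldr_bit_bits, Nat.foldr_bit_bits]

/-- One step of the subtraction of two binary numbers: from `(s, s - 1)` to `(s', s' - 1)`. -/
def subStep (b : Bool × Bool) (s : ℕ × ℕ) : ℕ × ℕ :=
  bif b.1 && !b.2 then (Nat.bit true s.1, Nat.bit false s.1)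
  else bif !b.1 && b.2 then (Nat.bit true s.2, Nat.bit false s.2)
  else (Nat.bit false s.1, Nat.bit true s.2)

/-- Subtraction of binary numbers, meaningful if the result is nonnegative. -/
def _root_.binSub (m n : ℕ) : ℕ := ((_root_.padZip m.bits n.bits).foldr subStep (0, 0)).1

/-- As for addition, both borrow cases are carried along. The second component is the predecessor of
the first only when the difference of the leading parts is nonzero; it is needed only then, because
the leading parts of `m` and `n` compare in the same direction. -/
theorem _root_.binSub_eq {m n : ℕ} (h : n ≤ m) : binSub m n = m - n := by
  have : ∀ l : List (Bool × Bool),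
      (l.map Prod.snd).foldr Nat.bit 0 ≤ (l.map Prod.fst).foldr Nat.bit 0 →
      (l.foldr subStep (0, 0)).1 + (l.map Prod.snd).foldr Nat.bit 0 =
        (l.map Prod.fst).foldr Nat.bit 0 ∧
      ((l.foldr subStep (0, 0)).1 ≠ 0 →
        (l.foldr subStep (0, 0)).2 + 1 = (l.foldr subStep (0, 0)).1) := by
    intro l
    induction l with
    | nil => simp
    | cons b l ih =>
      obtain ⟨b1, b2⟩ := b
      simp only [List.map_cons, List.foldr_cons]
      generalize (l.map Prod.snd).foldr Nat.bit 0 = v at *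
      generalize (l.map Prod.fst).foldr Nat.bit 0 = u at *
      generalize l.foldr subStep (0, 0) = s at *
      intro h
      have hle : v ≤ u := by
        cases b1 <;> cases b2 <;> simp [Nat.bit] at h <;> omega
      obtain ⟨h1, h2⟩ := ih hle
      cases b1 <;> cases b2 <;> simp [subStep, Nat.bit] at h ⊢ <;> omega
  have h1 := (this (_root_.padZip m.bits n.bits)
    (by rwa [padZip_fst, padZip_snd, Nat.foldr_bit_bits, Nat.foldr_bit_bits])).1
  rw [padZip_fst, padZip_snd, Nat.foldr_bit_bits, Nat.foldr_bit_bits] at h1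
  rw [binSub]
  omega

theorem sub {f g : α → ℕ} (hf : PolyT σ f) (hg : PolyT σ g) :
    PolyT σ fun x => binSub (f x) (g x) := by
  have hs : PolyT σ fun p : α × (Bool × Bool) × (ℕ × ℕ) => subStep p.2.1 p.2.2 := by
    have b1 : PolyT σ fun p : α × (Bool × Bool) × (ℕ × ℕ) => p.2.1.1 := fst.comp (fst.comp snd)
    have b2 : PolyT σ fun p : α × (Bool × Bool) × (ℕ × ℕ) => p.2.1.2 := snd.comp (fst.comp snd)
    have s1 : PolyT σ fun p : α × (Bool × Bool) × (ℕ × ℕ) => p.2.2.1 := fst.comp (snd.comp snd)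
    have s2 : PolyT σ fun p : α × (Bool × Bool) × (ℕ × ℕ) => p.2.2.2 := snd.comp (snd.comp snd)
    exact cond (and b1 (not b2)) (pair (natBit (const true) s1) (natBit (const false) s1))
      (cond (and (not b1) b2) (pair (natBit (const true) s2) (natBit (const false) s2))
        (pair (natBit (const false) s1) (natBit (const true) s2)))
  refine fst.comp (foldr_of_growth (padZip hf.bits hg.bits) (const (0, 0)) hs
    (fun s => max s.1.size s.2.size) _ sz_natPair_le (PolyBd.const 1) (PolyBd.const 1)
    (fun x => by simp) fun x s b => ?_)
  have h1 := size_bit_le true s.1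
  have h2 := size_bit_le false s.1
  have h3 := size_bit_le true s.2
  have h4 := size_bit_le false s.2
  obtain ⟨b1, b2⟩ := b
  cases b1 <;> cases b2 <;> simp only [subStep, Bool.and_true, Bool.and_false,
    Bool.not_true, Bool.not_false, cond_true, cond_false] <;> omega

theorem _root_.Nat.size_add_le (m n : ℕ) : (m + n).size ≤ m.size + n.size + 1 := by
  rw [Nat.size_le]
  have h1 := Nat.lt_size_self m
  have h2 := Nat.lt_size_self n
  have h3 : 2 ^ m.size ≤ 2 ^ (m.size + n.size) := Nat.pow_le_pow_right (by norm_num) (by omega)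
  have h4 : 2 ^ n.size ≤ 2 ^ (m.size + n.size) := Nat.pow_le_pow_right (by norm_num) (by omega)
  rw [pow_succ]
  omega

/-- Horner's scheme. Measured in binary digits, a doubling followed by an addition grows the
accumulator by a bounded number of digits per round. -/
theorem mul {f g : α → ℕ} (hf : PolyT σ f) (hg : PolyT σ g) : PolyT σ fun x => f x * g x := by
  have hs : PolyT σ fun p : α × Bool × ℕ => Nat.bit false p.2.2 + (bif p.2.1 then g p.1 else 0) :=
    add (natBit (const false) (snd.comp snd)) (cond (fst.comp snd) (hg.comp fst) (const 0))
  refine (foldr_of_growth (step := fun x b s => Nat.bit false s + (bif b then g x else 0))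
    hf.bits (const 0) hs Nat.size (4 * .X + 1)
    (fun s => by simpa using sz_nat_le s) (M := fun _ => 0) (K := fun x => sz (g x) + 2)
    (PolyBd.const 0)
    (hg.polyBd.add (PolyBd.const 2)) (fun x => by simp) fun x s b => ?_).of_eq fun x => ?_
  · have h1 := Nat.size_add_le (Nat.bit false s) (bif b then g x else 0)
    have h2 := size_bit_le false s
    have h3 : (bif b then g x else 0).size ≤ (g x).size := by cases b <;> simp
    have h4 := size_le_sz (g x)
    omega
  · have : ∀ l : List Bool, l.foldr (fun b s => Nat.bit false s + (bif b then g x else 0)) 0 =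
        l.foldr Nat.bit 0 * g x := by
      intro l
      induction l with
      | nil => simp
      | cons b l ih =>
        rw [List.foldr_cons, ih, List.foldr_cons]
        cases b <;> simp [Nat.bit] <;> ring
    rw [this, Nat.foldr_bit_bits]

end PolyT

end PolyTimeNat

/-! ### From tree programs to machines reading and writing words -/

section Wrap

open Enc

instance {σ : Type} [Finite σ] : Finite (TapeSymbol σ) :=
  Finite.of_surjective (fun x : Bool ⊕ σ ⊕ Fin 4 => match x with
    | .inl b => TapeSymbol.bit b
    | .inr (.inl R) => .label R
    | .inr (.inr 0) => .noEdge
    | .inr (.inr 1) => .endNumber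
    | .inr (.inr 2) => .endRow
    | .inr (.inr 3) => .endGraph) fun s => by
  cases s with
  | bit b => exact ⟨.inl b, rfl⟩
  | label R => exact ⟨.inr (.inl R), rfl⟩
  | noEdge => exact ⟨.inr (.inr 0), rfl⟩
  | endNumber => exact ⟨.inr (.inr 1), rfl⟩
  | endRow => exact ⟨.inr (.inr 2), rfl⟩
  | endGraph => exact ⟨.inr (.inr 3), rfl⟩

noncomputable instance {σ : Type} [Finite σ] : Fintype (TapeSymbol σ) := Fintype.ofFinite _

instance {σ : Type} : Nonempty (TapeSymbol σ) := ⟨.noEdge⟩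

variable {σ : Type} [Fintype σ]

noncomputable instance : Enc (TapeSymbol σ) := finEnc _

theorem sz_symbol_le (a : TapeSymbol σ) : sz a ≤ 2 * Fintype.card (TapeSymbol σ) + 1 := by
  have := sz_le_mul (List.replicate (Fintype.equivFin _ a).val ()) 1 (by simp)
  have h2 := (Fintype.equivFin _ a).isLt
  refine this.trans ?_
  rw [List.length_replicate]
  omega

namespace Cmd

/-- Read the word on stack `1` into a list of symbols on stack `0`. -/
noncomputable def readInput : Cmd (TapeSymbol σ) :=
  loop 1 Option.isSome (cases 1 fun
    | some a => seq (pop 1) (pushWord (.bit true :: (enc a).str))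
    | none => pop 1)

/-- Prepending the symbols one at a time reverses the word, whence the reversed words in the
representation of inputs. -/
theorem Run.readInput (w : List (TapeSymbol σ)) : ∀ acc : List (TapeSymbol σ),
    Run Cmd.readInput ![(enc acc).str, w, [], []] ![(enc (w.reverse ++ acc)).str, [], [], []]
      (w.length * (2 * Fintype.card (TapeSymbol σ) + 6) + 1) := by
  induction w with
  | nil => intro acc; exact (Run.loop_false rfl).mono (by simp)
  | cons a w ih =>
    intro acc
    have h1 := Run.pushWord (.bit true :: (enc a).str) (enc acc).str w [] []
    have e : TapeSymbol.bit (σ := σ) true :: (enc a).str ++ (enc acc).str = (enc (a :: acc)).str := by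
      simpa using (PolyT.str_cons a acc []).symm
    rw [e] at h1
    have h2 := ih (a :: acc)
    rw [List.reverse_cons, List.append_assoc, List.singleton_append]
    refine (Run.loop_true rfl (Run.cases (o := some a) rfl ((Run.pop1 a _ _ _ _).seq h1)) h2).mono ?_
    have h3 := sz_symbol_le a
    rw [List.length_cons, BT.length_str, List.length_cons, add_mul]
    unfold sz at h3
    omega

/-- Read a number in unary on stack `0` and push a symbol depending on it on stack `1`. -/
def readUnary : ℕ → (ℕ → TapeSymbol σ) → Cmd (TapeSymbol σ)
  | 0, g => seq (pop 0) (push 1 (g 0))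
  | n + 1, g => cases 0 fun
    | some (.bit true) => seq (pop 0) (seq (pop 0) (readUnary n fun i => g (i + 1)))
    | _ => seq (pop 0) (push 1 (g 0))

-- A unary cell consists of a node symbol and the leaf of its unit, so each unit costs two pops.
omit [Fintype σ] in
theorem Run.readUnary (r s : List (TapeSymbol σ)) : ∀ (n : ℕ) (g : ℕ → TapeSymbol σ) (i : ℕ),
    i ≤ n → Run (Cmd.readUnary n g) ![(enc (List.replicate i ())).str ++ r, s, [], []]
      ![r, g i :: s, [], []] (3 * n + 3) := by
  intro n
  induction n with
  | zero =>
    intro g i hi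
    obtain rfl : i = 0 := by omega
    exact Run.mono ((Run.pop0 _ _ _ _ _).seq (Run.push1 _ _ _ _ _)) (by omega)
  | succ n ih =>
    intro g i hi
    cases i with
    | zero =>
      exact Run.mono (Run.cases (n := 2) (o := some (.bit false)) rfl
        ((Run.pop0 _ _ _ _ _).seq (Run.push1 _ _ _ _ _))) (by omega)
    | succ i =>
      rw [List.replicate_succ, PolyT.str_cons]
      exact Run.mono (Run.cases (n := 1 + (1 + (3 * n + 3))) (o := some (.bit true)) rfl
        ((Run.pop0 _ _ _ _ _).seq ((Run.pop0 _ _ _ _ _).seq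
          (ih (fun i => g (i + 1)) i (by omega))))) (by omega)

/-- Read a symbol on stack `0` and push it on stack `1`. -/
noncomputable def readSymbol : Cmd (TapeSymbol σ) :=
  readUnary (Fintype.card (TapeSymbol σ)) fun i =>
    if h : i < Fintype.card (TapeSymbol σ) then (Fintype.equivFin _).symm ⟨i, h⟩ else .noEdge

theorem Run.readSymbol (a : TapeSymbol σ) (r s : List (TapeSymbol σ)) :
    Run Cmd.readSymbol ![(enc a).str ++ r, s, [], []] ![r, a :: s, [], []]
      (3 * Fintype.card (TapeSymbol σ) + 3) := by
  have h := (Fintype.equivFin _ a).isLt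
  have := Run.readUnary r s (Fintype.card (TapeSymbol σ)) (fun i =>
    if h : i < Fintype.card (TapeSymbol σ) then (Fintype.equivFin _).symm ⟨i, h⟩ else .noEdge)
    (Fintype.equivFin _ a) h.le
  simp only [h, dite_true, Fin.eta, Equiv.symm_apply_apply] at this
  exact this

/-- Write the list of symbols on stack `0` as a word on stack `2`. -/
noncomputable def writeOutput : Cmd (TapeSymbol σ) :=
  seq (loop 0 PolyT.isNode (seq (pop 0) readSymbol)) (seq (pop 0) (drain 1 2))

theorem Run.writeLoop (w : List (TapeSymbol σ)) : ∀ s : List (TapeSymbol σ),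
    Run (Cmd.loop 0 PolyT.isNode (Cmd.seq (Cmd.pop 0) Cmd.readSymbol)) ![(enc w).str, s, [], []]
      ![[.bit false], w.reverse ++ s, [], []]
      (w.length * (3 * Fintype.card (TapeSymbol σ) + 5) + 1) := by
  induction w with
  | nil => intro s; exact (Run.loop_false rfl).mono (by simp)
  | cons a w ih =>
    intro s
    have e : (enc (a :: w)).str = TapeSymbol.bit (σ := σ) true :: ((enc a).str ++ (enc w).str) := by
      simpa using PolyT.str_cons a w []
    rw [e, List.reverse_cons, List.append_assoc, List.singleton_append]
    refine (Run.loop_true rfl ((Run.pop0 _ _ _ _ _).seq (Run.readSymbol a _ s)) (ih (a :: s))).mono ?_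
    rw [List.length_cons, add_mul]
    omega

theorem Run.writeOutput (w : List (TapeSymbol σ)) :
    Run Cmd.writeOutput ![(enc w).str, [], [], []] ![[], [], w, []]
      (w.length * (3 * Fintype.card (TapeSymbol σ) + 9) + 3) := by
  have h1 := Run.writeLoop w []
  have h2 := Run.pop0 (TapeSymbol.bit (σ := σ) false) [] (w.reverse ++ []) [] []
  have h3 := Run.drain12 [] (w.reverse ++ []) [] []
  simp only [List.append_nil, List.reverse_reverse, List.length_reverse] at *
  refine (h1.seq (h2.seq h3)).mono ?_
  simp only [mul_add]
  omega

end Cmd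

/-- A function whose output word is computed in polynomial time from the list of symbols of the
(reversed) input word is computed by a Turing machine in polynomial time. -/
theorem PolyT.computable {α β : Type} (ea : α → List (TapeSymbol σ))
    (eb : β → List (TapeSymbol σ)) (f : α → β)
    (h : let _ : Enc α := ⟨fun x => enc (ea x).reverse⟩
      PolyT σ fun x => eb (f x)) :
    Nonempty (Turing.TM2ComputableInPolyTime ea eb f) := by
  let _ : Enc α := ⟨fun x => enc (ea x).reverse⟩
  obtain ⟨c, p, hc⟩ := h
  let N := Fintype.card (TapeSymbol σ)
  -- Each symbol takes at most `2 * N + 1` nodes, so the tree of the input word is linear in its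
  -- length.
  let P : Polynomial ℕ := p.comp (.C (2 * N + 2) * .X + 1)
  have hcomp : ∀ x, ∃ t ≤ (1 + ((.C (2 * N + 6) * .X + 1) + (P + (P * .C (3 * N + 9) + 3))) :
      Polynomial ℕ).eval (ea x).length,
      Cmd.Exec (.seq (.push 0 (.bit false)) (.seq Cmd.readInput (.seq c Cmd.writeOutput)))
        ![[], ea x, [], []] ![[], [], eb (f x), []] t := by
    intro x
    obtain ⟨h1, h2⟩ := hc x
    have h3 := h1 []
    have hsz : p.eval (sz x) ≤ P.eval (ea x).length := by
      simp only [P, Polynomial.eval_comp, Polynomial.eval_add, Polynomial.eval_mul,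
        Polynomial.eval_C, Polynomial.eval_X, Polynomial.eval_one]
      refine polyEval_mono p ?_
      have := sz_le_mul (ea x) (2 * N + 1) fun a _ => sz_symbol_le a
      refine ((sz_reverse (ea x)).le.trans this).trans ?_
      rw [mul_comm]
    have h4 := Cmd.Run.readInput (ea x) []
    have h5 := Cmd.Run.writeOutput (eb (f x))
    rw [List.append_nil] at h4 h3
    rw [List.append_nil] at h3
    refine Cmd.Run.mono ((Cmd.Run.push0 _ _ _ _ _).seq (h4.seq (h3.seq h5))) ?_
    have h6 := (length_lt_sz (eb (f x))).le.trans (h2.trans hsz)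
    simp only [Polynomial.eval_add, Polynomial.eval_mul,
        Polynomial.eval_C, Polynomial.eval_X, Polynomial.eval_one, Polynomial.eval_ofNat]
    have h7 := Nat.mul_le_mul_right (3 * N + 9) h6
    rw [mul_comm (ea x).length]
    change 1 + ((2 * N + 6) * (ea x).length + 1 + (p.eval (sz x) +
      ((eb (f x)).length * (3 * N + 9) + 3))) ≤ _
    omega
  exact Cmd.computableInPolyTime _ _ hcomp

end Wrap

/-! ### Downward trees, lineages and `β`-acyclicity -/

namespace LabeledGraph

variable {σ U V : Type}

/-- The parent function and the depth function of a downward tree with root `r`. -/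
structure TreeData (H : LabeledGraph σ V) where
  root : V
  par : V → V
  depth : V → ℕ
  edge_root : ∀ u, H.edge u root = none
  par_eq : ∀ {u v}, (H.edge u v).isSome → par v = u
  depth_eq : ∀ {u v}, (H.edge u v).isSome → depth v = depth u + 1
  edge_par : ∀ {v}, v ≠ root → (H.edge (par v) v).isSome
  depth_root : depth root = 0

/-- Reachability from the root shows that iterating the parent function ends at the root; the depth
is the least number of iterations needed. -/
theorem IsDownwardTree.nonempty_treeData {H : LabeledGraph σ V} (h : H.IsDownwardTree) :
    Nonempty H.TreeData := by
  classical
  obtain ⟨r, h1, h2, h3⟩ := h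
  let par : V → V := fun v => if hv : v ≠ r then (h2 v hv).choose else r
  have hpar : ∀ {v}, v ≠ r → (H.edge (par v) v).isSome := fun {v} hv => by
    simp only [par, hv, ne_eq, not_false_eq_true, dite_true]
    exact (h2 v hv).choose_spec.1
  have hne : ∀ {u v}, (H.edge u v).isSome → v ≠ r := fun {u v} he hv => by
    subst hv; simp [h1] at he
  have hparEq : ∀ {u v}, (H.edge u v).isSome → par v = u := fun {u v} he =>
    (h2 v (hne he)).unique (hpar (hne he)) he
  have hex : ∀ v, ∃ l, par^[l] v = r := by
    intro v
    induction h3 v with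
    | refl => exact ⟨0, rfl⟩
    | tail _ he ih =>
      obtain ⟨l, hl⟩ := ih
      exact ⟨l + 1, by rw [Function.iterate_succ_apply, hparEq he, hl]⟩
  refine ⟨⟨r, par, fun v => Nat.find (hex v), h1, hparEq, fun {u v} he => ?_, hpar,
    (Nat.find_eq_zero _).2 rfl⟩⟩
  have hu : par v = u := hparEq he
  subst hu
  rw [Nat.find_comp_succ (hex v) (hex (par v)) (hne he)]
  rfl

namespace TreeData

variable {H : LabeledGraph σ V} (T : H.TreeData)

theorem depth_pos {v : V} : 0 < T.depth v ↔ v ≠ T.root := by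
  constructor
  · rintro h rfl
    simp [T.depth_root] at h
  · intro h
    rw [T.depth_eq (T.edge_par h)]
    omega

theorem edge_par_of_depth_pos {v : V} (h : 0 < T.depth v) : (H.edge (T.par v) v).isSome :=
  T.edge_par (T.depth_pos.1 h)

theorem depth_iterate {v : V} {j : ℕ} (h : j ≤ T.depth v) :
    T.depth (T.par^[j] v) + j = T.depth v := by
  induction j with
  | zero => rfl
  | succ j ih =>
    have ih := ih (by omega)
    have := T.depth_eq (T.edge_par_of_depth_pos (v := T.par^[j] v) (by omega))
    rw [Function.iterate_succ_apply']
    omega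

theorem edge_iterate {v : V} {j : ℕ} (h : j < T.depth v) :
    (H.edge (T.par^[j + 1] v) (T.par^[j] v)).isSome := by
  rw [Function.iterate_succ_apply']
  have := T.depth_iterate h.le
  exact T.edge_par_of_depth_pos (by omega)

theorem iterate_depth (v : V) : T.par^[T.depth v] v = T.root := by
  by_contra h
  have h1 := T.depth_pos.2 h
  have h2 := T.depth_iterate (v := v) le_rfl
  omega

/-- The ancestors of `v`, itself included, have pairwise different depths and are therefore
distinct. -/
theorem depth_lt_card [Fintype V] (v : V) : T.depth v < Fintype.card V := by
  have : Function.Injective fun j : Fin (T.depth v + 1) => T.par^[j] v := by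
    intro i j hij
    have hi := T.depth_iterate (v := v) (j := i) (by omega)
    have hj := T.depth_iterate (v := v) (j := j) (by omega)
    simp only at hij
    rw [hij] at hi
    exact Fin.ext (by omega)
  simpa using Fintype.card_le_of_injective _ this

/-- The vertices of a path are ancestors of its last vertex. -/
theorem path_eq {m : ℕ} {a : Fin (m + 1) → V}
    (ha : ∀ k : Fin m, (H.edge (a k.castSucc) (a k.succ)).isSome) :
    ∀ (j : ℕ) (hj : j ≤ m), T.par^[j] (a (Fin.last m)) = a ⟨m - j, by omega⟩
  | 0, _ => rfl
  | j + 1, hj => by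
    rw [Function.iterate_succ_apply', path_eq ha j (by omega)]
    refine T.par_eq ?_
    have e : (⟨m - j, by omega⟩ : Fin (m + 1)) = (⟨m - (j + 1), by omega⟩ : Fin m).succ := by
      ext
      simp
      omega
    rw [e]
    exact ha ⟨m - (j + 1), by omega⟩

theorem le_depth_of_path {m : ℕ} {a : Fin (m + 1) → V}
    (ha : ∀ k : Fin m, (H.edge (a k.castSucc) (a k.succ)).isSome) :
    m ≤ T.depth (a (Fin.last m)) := by
  have : ∀ j : ℕ, ∀ hj : j ≤ m, j ≤ T.depth (a ⟨j, by omega⟩) := by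
    intro j
    induction j with
    | zero => simp
    | succ j ih =>
      intro hj
      have h1 := ih (by omega)
      have h2 := T.depth_eq (ha ⟨j, hj⟩)
      change T.depth (a ⟨j + 1, _⟩) = T.depth (a ⟨j, _⟩) + 1 at h2
      omega
  exact this m le_rfl

end TreeData

section Lineage

variable [Fintype V]

theorem world_edge (H : LabeledGraph σ V) (ν : H.edges → Bool) (u v : V) (S : σ) :
    (H.world ν).edge u v = some S ↔
      ∃ h : H.edge u v = some S, ν ⟨(u, v), mem_edges_of_eq h⟩ = true := by
  unfold world subgraph
  simp only [Finset.mem_filter, Finset.mem_univ, true_and]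
  split
  · next h =>
    obtain ⟨h1, h2⟩ := h
    exact ⟨fun h => ⟨h, by simpa using h2⟩, fun h => h.1⟩
  · next h =>
    refine ⟨fun h => by simp at h, fun h' => absurd ⟨mem_edges_of_eq h'.1, by simpa using h'.2⟩ h⟩

theorem satisfies_pathDNF (H : LabeledGraph σ V) {m : ℕ} (R : Fin m → σ) (ν : H.edges → Bool) :
    (H.pathDNF R).Satisfies ν ↔
      ∃ a : Fin (m + 1) → V, ∀ k : Fin m, (H.world ν).edge (a k.castSucc) (a k.succ) = some (R k) := by
  classical
  constructor
  · rintro ⟨p, hp⟩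
    refine ⟨p.1, fun k => (world_edge ..).2 ⟨p.2 k, hp _ ?_⟩⟩
    exact Finset.mem_image_of_mem _ (Finset.mem_univ k)
  · rintro ⟨a, ha⟩
    refine ⟨(⟨a, fun k => ((world_edge ..).1 (ha k)).1⟩ : H.MatchingPath R), fun x hx => ?_⟩
    obtain ⟨k, -, rfl⟩ := Finset.mem_image.1 hx
    exact ((world_edge ..).1 (ha k)).2

-- The path has no vertices besides the enumerated ones and no edges besides the consecutive ones,
-- so a homomorphism is just the sequence of images; these images need not be distinct.
omit [Fintype V] in
theorem hasHom_iff_of_path {G : LabeledGraph σ U} {m : ℕ} {a : Fin (m + 1) ≃ U} {R : Fin m → σ}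
    (hG : G.IsOneWayPathAlong a R) (H : LabeledGraph σ V) :
    G.HasHom H ↔ ∃ b : Fin (m + 1) → V, ∀ k : Fin m, H.edge (b k.castSucc) (b k.succ) = some (R k) := by
  constructor
  · rintro ⟨h, hh⟩
    exact ⟨h ∘ a, fun k => hh _ _ _ ((hG _ _ _).2 ⟨k, rfl, rfl, rfl⟩)⟩
  · rintro ⟨b, hb⟩
    refine ⟨b ∘ a.symm, fun u v S huv => ?_⟩
    have := (hG (a.symm u) (a.symm v) S).1 (by simpa using huv)
    obtain ⟨k, h1, h2, rfl⟩ := this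
    simp [h1, h2, hb]

theorem capturesLineage_pathDNF {G : LabeledGraph σ U} {m : ℕ} {a : Fin (m + 1) ≃ U}
    {R : Fin m → σ} (hG : G.IsOneWayPathAlong a R) (H : LabeledGraph σ V) :
    H.CapturesLineage (H.pathDNF R) G := fun ν => by
  rw [satisfies_pathDNF, hasHom_iff_of_path hG]

end Lineage

end LabeledGraph

/-! ### Probabilities as weighted sums over valuations -/

section Prob

variable {X : Type} [Fintype X]

/-- The probability of a valuation. -/
def valuationWeight (π : X → ℚ) (ν : X → Bool) : ℚ := ∏ x, if ν x = true then π x else 1 - π x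

theorem valuationWeight_eq (π : X → ℚ) (ν : X → Bool) :
    (∏ x with ν x = true, π x) * ∏ x with ν x = false, (1 - π x) = valuationWeight π ν := by
  rw [valuationWeight, Finset.prod_ite]
  simp

open Classical in
theorem PosDNF.prob_eq (φ : PosDNF X) (π : X → ℚ) :
    φ.prob π = ∑ ν : X → Bool, valuationWeight π ν * if φ.Satisfies ν then 1 else 0 := by
  simp only [PosDNF.prob, Finset.sum_filter, valuationWeight_eq, mul_ite, mul_one, mul_zero]

open Classical in
theorem ProbGraph.homProb_eq {σ U V : Type} [Fintype V] (G : LabeledGraph σ U)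
    (H : ProbGraph σ V) : ProbGraph.homProb G H = ∑ ν : H.graph.edges → Bool,
      valuationWeight (fun e => (H.prob e).val) ν * if G.HasHom (H.graph.world ν) then 1 else 0 := by
  rw [ProbGraph.homProb, Finset.sum_filter]
  refine (Fintype.sum_equiv (⟨fun ν => Finset.univ.filter fun e => ν e = true,
    fun s e => decide (e ∈ s), fun ν => by ext; simp, fun s => by ext; simp⟩ :
    (H.graph.edges → Bool) ≃ Finset H.graph.edges) _ _ fun ν => ?_).symm
  have h : H.worldProb (Finset.univ.filter fun e => ν e = true) =
      valuationWeight (fun e => (H.prob e).val) ν := by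
    rw [ProbGraph.worldProb, ← valuationWeight_eq]
    congr 1
    refine Finset.prod_congr ?_ fun _ _ => rfl
    ext e
    simp
  change _ = if G.HasHom (H.graph.world ν) then
    H.worldProb (Finset.univ.filter fun e => ν e = true) else 0
  rw [h]
  split_ifs <;> simp

end Prob

/-! ### Elimination of families of upward chains -/

section BetaAcyclic

variable {X : Type}

open Classical in
/-- The first `t + 1` elements of the sequence `x, par x, par (par x), …`. -/
noncomputable def upChain (par : X → X) (x : X) (t : ℕ) : Finset X :=
  (Finset.range (t + 1)).image fun i => par^[i] x

theorem mem_upChain {par : X → X} {x y : X} {t : ℕ} :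
    y ∈ upChain par x t ↔ ∃ i ≤ t, par^[i] x = y := by
  simp [upChain]

/-- Take a vertex of maximal depth among those lying in hyperedges. Depth decreases along chains, so
every hyperedge through it starts there, and such hyperedges are nested by length. Its removal cuts
the first element off these chains and keeps the others, so the hypothesis is inherited. -/
theorem FinHypergraph.isBetaAcyclic_of_upChain (par : X → X) (dep : X → ℕ) :
    ∀ (N : ℕ) (𝓗 : FinHypergraph X), 𝓗.verts.card ≤ N →
    (∀ e ∈ 𝓗.edges, ∃ x t, e = upChain par x t ∧
      ∀ i < t, dep (par^[i + 1] x) < dep (par^[i] x)) → 𝓗.IsBetaAcyclic := by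
  classical
  intro N
  induction N with
  | zero =>
    intro 𝓗 hN _
    refine ⟨[], .nil _ (Set.eq_empty_of_forall_notMem fun e he => ?_)⟩
    obtain ⟨v, hv⟩ := 𝓗.nonempty e he
    have := 𝓗.subset_verts e he hv
    rw [Finset.card_eq_zero.1 (Nat.le_zero.1 hN)] at this
    simp at this
  | succ N ih =>
    intro 𝓗 hN h
    by_cases hE : 𝓗.edges = ∅
    · exact ⟨[], .nil _ hE⟩
    obtain ⟨e₀, he₀⟩ := Set.nonempty_iff_ne_empty.2 hE
    obtain ⟨v₀, hv₀⟩ := 𝓗.nonempty e₀ he₀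
    obtain ⟨v, hv, hmax⟩ := Finset.exists_max_image
      (𝓗.verts.filter fun v => ∃ e ∈ 𝓗.edges, v ∈ e) dep
      ⟨v₀, Finset.mem_filter.2 ⟨𝓗.subset_verts _ he₀ hv₀, e₀, he₀, hv₀⟩⟩
    have hdep : ∀ x t, (∀ i < t, dep (par^[i + 1] x) < dep (par^[i] x)) →
        ∀ i ≤ t, dep (par^[i] x) + i ≤ dep x := by
      intro x t hx i
      induction i with
      | zero => simp
      | succ i ih => intro hi; have := ih (by omega); have := hx i (by omega); omega
    have hv' : ∀ e ∈ 𝓗.edges, v ∈ e → ∃ t, e = upChain par v t ∧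
        ∀ i < t, dep (par^[i + 1] v) < dep (par^[i] v) := by
      intro e he hve
      obtain ⟨x, t, rfl, hx⟩ := h e he
      obtain ⟨i, hi, hxi⟩ := mem_upChain.1 hve
      have hxm : x ∈ upChain par x t := mem_upChain.2 ⟨0, Nat.zero_le _, rfl⟩
      -- If `v` came `i > 0` steps up the chain, the start `x` would be deeper than `v`,
      -- contradicting maximality.
      have h1 := hmax x (Finset.mem_filter.2 ⟨𝓗.subset_verts _ he hxm, _, he, hxm⟩)
      have h2 := hdep x t hx i hi
      rw [hxi] at h2
      obtain rfl : i = 0 := by omega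
      obtain rfl : x = v := hxi
      exact ⟨t, rfl, hx⟩
    have hmem := (Finset.mem_filter.1 hv).1
    have hleaf : 𝓗.IsBetaLeaf v := by
      refine ⟨hmem, fun e he f hf hve hvf => ?_⟩
      obtain ⟨t, rfl, -⟩ := hv' e he hve
      obtain ⟨s, rfl, -⟩ := hv' f hf hvf
      rcases le_total t s with hts | hts
      · refine Or.inl fun y hy => ?_
        obtain ⟨i, hi, rfl⟩ := mem_upChain.1 hy
        exact mem_upChain.2 ⟨i, hi.trans hts, rfl⟩
      · refine Or.inr fun y hy => ?_
        obtain ⟨i, hi, rfl⟩ := mem_upChain.1 hy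
        exact mem_upChain.2 ⟨i, hi.trans hts, rfl⟩
    obtain ⟨l, hl⟩ := ih (𝓗.remove v) (by
      have : (𝓗.remove v).verts = 𝓗.verts.erase v := by
        ext; simp [FinHypergraph.remove]
      rw [this, Finset.card_erase_of_mem hmem]
      omega) (by
      rintro e' ⟨hne, e, he, rfl⟩
      by_cases hve : v ∈ e
      · obtain ⟨t, rfl, hx⟩ := hv' e he hve
        have hd := hdep v t hx
        obtain ⟨y, hy⟩ := hne
        rw [Finset.mem_erase] at hy
        obtain ⟨i, hi, rfl⟩ := mem_upChain.1 hy.2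
        obtain ⟨t, rfl⟩ : ∃ s, t = s + 1 := by
          cases t with
          | zero =>
            obtain rfl : i = 0 := by omega
            simp at hy
          | succ s => exact ⟨s, rfl⟩
        -- What remains is the chain from `par v`, one step shorter; strict decrease of depth keeps
        -- `v` from reappearing in it.
        refine ⟨par v, t, ?_, fun i hi => hx (i + 1) (by omega)⟩
        ext z
        rw [Finset.mem_erase, mem_upChain, mem_upChain]
        constructor
        · rintro ⟨hz, j, hj, rfl⟩
          cases j with
          | zero => simp at hz
          | succ j => exact ⟨j, by omega, rfl⟩
        · rintro ⟨j, hj, rfl⟩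
          refine ⟨fun hz => ?_, j + 1, by omega, rfl⟩
          have := hd (j + 1) (by omega)
          rw [Function.iterate_succ_apply, hz] at this
          omega
      · obtain ⟨x, t, rfl, hx⟩ := h e he
        exact ⟨x, t, by rw [Finset.erase_eq_of_notMem hve], hx⟩)
    exact ⟨v :: l, .cons _ _ _ hE hleaf hl⟩

/-- Let the parent of an edge be the edge entering its upper endpoint. A path is then the chain of
its last edge, and the depth of the lower endpoint decreases along it. -/
theorem LabeledGraph.isBetaAcyclic_pathDNF {σ V : Type} [Fintype V] {H : LabeledGraph σ V}
    (hH : H.IsDownwardTree) {m : ℕ} (R : Fin m → σ) : (H.pathDNF R).IsBetaAcyclic := by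
  classical
  obtain ⟨T⟩ := hH.nonempty_treeData
  -- Edges leaving the root have no parent edge and are sent to themselves; no clause continues past
  -- them.
  let par : H.edges → H.edges := fun e =>
    if h : (T.par e.1.1, e.1.1) ∈ H.edges then ⟨_, h⟩ else e
  refine FinHypergraph.isBetaAcyclic_of_upChain par (fun e => T.depth e.1.2) _ _ le_rfl ?_
  rintro _ ⟨hne, p, rfl⟩
  change (MatchingPath.edgeSet p).Nonempty at hne
  change ∃ x t, MatchingPath.edgeSet p = _ ∧ _
  obtain ⟨m, rfl⟩ : ∃ s, m = s + 1 := by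
    cases m with
    | zero => simp [MatchingPath.edgeSet] at hne
    | succ s => exact ⟨s, rfl⟩
  let E : Fin (m + 1) → H.edges := fun k =>
    ⟨(p.1 k.castSucc, p.1 k.succ), mem_edges_of_eq (p.2 k)⟩
  have hE : ∀ i (hi : i ≤ m), par^[i] (E (Fin.last m)) = E ⟨m - i, by omega⟩ := by
    intro i
    induction i with
    | zero => intro _; rfl
    | succ i ih =>
      intro hi
      rw [Function.iterate_succ_apply', ih (by omega)]
      have h1 := p.2 ⟨m - (i + 1), by omega⟩
      have e1 : (⟨m - (i + 1), by omega⟩ : Fin (m + 1)).succ =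
          (⟨m - i, by omega⟩ : Fin (m + 1)).castSucc := by
        ext; simp; omega
      have h2 : T.par (E ⟨m - i, by omega⟩).1.1 =
          p.1 (⟨m - (i + 1), by omega⟩ : Fin (m + 1)).castSucc := by
        refine T.par_eq ?_
        change (H.edge _ (p.1 (⟨m - i, by omega⟩ : Fin (m + 1)).castSucc)).isSome
        rw [← e1, h1]
        rfl
      have h3 : (E ⟨m - i, by omega⟩).1.1 =
          p.1 (⟨m - (i + 1), by omega⟩ : Fin (m + 1)).succ := by
        rw [e1]
      have h4 : (T.par (E ⟨m - i, by omega⟩).1.1, (E ⟨m - i, by omega⟩).1.1) =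
          (E ⟨m - (i + 1), by omega⟩).1 := Prod.ext h2 h3
      have h5 : (T.par (E ⟨m - i, by omega⟩).1.1, (E ⟨m - i, by omega⟩).1.1) ∈ H.edges := by
        rw [h4]; exact (E _).2
      simp only [par]
      rw [dif_pos h5]
      exact Subtype.ext h4
  refine ⟨E (Fin.last m), m, ?_, fun i hi => ?_⟩
  · ext e
    rw [mem_upChain]
    unfold MatchingPath.edgeSet
    rw [Finset.mem_image]
    constructor
    · rintro ⟨k, -, rfl⟩
      refine ⟨m - k, by omega, ?_⟩
      rw [hE _ (by omega)]
      change E _ = E k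
      congr 1
      ext
      simp
      omega
    · rintro ⟨i, hi, rfl⟩
      exact ⟨_, Finset.mem_univ _, (hE i hi).symm⟩
  · rw [hE (i + 1) (by omega), hE i (by omega)]
    have h1 := T.depth_eq (u := p.1 (⟨m - i, by omega⟩ : Fin (m + 1)).castSucc)
      (v := p.1 (⟨m - i, by omega⟩ : Fin (m + 1)).succ) (by rw [p.2]; rfl)
    have e1 : (⟨m - (i + 1), by omega⟩ : Fin (m + 1)).succ =
        (⟨m - i, by omega⟩ : Fin (m + 1)).castSucc := by
      ext; simp; omega
    change T.depth (p.1 (⟨m - (i + 1), by omega⟩ : Fin (m + 1)).succ) <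
      T.depth (p.1 (⟨m - i, by omega⟩ : Fin (m + 1)).succ)
    rw [e1]
    omega

end BetaAcyclic

/-! ### Expectation and independence over finitely many Boolean variables -/

section Expectation

open Classical in
/-- The expectation of a function of independent Boolean variables. -/
noncomputable def expect {X : Type} [Fintype X] (π : X → ℚ) (F : (X → Bool) → ℚ) : ℚ :=
  ∑ ν, valuationWeight π ν * F ν

variable {X : Type} [Fintype X]

/-- Distributivity: expanding the product of the two-term sums gives the sum over all valuations. -/
theorem expect_prod_apply (π : X → ℚ) (g : X → Bool → ℚ) :
    expect π (fun ν => ∏ x, g x (ν x)) = ∏ x, (π x * g x true + (1 - π x) * g x false) := by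
  classical
  have h := Finset.prod_univ_sum (fun _ : X => (Finset.univ : Finset Bool))
    (fun x b => (if b = true then π x else 1 - π x) * g x b)
  rw [Fintype.piFinset_univ] at h
  simp only [Fintype.sum_bool, if_true, Bool.false_eq_true, if_false] at h
  rw [h, expect]
  refine Finset.sum_congr rfl fun ν _ => ?_
  rw [valuationWeight, Finset.prod_mul_distrib]

theorem expect_const (π : X → ℚ) (c : ℚ) : expect π (fun _ => c) = c := by
  have h := expect_prod_apply π fun _ _ => 1
  simp only [Finset.prod_const_one, mul_one, add_sub_cancel] at h
  rw [expect, ← Finset.sum_mul]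
  simp only [expect, mul_one] at h
  rw [h, one_mul]

theorem expect_var (π : X → ℚ) (x : X) (f : Bool → ℚ) :
    expect π (fun ν => f (ν x)) = π x * f true + (1 - π x) * f false := by
  classical
  have h := expect_prod_apply π fun y b => if y = x then f b else 1
  have e : ∀ y, (π y * (if y = x then f true else 1) + (1 - π y) * if y = x then f false else 1) =
      if y = x then π x * f true + (1 - π x) * f false else 1 := by
    intro y
    split_ifs with hy
    · rw [hy]
    · ring
  simp only [e, Finset.prod_ite_eq', Finset.mem_univ, if_true] at h
  simpa using h

theorem expect_add (π : X → ℚ) (F G : (X → Bool) → ℚ) :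
    expect π (fun ν => F ν + G ν) = expect π F + expect π G := by
  simp only [expect, mul_add, Finset.sum_add_distrib]

open Classical in
/-- The valuation that agrees with `ν` on `S` and with `ν'` elsewhere. -/
noncomputable def mixVal (S : Set X) (ν ν' : X → Bool) : X → Bool :=
  fun x => if x ∈ S then ν x else ν' x

theorem valuationWeight_mixVal (π : X → ℚ) (S : Set X) (ν ν' : X → Bool) :
    valuationWeight π (mixVal S ν ν') * valuationWeight π (mixVal S ν' ν) =
      valuationWeight π ν * valuationWeight π ν' := by
  classical
  simp only [valuationWeight, ← Finset.prod_mul_distrib]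
  refine Finset.prod_congr rfl fun x _ => ?_
  by_cases hx : x ∈ S <;> simp only [mixVal, hx, if_true, if_false]
  ring

/-- Functions of disjoint sets of independent variables are independent. -/
theorem expect_mul (π : X → ℚ) {F G : (X → Bool) → ℚ} {S T : Set X} (hF : DependsOn F S)
    (hG : DependsOn G T) (hST : Disjoint S T) :
    expect π (fun ν => F ν * G ν) = expect π F * expect π G := by
  classical
  have h1 : expect π F * expect π G = ∑ q : (X → Bool) × (X → Bool),
      (valuationWeight π q.1 * valuationWeight π q.2) * (F q.1 * G q.2) := by
    rw [expect, expect, Finset.sum_mul_sum, ← Finset.univ_product_univ, Finset.sum_product]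
    refine Finset.sum_congr rfl fun ν _ => Finset.sum_congr rfl fun ν' _ => ?_
    ring
  have h2 : expect π (fun ν => F ν * G ν) = ∑ q : (X → Bool) × (X → Bool),
      (valuationWeight π q.1 * valuationWeight π q.2) * (F q.1 * G q.1) := by
    rw [← mul_one (expect π _), ← expect_const π 1, expect, expect, Finset.sum_mul_sum,
      ← Finset.univ_product_univ, Finset.sum_product]
    refine Finset.sum_congr rfl fun ν _ => Finset.sum_congr rfl fun ν' _ => ?_
    ring
  -- On pairs of independent valuations, exchange the coordinates outside `S`. This preserves
  -- weights, and the first component of the result agrees with `q.1` where `F` looks and with `q.2`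
  -- where `G` looks.
  have hinv : Function.Involutive fun q : (X → Bool) × (X → Bool) =>
      (mixVal S q.1 q.2, mixVal S q.2 q.1) := by
    intro q
    ext x <;> by_cases hx : x ∈ S <;> simp [mixVal, hx]
  rw [h1, h2]
  refine (Fintype.sum_equiv hinv.toPerm _ _ fun q => ?_).symm
  have e1 : F q.1 = F (mixVal S q.1 q.2) := hF fun x hx => by simp [mixVal, hx]
  have e2 : G q.2 = G (mixVal S q.1 q.2) := hG fun x hx => by
    simp [mixVal, Set.disjoint_right.1 hST hx]
  change _ = valuationWeight π (mixVal S q.1 q.2) * valuationWeight π (mixVal S q.2 q.1) *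
    (F (mixVal S q.1 q.2) * G (mixVal S q.1 q.2))
  rw [valuationWeight_mixVal, e1, e2]

theorem expect_prod (π : X → ℚ) {J : Type} (s : Finset J) {F : J → (X → Bool) → ℚ}
    {S : J → Set X} (hF : ∀ j ∈ s, DependsOn (F j) (S j))
    (hS : ∀ i ∈ s, ∀ j ∈ s, i ≠ j → Disjoint (S i) (S j)) :
    expect π (fun ν => ∏ j ∈ s, F j ν) = ∏ j ∈ s, expect π (F j) := by
  classical
  induction s using Finset.induction_on with
  | empty => simpa using expect_const π 1
  | insert a s ha ih =>
    simp only [Finset.prod_insert ha]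
    rw [expect_mul π (S := S a) (T := ⋃ j ∈ s, S j) (hF a (Finset.mem_insert_self _ _)), ih]
    · exact fun j hj => hF j (Finset.mem_insert_of_mem hj)
    · exact fun i hi j hj => hS i (Finset.mem_insert_of_mem hi) j (Finset.mem_insert_of_mem hj)
    · intro ν ν' h
      refine Finset.prod_congr rfl fun j hj => hF j (Finset.mem_insert_of_mem hj) fun x hx => ?_
      exact h x (Set.mem_biUnion (x := j) (Finset.mem_coe.2 hj) hx)
    · simp only [Set.disjoint_iUnion_right]
      intro j hj
      exact hS a (Finset.mem_insert_self _ _) j (Finset.mem_insert_of_mem hj)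
        (fun h => ha (h ▸ hj))

/-- Conditioning on `x`, which neither branch reads: each indicator of `x` is independent of its
branch. -/
theorem expect_ite (π : X → ℚ) {F G : (X → Bool) → ℚ} {S : Set X} (hF : DependsOn F S)
    (hG : DependsOn G S) {x : X} (hx : x ∉ S) :
    expect π (fun ν => if ν x = true then F ν else G ν) =
      π x * expect π F + (1 - π x) * expect π G := by
  have e : (fun ν : X → Bool => if ν x = true then F ν else G ν) = fun ν =>
      (if ν x = true then 1 else 0) * F ν + (if ν x = true then 0 else 1) * G ν := by
    funext ν
    split_ifs <;> simp
  have hd : ∀ f : Bool → ℚ, DependsOn (fun ν : X → Bool => f (ν x)) {x} := fun f ν ν' h => by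
    simp only [h x rfl]
  have hdis : Disjoint {x} S := Set.disjoint_singleton_left.2 hx
  rw [e, expect_add, expect_mul π (hd fun b => if b = true then 1 else 0) hF hdis,
    expect_mul π (hd fun b => if b = true then 0 else 1) hG hdis,
    expect_var π x fun b => if b = true then 1 else 0,
    expect_var π x fun b => if b = true then 0 else 1]
  simp

end Expectation

/-! ### The bottom-up recursion for the probability -/

section TreeRecursion

namespace LabeledGraph.TreeData

variable {σ V : Type} {H : LabeledGraph σ V} (T : H.TreeData)

/-- The descendants of a vertex, including itself. -/
def below (v : V) : Set V := {b | T.depth v ≤ T.depth b ∧ T.par^[T.depth b - T.depth v] b = v}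

theorem mem_below_self (v : V) : v ∈ T.below v := by simp [below]

/-- A vertex has only one ancestor at a given depth. This makes the subtrees of distinct siblings
disjoint. -/
theorem eq_of_mem_below {w w' b : V} (hd : T.depth w = T.depth w') (h : b ∈ T.below w)
    (h' : b ∈ T.below w') : w = w' := by
  rw [← h.2, ← h'.2, hd]

theorem depth_le_of_mem_below {w b : V} (h : b ∈ T.below w) : T.depth w ≤ T.depth b := h.1

theorem mem_below_of_child {v w b : V} (he : (H.edge v w).isSome) (h : b ∈ T.below w) :
    b ∈ T.below v := by
  have hd := T.depth_eq he
  obtain ⟨h1, h2⟩ := h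
  refine ⟨by omega, ?_⟩
  rw [show T.depth b - T.depth v = (T.depth b - T.depth w) + 1 by omega,
    Function.iterate_succ_apply', h2, T.par_eq he]

end LabeledGraph.TreeData

namespace ProbGraph

variable {σ V : Type} [Fintype V] (H : ProbGraph σ V) (M : V → Bool) (m : ℕ)

/-- Below `v` there is, within distance `k`, a vertex `w` with `M w` below `m` present edges, where
the first `m - (i + 1)` of these edges may be counted above `v`. -/
def Bad (ν : H.graph.edges → Bool) : ℕ → V → ℕ → Prop
  | 0, _, _ => False
  | k + 1, v, i => ∃ w, ∃ h : (v, w) ∈ H.graph.edges,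
      -- A present edge lowers `i`, and truncated subtraction keeps it at `0`, where `m - 1` edges
      -- above are already credited. An absent edge resets `i` to `m - 1`, no credit.
      if ν ⟨(v, w), h⟩ = true then (i = 0 ∧ M w = true) ∨ Bad ν k w (i - 1)
      else Bad ν k w (m - 1)

open Classical in
/-- The common denominators of the probabilities computed bottom-up. -/
noncomputable def denTab : ℕ → V → ℕ
  | 0, _ => 1
  | k + 1, v => ∏ w, if h : (v, w) ∈ H.graph.edges then
      (H.prob ⟨(v, w), h⟩).den * denTab k w else 1

open Classical in
/-- The numerators of the probabilities computed bottom-up. -/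
noncomputable def numTab : ℕ → V → ℕ → ℕ
  | 0, _, _ => 1
  -- The denominator below `w` does not depend on the credit, so the cases of an absent and a
  -- present edge are added over the same denominator.
  | k + 1, v, i => ∏ w, if h : (v, w) ∈ H.graph.edges then
      ((H.prob ⟨(v, w), h⟩).den - (H.prob ⟨(v, w), h⟩).num) * numTab k w (m - 1) +
        (H.prob ⟨(v, w), h⟩).num * (if i = 0 ∧ M w = true then 0 else numTab k w (i - 1)) else 1

theorem denTab_pos (k : ℕ) (v : V) : 0 < H.denTab k v := by
  induction k generalizing v with
  | zero => simp [denTab]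
  | succ k ih =>
    refine Finset.prod_pos fun w _ => ?_
    split_ifs with h
    · exact Nat.mul_pos (RatProb.den_pos _) (ih w)
    · exact Nat.one_pos

/-- The fractions stay at most one, as averages of such fractions. This bounds the digits of the
numerators and makes the final subtraction from the denominator exact. -/
theorem numTab_le_denTab (k : ℕ) (v : V) (i : ℕ) : H.numTab M m k v i ≤ H.denTab k v := by
  induction k generalizing v i with
  | zero => simp [denTab, numTab]
  | succ k ih =>
    refine Finset.prod_le_prod' fun w _ => ?_
    split_ifs with h h'
    · rw [mul_zero, add_zero]
      exact Nat.mul_le_mul (Nat.sub_le _ _) (ih w _)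
    · have h1 := RatProb.num_le_den (H.prob ⟨(v, w), h⟩)
      have h2 := Nat.mul_le_mul_left ((H.prob ⟨(v, w), h⟩).den - (H.prob ⟨(v, w), h⟩).num)
        (ih w (m - 1))
      have h3 := Nat.mul_le_mul_left (H.prob ⟨(v, w), h⟩).num (ih w (i - 1))
      refine (add_le_add h2 h3).trans ?_
      rw [← add_mul, Nat.sub_add_cancel h1]
    · exact le_rfl

variable {H} (T : H.graph.TreeData)

/-- The edges below a vertex. -/
def edgesBelow (v : V) : Set H.graph.edges := {e | e.1.2 ∈ T.below v ∧ e.1.2 ≠ v}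

/-- The edge to a vertex and the edges below it. -/
def edgesTo (v : V) : Set H.graph.edges := {e | e.1.2 ∈ T.below v}

variable {T}

theorem edgesBelow_subset_edgesTo (v : V) : edgesBelow T v ⊆ edgesTo T v := fun _ h => h.1

theorem notMem_edgesBelow {v w : V} (h : (v, w) ∈ H.graph.edges) :
    (⟨(v, w), h⟩ : H.graph.edges) ∉ edgesBelow T w := fun h' => h'.2 rfl

theorem mem_edgesTo {v w : V} (h : (v, w) ∈ H.graph.edges) :
    (⟨(v, w), h⟩ : H.graph.edges) ∈ edgesTo T w := T.mem_below_self w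

theorem edgesTo_subset_edgesBelow {v w : V} (h : (v, w) ∈ H.graph.edges) :
    edgesTo T w ⊆ edgesBelow T v := fun e he => by
  have h1 := LabeledGraph.mem_edges.1 h
  refine ⟨T.mem_below_of_child h1 he, fun hv => ?_⟩
  have h2 := T.depth_eq h1
  have h3 := T.depth_le_of_mem_below he
  rw [hv] at h3
  omega

theorem disjoint_edgesTo {v w w' : V} (h : (v, w) ∈ H.graph.edges) (h' : (v, w') ∈ H.graph.edges)
    (hne : w ≠ w') : Disjoint (edgesTo T w) (edgesTo T w') := by
  rw [Set.disjoint_left]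
  intro e he he'
  have h1 := T.depth_eq (LabeledGraph.mem_edges.1 h)
  have h2 := T.depth_eq (LabeledGraph.mem_edges.1 h')
  exact hne (T.eq_of_mem_below (by omega) he he')

/-- Supplies the dependence on edges strictly below `v` that independence requires. -/
theorem bad_congr {k : ℕ} {v : V} {i : ℕ} {ν ν' : H.graph.edges → Bool}
    (h : ∀ e ∈ edgesBelow T v, ν e = ν' e) : H.Bad M m ν k v i ↔ H.Bad M m ν' k v i := by
  induction k generalizing v i with
  | zero => rfl
  | succ k ih =>
    refine exists_congr fun w => exists_congr fun hw => ?_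
    have h1 := edgesTo_subset_edgesBelow (T := T) hw
    rw [h _ (h1 (mem_edgesTo hw))]
    have h2 : ∀ e ∈ edgesBelow T w, ν e = ν' e := fun e he =>
      h e (h1 (edgesBelow_subset_edgesTo w he))
    rw [ih h2, ih h2]

-- The bad event is avoided exactly when it is avoided through every child. These events read the
-- disjoint edge sets `edgesTo`, so expectations multiply; for each child one conditions on the edge
-- leading to it and applies the induction hypothesis with the updated credit.
open Classical in
theorem expect_not_bad (T : H.graph.TreeData) (k : ℕ) (v : V) (i : ℕ) :
    expect (fun e => (H.prob e).val) (fun ν => if H.Bad M m ν k v i then 0 else 1) =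
      (H.numTab M m k v i : ℚ) / H.denTab k v := by
  induction k generalizing v i with
  | zero => simpa [Bad, numTab, denTab] using expect_const _ 1
  | succ k ih =>
    let c : Finset V := Finset.univ.filter fun w => (v, w) ∈ H.graph.edges
    let A : V → (H.graph.edges → Bool) → ℚ := fun w ν =>
      if (i = 0 ∧ M w = true) ∨ H.Bad M m ν k w (i - 1) then 0 else 1
    let B : V → (H.graph.edges → Bool) → ℚ := fun w ν => if H.Bad M m ν k w (m - 1) then 0 else 1
    let F : V → (H.graph.edges → Bool) → ℚ := fun w ν =>
      if h : (v, w) ∈ H.graph.edges then if ν ⟨(v, w), h⟩ = true then A w ν else B w ν else 1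
    have hF : ∀ ν, (if H.Bad M m ν (k + 1) v i then (0 : ℚ) else 1) = ∏ w ∈ c, F w ν := by
      intro ν
      have e1 : ∀ w ∈ c, F w ν = if (∀ h : (v, w) ∈ H.graph.edges,
          ¬ if ν ⟨(v, w), h⟩ = true then (i = 0 ∧ M w = true) ∨ H.Bad M m ν k w (i - 1)
          else H.Bad M m ν k w (m - 1)) then 1 else 0 := by
        intro w hw
        have hw' := (Finset.mem_filter.1 hw).2
        simp only [F, A, B, hw', dite_true, forall_true_left]
        by_cases hν : ν ⟨(v, w), hw'⟩ = true <;> simp only [hν, if_true, ite_not] <;> rfl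
      rw [Finset.prod_congr rfl e1, Finset.prod_boole]
      by_cases hb : H.Bad M m ν (k + 1) v i
      · rw [if_pos hb, if_neg]
        obtain ⟨w, hw, hh⟩ := hb
        exact fun h => h w (Finset.mem_filter.2 ⟨Finset.mem_univ _, hw⟩) hw hh
      · rw [if_neg hb, if_pos]
        exact fun w _ hw hh => hb ⟨w, hw, hh⟩
    have hA : ∀ w, DependsOn (A w) (edgesBelow T w) := fun w ν ν' h =>
      if_congr (or_congr Iff.rfl (bad_congr M m h)) rfl rfl
    have hB : ∀ w, DependsOn (B w) (edgesBelow T w) := fun w ν ν' h =>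
      if_congr (bad_congr M m h) rfl rfl
    have hFdep : ∀ w ∈ c, DependsOn (F w) (edgesTo T w) := by
      intro w hw ν ν' h
      have hw' := (Finset.mem_filter.1 hw).2
      simp only [F, hw', dite_true]
      have h2 : ∀ e ∈ edgesBelow T w, ν e = ν' e := fun e he =>
        h e (edgesBelow_subset_edgesTo w he)
      rw [h _ (mem_edgesTo hw'), hA w h2, hB w h2]
    simp only [hF]
    rw [expect_prod _ c hFdep fun w hw w' hw' hne =>
      disjoint_edgesTo (Finset.mem_filter.1 hw).2 (Finset.mem_filter.1 hw').2 hne]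
    rw [numTab, denTab, Nat.cast_prod, Nat.cast_prod, ← Finset.prod_div_distrib]
    rw [Finset.prod_filter]
    refine Finset.prod_congr rfl fun w _ => ?_
    by_cases hw : (v, w) ∈ H.graph.edges
    swap
    · simp [hw]
    have hd : ((H.prob ⟨(v, w), hw⟩).den : ℚ) ≠ 0 := by
      exact_mod_cast (RatProb.den_pos _).ne'
    have hd' : (H.denTab k w : ℚ) ≠ 0 := by exact_mod_cast (H.denTab_pos k w).ne'
    simp only [hw, if_true, dite_true, F]
    have e3 : expect (fun e => (H.prob e).val) (B w) = _ := ih w (m - 1)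
    rw [expect_ite _ (hA w) (hB w) (notMem_edgesBelow hw), e3]
    have e2 : expect (fun e => (H.prob e).val) (A w) = (if i = 0 ∧ M w = true then 0 else (H.numTab M m k w (i - 1) : ℚ)) / H.denTab k w := by
      by_cases hi : i = 0 ∧ M w = true
      · simpa [A, hi] using expect_const _ 0
      · simpa only [A, hi, false_or, if_false] using ih w (i - 1)
    rw [e2, RatProb.val]
    push_cast [Nat.cast_sub (RatProb.num_le_den (H.prob ⟨(v, w), hw⟩))]
    field_simp
    ring

/-- Whether the edge to the vertex `b` from its parent is present. -/
def Kept (T : H.graph.TreeData) (ν : H.graph.edges → Bool) (b : V) : Prop :=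
  ∃ h : (T.par b, b) ∈ H.graph.edges, ν ⟨_, h⟩ = true

theorem kept_iff {ν : H.graph.edges → Bool} {v w : V} (h : (v, w) ∈ H.graph.edges) :
    Kept T ν w ↔ ν ⟨(v, w), h⟩ = true := by
  have e := T.par_eq (LabeledGraph.mem_edges.1 h)
  subst e
  exact ⟨fun h => h.2, fun h' => ⟨h, h'⟩⟩

/-- Unrolling the recursion gives a marked vertex `w` at distance `l` below `v`. With `m - (i + 1)`
edges credited above `v`, the match needs `l` to be at least `i + 1`; below `v` only the `min m l`
edges nearest to `w` matter. -/
theorem bad_iff (T : H.graph.TreeData) (hm : 0 < m) (ν : H.graph.edges → Bool) (k : ℕ) (v : V)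
    (i : ℕ) (hi : i < m) :
    H.Bad M m ν k v i ↔ ∃ w l, l ≤ k ∧ i + 1 ≤ l ∧ l ≤ T.depth w ∧ T.par^[l] w = v ∧ M w = true ∧
      ∀ j < min m l, Kept T ν (T.par^[j] w) := by
  induction k generalizing v i with
  | zero =>
    refine iff_of_false id ?_
    rintro ⟨w, l, h1, h2, -⟩
    omega
  | succ k ih =>
    constructor
    · rintro ⟨c, hc, h⟩
      have hdc := T.depth_eq (LabeledGraph.mem_edges.1 hc)
      have hpc := T.par_eq (LabeledGraph.mem_edges.1 hc)
      split_ifs at h with hk <;> rw [← kept_iff (T := T) hc] at hk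
      · rcases h with ⟨rfl, hM⟩ | h
        · refine ⟨c, 1, by omega, by omega, by omega, hpc, hM, fun j hj => ?_⟩
          obtain rfl : j = 0 := by omega
          exact hk
        · obtain ⟨w, l, h1, h2, h3, h4, h5, h6⟩ := (ih c (i - 1) (by omega)).1 h
          have h7 := T.depth_iterate h3
          rw [h4] at h7
          refine ⟨w, l + 1, by omega, by omega, by omega, ?_, h5, fun j hj => ?_⟩
          · rw [Function.iterate_succ_apply', h4, hpc]
          · rcases Nat.lt_or_ge j l with hjl | hjl
            · exact h6 j (by omega)
            · obtain rfl : j = l := by omega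
              rw [h4]
              exact hk
      · obtain ⟨w, l, h1, h2, h3, h4, h5, h6⟩ := (ih c (m - 1) (by omega)).1 h
        have h7 := T.depth_iterate h3
        rw [h4] at h7
        refine ⟨w, l + 1, by omega, by omega, by omega, ?_, h5, fun j hj => h6 j (by omega)⟩
        rw [Function.iterate_succ_apply', h4, hpc]
    · rintro ⟨w, l, h1, h2, h3, h4, h5, h6⟩
      obtain ⟨l, rfl⟩ : ∃ l', l = l' + 1 := ⟨l - 1, by omega⟩
      have he := T.edge_iterate (v := w) (j := l) (by omega)
      rw [h4] at he
      have hc := LabeledGraph.mem_edges.2 he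
      refine ⟨T.par^[l] w, hc, ?_⟩
      split_ifs with hk <;> rw [← kept_iff (T := T) hc] at hk
      · by_cases hl : l = 0
        · subst hl
          exact Or.inl ⟨by omega, h5⟩
        · exact Or.inr ((ih _ (i - 1) (by omega)).2 ⟨w, l, by omega, by omega, by omega, rfl, h5,
            fun j hj => h6 j (by omega)⟩)
      · refine (ih _ (m - 1) (by omega)).2 ⟨w, l, by omega, ?_, by omega, rfl, h5,
          fun j hj => h6 j (by omega)⟩
        -- Were `l < m`, the absent edge would be among the `min m (l + 1)` edges required.
        by_contra hlt
        exact hk (h6 l (by omega))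

/-- At the root no edge is credited, so `i = m - 1` forces `l` to be at least `m`. The edges tested
are then the `m` edges above `w`, which form the only match that can end at `w`. All depths are
below `n`, so the recursion reaches every vertex. -/
theorem bad_root_iff (T : H.graph.TreeData) {m : ℕ} (hm : 0 < m) {R : Fin m → σ}
    (hM : ∀ w, M w = true ↔ ∃ a : Fin (m + 1) → V, a (Fin.last m) = w ∧
      ∀ k : Fin m, H.graph.edge (a k.castSucc) (a k.succ) = some (R k))
    (ν : H.graph.edges → Bool) {n : ℕ} (hn : Fintype.card V ≤ n) :
    H.Bad M m ν n T.root (m - 1) ↔ (H.graph.pathDNF R).Satisfies ν := by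
  rw [bad_iff M m T hm ν n T.root (m - 1) (by omega), LabeledGraph.satisfies_pathDNF]
  constructor
  · rintro ⟨w, l, -, h2, -, -, h5, h6⟩
    obtain ⟨a, rfl, ha⟩ := (hM w).1 h5
    refine ⟨a, fun k => (LabeledGraph.world_edge ..).2 ⟨ha k, ?_⟩⟩
    rw [← kept_iff (T := T)]
    have h7 := T.path_eq (a := a) (fun k => by rw [ha k]; rfl) (m - (k + 1)) (by omega)
    have h8 := h6 (m - (k + 1)) (by omega)
    rw [h7] at h8
    convert h8 using 2
    ext
    simp
    omega
  · rintro ⟨a, ha⟩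
    have ha' := fun k => (LabeledGraph.world_edge ..).1 (ha k)
    have hs : ∀ k : Fin m, (H.graph.edge (a k.castSucc) (a k.succ)).isSome := fun k => by
      rw [(ha' k).1]; rfl
    have h1 := T.le_depth_of_path hs
    -- The distance to the root is the full depth of the last vertex, which may exceed the length of
    -- the match.
    refine ⟨a (Fin.last m), T.depth (a (Fin.last m)), ?_, by omega, le_rfl, T.iterate_depth _,
      (hM _).2 ⟨a, rfl, fun k => (ha' k).1⟩, fun j hj => ?_⟩
    · have := T.depth_lt_card (a (Fin.last m))
      omega
    · rw [T.path_eq hs j (by omega)]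
      obtain ⟨h2, h3⟩ := ha' ⟨m - (j + 1), by omega⟩
      have e : (⟨m - j, by omega⟩ : Fin (m + 1)) = (⟨m - (j + 1), by omega⟩ : Fin m).succ := by
        ext
        simp
        omega
      rw [e]
      exact (kept_iff (LabeledGraph.mem_edges_of_eq h2)).2 h3

theorem homProb_eq_prob {U : Type} {G : LabeledGraph σ U} {m : ℕ} {a : Fin (m + 1) ≃ U}
    {R : Fin m → σ} (hG : G.IsOneWayPathAlong a R) (H : ProbGraph σ V) :
    (H.graph.pathDNF R).prob (fun e => (H.prob e).val) = homProb G H := by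
  classical
  rw [PosDNF.prob_eq, homProb_eq]
  refine Finset.sum_congr (by ext; simp) fun ν _ => ?_
  congr 1
  exact if_congr (LabeledGraph.capturesLineage_pathDNF hG H.graph ν) rfl rfl

-- The query holds exactly when the bad event occurs at the root, so one takes the complement. A
-- query without edges is separate: its clause is empty, hence always true, and the credit `m - 1`
-- has no meaning.
open Classical in
theorem homProb_eq_tab {U : Type} {G : LabeledGraph σ U} (T : H.graph.TreeData) {m : ℕ}
    {a : Fin (m + 1) ≃ U} {R : Fin m → σ} (hG : G.IsOneWayPathAlong a R)
    (hM : ∀ w, M w = true ↔ ∃ a : Fin (m + 1) → V, a (Fin.last m) = w ∧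
      ∀ k : Fin m, H.graph.edge (a k.castSucc) (a k.succ) = some (R k))
    {n : ℕ} (hn : Fintype.card V ≤ n) :
    homProb G H = 1 - (if m = 0 then 0 else (H.numTab M m n T.root (m - 1) : ℚ)) /
      H.denTab n T.root := by
  rw [← homProb_eq_prob hG, PosDNF.prob_eq]
  change expect _ _ = _
  split_ifs with hm
  · subst hm
    have : ∀ ν, (H.graph.pathDNF R).Satisfies ν := fun ν =>
      (LabeledGraph.satisfies_pathDNF ..).2 ⟨fun _ => T.root, fun k => k.elim0⟩
    simpa [this] using expect_const _ 1
  · rw [← expect_not_bad M m T]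
    rw [eq_sub_iff_add_eq, ← expect_add]
    refine Eq.trans (congrArg _ (funext fun ν => ?_)) (expect_const _ 1)
    rw [if_congr (bad_root_iff M T (Nat.pos_of_ne_zero hm) hM ν hn) rfl rfl]
    split_ifs <;> simp

-- Since the subtrees of siblings are disjoint, no edge denominator is multiplied in twice. The
-- number of digits is thus bounded by a sum over the edges instead of compounding from level to
-- level.
open Classical in
theorem denTab_le (T : H.graph.TreeData) (k : ℕ) (v : V) :
    H.denTab k v ≤ ∏ e with e ∈ edgesBelow T v, (H.prob e).den := by
  induction k generalizing v with
  | zero => exact Finset.one_le_prod' fun e _ => RatProb.den_pos _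
  | succ k ih =>
    let c : Finset V := Finset.univ.filter fun w => (v, w) ∈ H.graph.edges
    have h1 : H.denTab (k + 1) v ≤ ∏ w ∈ c, ∏ e with e ∈ edgesTo T w, (H.prob e).den := by
      rw [denTab, Finset.prod_filter]
      refine Finset.prod_le_prod' fun w _ => ?_
      split_ifs with hw
      · have h2 : insert (⟨(v, w), hw⟩ : H.graph.edges)
            (Finset.univ.filter fun e => e ∈ edgesBelow T w) ⊆
            Finset.univ.filter fun e => e ∈ edgesTo T w := by
          intro e he
          rw [Finset.mem_filter]
          rcases Finset.mem_insert.1 he with rfl | he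
          · exact ⟨Finset.mem_univ _, mem_edgesTo hw⟩
          · exact ⟨Finset.mem_univ _, edgesBelow_subset_edgesTo _ (Finset.mem_filter.1 he).2⟩
        refine le_trans ?_ (Finset.prod_le_prod_of_subset_of_one_le' h2
          fun e _ _ => RatProb.den_pos _)
        rw [Finset.prod_insert (by simpa using notMem_edgesBelow hw)]
        exact Nat.mul_le_mul_left _ (ih w)
      · exact le_rfl
    refine h1.trans ?_
    rw [← Finset.prod_biUnion]
    · refine Finset.prod_le_prod_of_subset_of_one_le' (fun e he => ?_)
        fun e _ _ => RatProb.den_pos _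
      obtain ⟨w, hw, he⟩ := Finset.mem_biUnion.1 he
      exact Finset.mem_filter.2 ⟨Finset.mem_univ _,
        edgesTo_subset_edgesBelow (Finset.mem_filter.1 hw).2 (Finset.mem_filter.1 he).2⟩
    · intro w hw w' hw' hne
      have := disjoint_edgesTo (T := T) (Finset.mem_filter.1 hw).2 (Finset.mem_filter.1 hw').2 hne
      rw [Function.onFun, Finset.disjoint_left]
      intro e he he'
      exact Set.disjoint_left.1 this (Finset.mem_filter.1 he).2 (Finset.mem_filter.1 he').2

end ProbGraph

end TreeRecursion

/-! ### The algorithm, on lists -/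

section Algorithm

variable {σ : Type}

/-- Entries of the matrices read from the input: a label and a fraction for every edge. -/
abbrev Entry (σ : Type) := Option (TapeSymbol σ × ℕ × ℕ)

/-- Matrices given by the list of their rows. -/
abbrev RowMat (β : Type) := List (List β)

/-- The list of rows of a square matrix. -/
def toRows {β : Type} {m n : ℕ} (E : Fin m → Fin n → β) : RowMat β :=
  (List.finRange m).map fun u => (List.finRange n).map fun v => E u v

/-- The number of columns is read off the first row, so there must be one. -/
theorem transposeRows_toRows {β : Type} {m n : ℕ} (hm : 0 < m) (E : Fin m → Fin n → β) :
    transposeRows (toRows E) = toRows fun v u => E u v := by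
  have key : ∀ us : List (Fin m),
      (us.map fun u => (List.finRange n).map fun v => E u v).foldr
        (fun row acc => List.zipWith List.cons row acc) ((List.finRange n).map fun _ => []) =
      (List.finRange n).map fun v => us.map fun u => E u v := by
    intro us
    induction us with
    | nil => simp
    | cons u us ih =>
      rw [List.map_cons, List.foldr_cons, ih, List.zipWith_map]
      simp [List.zipWith_self]
  obtain ⟨m, rfl⟩ : ∃ k, m = k + 1 := ⟨m - 1, by omega⟩
  have h : ((toRows E).headD []).map (fun _ => ([] : List β)) =
      (List.finRange n).map fun _ => [] := by
    simp [toRows, List.finRange_succ, Function.comp_def]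
  rw [transposeRows, h]
  exact key _

/-- Add an entry to the first row. -/
def addEntry (e : Entry σ) : RowMat (Entry σ) → RowMat (Entry σ)
  | [] => []
  | r :: rs => (e :: r) :: rs

/-- The states of the parser, which reads its input from right to left: two numbers, the rows read
of the current matrix, and the matrices read. -/
abbrev ParseState (σ : Type) := (ℕ × ℕ) × RowMat (Entry σ) × List (RowMat (Entry σ))

/-- One step of the parser. -/
def parseStep : TapeSymbol σ → ParseState σ → ParseState σ
  | .bit b, s => ((Nat.bit b s.1.1, s.1.2), s.2)
  | .endNumber, s => ((0, s.1.1), s.2)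
  -- From right to left, a label is met after its denominator and numerator; it completes the entry.
  | .label R, s => ((0, 0), addEntry (some (.label R, s.1)) s.2.1, s.2.2)
  | .noEdge, s => (s.1, addEntry none s.2.1, s.2.2)
  | .endRow, s => (s.1, [] :: s.2.1, s.2.2)
  | .endGraph, s => (s.1, [], s.2.1 :: s.2.2)

/-- From the right, the end mark comes first and shifts the previous number; the bits follow, most
significant first, so `Nat.bit` rebuilds the number. -/
theorem parse_encodeNumber (n x y : ℕ) (s : RowMat (Entry σ) × List (RowMat (Entry σ))) :
    (encodeNumber n).foldr parseStep ((x, y), s) = ((n, x), s) := by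
  have : ∀ l : List Bool, (l.map TapeSymbol.bit).foldr parseStep ((0, x), s) =
      ((l.foldr Nat.bit 0, x), s) := by
    intro l
    induction l with
    | nil => rfl
    | cons b l ih => rw [List.map_cons, List.foldr_cons, ih]; rfl
  rw [encodeNumber, List.foldr_append, encodeNat_eq_bits]
  exact (this _).trans (by rw [Nat.foldr_bit_bits])

theorem parse_encodeMatrix {n : ℕ} {entry : Fin n → Fin n → List (TapeSymbol σ)}
    {E : Fin n → Fin n → Entry σ} (hE : ∀ u v r rs gs, (entry u v).foldr parseStep
      ((0, 0), r :: rs, gs) = ((0, 0), (E u v :: r) :: rs, gs))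
    (rows : RowMat (Entry σ)) (gs : List (RowMat (Entry σ))) :
    (encodeMatrix entry).foldr parseStep ((0, 0), rows, gs) =
      ((0, 0), toRows E, rows :: gs) := by
  have h1 : ∀ u (vs : List (Fin n)) r rs gs, (vs.flatMap fun v => entry u v).foldr parseStep
      ((0, 0), r :: rs, gs) = ((0, 0), ((vs.map fun v => E u v) ++ r) :: rs, gs) := by
    intro u vs
    induction vs with
    | nil => intros; rfl
    | cons v vs ih =>
      intro r rs gs
      rw [List.flatMap_cons, List.foldr_append, ih, hE]
      rfl
  have h2 : ∀ (us : List (Fin n)) rs gs, (us.flatMap fun u =>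
      ((List.finRange n).flatMap fun v => entry u v) ++ [TapeSymbol.endRow]).foldr parseStep
      ((0, 0), rs, gs) = ((0, 0), (us.map fun u => (List.finRange n).map fun v => E u v) ++ rs,
        gs) := by
    intro us
    induction us with
    | nil => intros; rfl
    | cons u us ih =>
      intro rs gs
      rw [List.flatMap_cons, List.foldr_append, ih, List.foldr_append]
      simp only [List.foldr_cons, List.foldr_nil, parseStep]
      rw [h1, List.append_nil]
      rfl
  rw [encodeMatrix, List.foldr_append]
  simp only [List.foldr_cons, List.foldr_nil, parseStep]
  rw [h2, List.append_nil, toRows]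

/-- The entries of the matrix of a graph. -/
def graphEntry {n : ℕ} (G : LabeledGraph σ (Fin n)) (u v : Fin n) : Entry σ :=
  (G.edge u v).map fun R => (.label R, 0, 0)

/-- The entries of the matrix of a probabilistic graph. -/
def probEntry {n : ℕ} (H : ProbGraph σ (Fin n)) (u v : Fin n) : Entry σ :=
  if h : (u, v) ∈ H.graph.edges then
    some (.label ((H.graph.edge u v).get (LabeledGraph.mem_edges.1 h)),
      (H.prob ⟨(u, v), h⟩).num, (H.prob ⟨(u, v), h⟩).den)
  else none

/-- An `endGraph` mark stores the rows read before it and opens a new matrix. Hence the query,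
leftmost on the tape, is left in the current rows, and the initial empty matrix is stored last in
the list. -/
theorem parse_encodePHomInput {𝒢 ℋ : GraphClass σ} (x : PHomInput σ 𝒢 ℋ) :
    (encodePHomInput x).foldr parseStep ((0, 0), [], []) =
      ((0, 0), toRows (graphEntry x.query), [toRows (probEntry x.inst), []]) := by
  rw [encodePHomInput, List.foldr_append, encodeProbGraph,
    parse_encodeMatrix (E := probEntry x.inst), encodeGraph,
    parse_encodeMatrix (E := graphEntry x.query)]
  · intro u v r rs gs
    unfold graphEntry
    cases x.query.edge u v <;> rfl
  · intro u v r rs gs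
    unfold probEntry
    split_ifs with h
    · rw [encodeRatProb, List.foldr_cons, List.foldr_append, parse_encodeNumber,
        parse_encodeNumber]
      rfl
    · rfl

open Classical in
/-- Equality of symbols. -/
noncomputable def symEq (a b : TapeSymbol σ) : Bool := decide (a = b)

/-- Whether an entry is an edge with a given label. -/
noncomputable def entryHas (a : TapeSymbol σ) : Entry σ → Bool
  | none => false
  | some q => symEq a q.1

/-- For an edge `e` of the query, whether the vertex of the instance with column `c` is reached by
an edge with the same label from a vertex marked in `l`. -/
noncomputable def edgeMatch (e : Entry σ) (c : List (Entry σ)) (l : List Bool) : Bool :=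
  match e with
  | none => true
  | some q => (c.zip l).any fun p => p.2 && entryHas q.1 p.1

/-- One round of the computation of the partial homomorphisms, from the columns of the query and of
the instance. -/
noncomputable def homStep (GT HT : RowMat (Entry σ)) (A : RowMat Bool) : RowMat Bool :=
  GT.map fun c => HT.map fun d => (c.zip A).all fun p => edgeMatch p.1 d p.2

/-- The table of the partial homomorphisms. -/
noncomputable def homRows (GT HT : RowMat (Entry σ)) : RowMat Bool :=
  GT.foldl (fun A _ => homStep GT HT A) (GT.map fun _ => HT.map fun _ => true)

/-- Whether all entries are absent. -/
def allNone (l : List (Entry σ)) : Bool := l.all fun e => e.isNone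

/-- The vertices of the instance where a match of the query ends. -/
noncomputable def endRow (G GT HT : RowMat (Entry σ)) : List Bool :=
  (transposeRows (homRows GT HT)).map fun l => (G.zip l).any fun p => p.2 && allNone p.1

/-- The numerators at the next stage, along a present edge. -/
def shiftRow (b : Bool) : List ℕ → List ℕ
  | [] => []
  | h :: t => (bif b then 0 else h) :: (h :: t).reverse.tail.reverse

/-- The factors that an entry of the instance contributes. -/
def contribution (ones : List ℕ) (p : Entry σ × List ℕ × Bool) : List ℕ :=
  match p.1 with
  | none => ones
  | some q => match p.2.1 with
    | [] => []
    | D :: r => (q.2.2 * D) :: (shiftRow p.2.2 r).map fun s =>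
        binSub q.2.2 q.2.1 * r.reverse.headD 0 + q.2.1 * s

/-- Componentwise products. -/
def rowProd (ones : List ℕ) (l : List (List ℕ)) : List ℕ :=
  l.foldr (fun a s => a.zipWith (fun x y => x * y) s) ones

/-- One round of the computation of the probabilities. -/
def tabStep (ones : List ℕ) (H : RowMat (Entry σ)) (M : List Bool) (T : List (List ℕ)) :
    List (List ℕ) :=
  H.map fun r => rowProd ones ((r.zip (T.zip M)).map (contribution ones))

/-- The table of the probabilities. -/
def tabRows (ones : List ℕ) (H : RowMat (Entry σ)) (M : List Bool) : List (List ℕ) :=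
  H.foldl (fun T _ => tabStep ones H M T) (H.map fun _ => ones)

/-- The row of the root. -/
def rootRow (HT : RowMat (Entry σ)) (T : List (List ℕ)) : List ℕ :=
  (HT.zip T).foldr (fun p s => bif allNone p.1 then p.2 else s) []

/-- The fraction read off the row of the root. -/
def rowFraction : List ℕ → ℕ × ℕ
  | [] => (0, 0)
  | D :: r => (binSub D (r.reverse.headD 0), D)

/-- The whole algorithm. -/
noncomputable def phomAlg (G H : RowMat (Entry σ)) : ℕ × ℕ :=
  rowFraction (rootRow (transposeRows H) (tabRows (G.map fun _ => 1) H
    (endRow G (transposeRows G) (transposeRows H))))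

/-- The word written for a fraction. -/
def writeFraction (p : ℕ × ℕ) : List (TapeSymbol σ) :=
  (p.1.bits.map TapeSymbol.bit ++ [.endNumber]) ++ (p.2.bits.map TapeSymbol.bit ++ [.endNumber])

theorem encodeRatProb_eq (p : RatProb) :
    encodeRatProb (σ := σ) p = writeFraction (p.num, p.den) := by
  simp [encodeRatProb, encodeNumber, encodeNat_eq_bits, writeFraction]

/-! ### Correctness of the algorithm -/

/-- The table of the partial homomorphisms, as a function. -/
noncomputable def homTab {m n : ℕ} (EG : Fin m → Fin m → Entry σ) (EH : Fin n → Fin n → Entry σ) :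
    ℕ → Fin m → Fin n → Bool
  | 0, _, _ => true
  | k + 1, u', w' => (List.finRange m).all fun u => match EG u u' with
    | none => true
    | some q => (List.finRange n).any fun w => homTab EG EH k u w && entryHas q.1 (EH w w')

theorem foldl_const {β γ : Type} (f : γ → γ) (l : List β) (a : γ) :
    l.foldl (fun s _ => f s) a = f^[l.length] a := by
  induction l generalizing a with
  | nil => rfl
  | cons b l ih => rw [List.foldl_cons, ih]; rfl

theorem homStep_iterate {m n : ℕ} (EG : Fin m → Fin m → Entry σ) (EH : Fin n → Fin n → Entry σ)
    (k : ℕ) : (homStep (toRows fun v u => EG u v) (toRows fun v u => EH u v))^[k]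
      ((toRows fun v u => EG u v).map fun _ => (toRows fun v u => EH u v).map fun _ => true) =
      toRows (homTab EG EH k) := by
  induction k with
  | zero => simp [toRows, homTab, Function.comp_def]
  | succ k ih =>
    rw [Function.iterate_succ_apply', ih]
    simp only [homStep, toRows, List.map_map, Function.comp_def, List.zip_map', List.all_map]
    refine List.map_congr_left fun u' _ => List.map_congr_left fun w' _ => ?_
    rw [homTab]
    congr 1
    funext u
    cases EG u u' with
    | none => rfl
    | some q => simp only [edgeMatch, List.zip_map', List.any_map, Function.comp_def]

theorem endRow_eq {m n : ℕ} (hm : 0 < m) (EG : Fin m → Fin m → Entry σ)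
    (EH : Fin n → Fin n → Entry σ) :
    endRow (toRows EG) (toRows fun v u => EG u v) (toRows fun v u => EH u v) =
      (List.finRange n).map fun w => (List.finRange m).any fun u =>
        homTab EG EH m u w && (List.finRange m).all fun u' => (EG u u').isNone := by
  have hl : (toRows fun v u => EG u v).length = m := by simp [toRows]
  rw [endRow, homRows, foldl_const, homStep_iterate, hl, transposeRows_toRows hm]
  simp only [toRows, List.map_map, Function.comp_def, List.zip_map', List.any_map, allNone,
    List.all_map]

theorem entryHas_label_iff {n : ℕ} (H : ProbGraph σ (Fin n)) (R : σ) (w w' : Fin n) :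
    entryHas (.label R) (probEntry H w w') = true ↔ H.graph.edge w w' = some R := by
  unfold probEntry
  split_ifs with h
  · obtain ⟨S, hS⟩ := Option.isSome_iff_exists.1 (LabeledGraph.mem_edges.1 h)
    simp [entryHas, symEq, hS, eq_comm]
  · rw [LabeledGraph.mem_edges, Option.not_isSome_iff_eq_none] at h
    simp [entryHas, h]

/-- The vertex `a t` has a single incoming edge, from `a (t - 1)`, so its table row concerns only
the prefix of length `t` and is final after `t` rounds. Walks indexed by `ℕ` are unconstrained past
`t`. -/
theorem homTab_iff {m n N : ℕ} {G : LabeledGraph σ (Fin N)} {a : Fin (m + 1) ≃ Fin N}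
    {R : Fin m → σ} (hG : G.IsOneWayPathAlong a R) (H : ProbGraph σ (Fin n)) :
    ∀ (t : ℕ) (ht : t < m + 1) (k : ℕ) (w : Fin n), t ≤ k →
    (homTab (graphEntry G) (probEntry H) k (a ⟨t, ht⟩) w = true ↔
      ∃ b : ℕ → Fin n, b t = w ∧ ∀ j (hj : j < m), j < t →
        H.graph.edge (b j) (b (j + 1)) = some (R ⟨j, hj⟩)) := by
  intro t
  induction t with
  | zero =>
    intro ht k w _
    refine iff_of_true ?_ ⟨fun _ => w, rfl, fun j _ h => absurd h (Nat.not_lt_zero _)⟩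
    cases k with
    | zero => rfl
    | succ k =>
      rw [homTab, List.all_eq_true]
      intro u _
      have : graphEntry G u (a ⟨0, ht⟩) = none := by
        rw [graphEntry, Option.map_eq_none_iff]
        by_contra hne
        obtain ⟨S, hS⟩ := Option.ne_none_iff_exists'.1 hne
        obtain ⟨l, -, h2, -⟩ := (hG (a.symm u) ⟨0, ht⟩ S).1 (by simpa using hS)
        exact absurd (congrArg Fin.val h2) (by simp)
      rw [this]
  | succ t ih =>
    intro ht k w hk
    obtain ⟨k, rfl⟩ : ∃ l, k = l + 1 := ⟨k - 1, by omega⟩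
    have hin : ∀ u S, G.edge u (a ⟨t + 1, ht⟩) = some S ↔
        u = a ⟨t, by omega⟩ ∧ S = R ⟨t, by omega⟩ := by
      intro u S
      have := hG (a.symm u) ⟨t + 1, ht⟩ S
      rw [Equiv.apply_symm_apply] at this
      rw [this]
      constructor
      · rintro ⟨l, h1, h2, rfl⟩
        have h3 : t = l := by simpa using congrArg Fin.val h2
        subst h3
        exact ⟨by rw [← Equiv.symm_apply_eq, h1]; rfl, rfl⟩
      · rintro ⟨rfl, rfl⟩
        exact ⟨⟨t, by omega⟩, by simp, rfl, rfl⟩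
    have h1 : homTab (graphEntry G) (probEntry H) (k + 1) (a ⟨t + 1, ht⟩) w = true ↔
        ∃ w₀, homTab (graphEntry G) (probEntry H) k (a ⟨t, by omega⟩) w₀ = true ∧
          H.graph.edge w₀ w = some (R ⟨t, by omega⟩) := by
      rw [homTab, List.all_eq_true]
      constructor
      · intro h
        have := h (a ⟨t, by omega⟩) (List.mem_finRange _)
        rw [graphEntry, (hin _ _).2 ⟨rfl, rfl⟩] at this
        simp only [Option.map_some, List.any_eq_true, Bool.and_eq_true, entryHas_label_iff] at this
        obtain ⟨w₀, -, h2⟩ := this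
        exact ⟨w₀, h2⟩
      · rintro ⟨w₀, h2, h3⟩ u -
        cases he : G.edge u (a ⟨t + 1, ht⟩) with
        | none => simp [graphEntry, he]
        | some S =>
          obtain ⟨rfl, rfl⟩ := (hin _ _).1 he
          simp only [graphEntry, he, Option.map_some, List.any_eq_true, Bool.and_eq_true,
            entryHas_label_iff]
          exact ⟨w₀, List.mem_finRange _, h2, h3⟩
    rw [h1]
    constructor
    · rintro ⟨w₀, h2, h3⟩
      obtain ⟨b, rfl, hb⟩ := (ih (by omega) k w₀ (by omega)).1 h2
      refine ⟨fun j => if j ≤ t then b j else w, by simp, fun j hj hjt => ?_⟩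
      rcases Nat.lt_or_ge j t with h | h
      · simpa [h.le, Nat.succ_le_of_lt h] using hb j hj h
      · obtain rfl : j = t := by omega
        simpa using h3
    · rintro ⟨b, rfl, hb⟩
      exact ⟨b t, (ih (by omega) k _ (by omega)).2 ⟨b, rfl, fun j hj h => hb j hj (by omega)⟩,
        hb t (by omega) (by omega)⟩

/-- The vertices of the instance where a match of the query ends, as a function. -/
noncomputable def endTab {N n : ℕ} (G : LabeledGraph σ (Fin N)) (H : ProbGraph σ (Fin n))
    (w : Fin n) : Bool :=
  (List.finRange N).any fun u => homTab (graphEntry G) (probEntry H) N u w &&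
    (List.finRange N).all fun u' => (graphEntry G u u').isNone

/-- The last vertex of the path is recognized as the only one without outgoing edge, and `N = m + 1`
rounds suffice for its row. -/
theorem endTab_iff {m n N : ℕ} {G : LabeledGraph σ (Fin N)} {a : Fin (m + 1) ≃ Fin N}
    {R : Fin m → σ} (hG : G.IsOneWayPathAlong a R) (H : ProbGraph σ (Fin n)) (w : Fin n) :
    endTab G H w = true ↔ ∃ b : Fin (m + 1) → Fin n, b (Fin.last m) = w ∧
      ∀ k : Fin m, H.graph.edge (b k.castSucc) (b k.succ) = some (R k) := by
  have hN : m + 1 = N := by simpa using Fintype.card_congr a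
  have hlast : ∀ u, ((List.finRange N).all fun u' => (graphEntry G u u').isNone) = true ↔
      u = a (Fin.last m) := by
    intro u
    simp only [List.all_eq_true, List.mem_finRange, true_implies, graphEntry, Option.isNone_map,
      Option.isNone_iff_eq_none]
    constructor
    · intro h
      by_contra hne
      have hlt : (a.symm u).val < m := by
        have h1 := (a.symm u).isLt
        have h2 : a.symm u ≠ Fin.last m := fun h => hne (by rw [← h, Equiv.apply_symm_apply])
        have h3 : (a.symm u).val ≠ m := fun h => h2 (Fin.ext h)
        omega
      have := (hG (a.symm u) (Fin.succ ⟨_, hlt⟩) (R ⟨_, hlt⟩)).2 ⟨⟨_, hlt⟩, rfl, rfl, rfl⟩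
      rw [Equiv.apply_symm_apply, h] at this
      simp at this
    · rintro rfl u'
      by_contra hne
      obtain ⟨S, hS⟩ := Option.ne_none_iff_exists'.1 hne
      obtain ⟨l, h1, -⟩ := (hG (Fin.last m) (a.symm u') S).1 (by simpa using hS)
      have := congrArg Fin.val h1
      have := l.isLt
      simp at *
      omega
  have h1 : endTab G H w = true ↔
      homTab (graphEntry G) (probEntry H) N (a (Fin.last m)) w = true := by
    simp only [endTab, List.any_eq_true, Bool.and_eq_true, hlast, List.mem_finRange, true_and]
    constructor
    · rintro ⟨u, h, rfl⟩
      exact h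
    · exact fun h => ⟨_, h, rfl⟩
  rw [h1]
  refine (homTab_iff hG H m (by omega) N w (by omega)).trans ?_
  constructor
  · rintro ⟨b, hb, h⟩
    exact ⟨fun i => b i, hb, fun k => h k k.isLt k.isLt⟩
  · rintro ⟨b, hb, h⟩
    refine ⟨fun j => if hj : j < m + 1 then b ⟨j, hj⟩ else w,
      (dif_pos (Nat.lt_succ_self m)).trans hb,
      fun j hj _ => ?_⟩
    have := h ⟨j, hj⟩
    simpa [hj, Nat.lt_succ_of_lt hj] using this

/-- The entries of the table of the probabilities: the denominator and the numerators. -/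
noncomputable def rowEntry {V : Type} [Fintype V] (H : ProbGraph σ V) (M : V → Bool) (m k : ℕ)
    (v : V) : ℕ → ℕ
  | 0 => H.denTab k v
  | i + 1 => H.numTab M m k v i

theorem rowProd_map {β : Type} (l : List β) (js : List ℕ) (f : β → ℕ → ℕ) :
    rowProd (js.map fun _ => 1) (l.map fun w => js.map (f w)) =
      js.map fun j => (l.map fun w => f w j).prod := by
  induction l with
  | nil => simp [rowProd]
  | cons w l ih =>
    rw [rowProd] at ih
    rw [List.map_cons, rowProd, List.foldr_cons, ih, List.zipWith_map, List.zipWith_self]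
    simp

/-- The map sending `i` to `i - 1` shifts the row by one place, drops its last entry and repeats the
first, or puts zero there if a match is completed. -/
theorem shiftRow_map (b : Bool) (m : ℕ) (f : ℕ → ℕ) : shiftRow b ((List.range m).map f) =
    (List.range m).map fun i => if i = 0 ∧ b = true then 0 else f (i - 1) := by
  cases m with
  | zero => rfl
  | succ m =>
    have h : ((List.range (m + 1)).map f).reverse.tail.reverse = (List.range m).map f := by
      rw [List.range_succ]; simp
    rw [List.range_succ_eq_map, List.map_cons] at h ⊢
    rw [shiftRow, h]
    cases b <;> simp

/-- The last numerator belongs to the state without credit. Its default `0` for `m = 0` makes the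
final fraction equal to one, as it must be for a single-vertex query. -/
theorem headD_reverse_map_range (m : ℕ) (f : ℕ → ℕ) :
    ((List.range m).map f).reverse.headD 0 = if m = 0 then 0 else f (m - 1) := by
  cases m with
  | zero => rfl
  | succ m => rw [List.range_succ]; simp

theorem contribution_eq {n : ℕ} (H : ProbGraph σ (Fin n)) (M : Fin n → Bool) (m k : ℕ)
    (v w : Fin n) : contribution ((List.range (m + 1)).map fun _ => 1)
      (probEntry H v w, (List.range (m + 1)).map (rowEntry H M m k w), M w) =
    (List.range (m + 1)).map fun j => if h : (v, w) ∈ H.graph.edges then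
      match j with
      | 0 => (H.prob ⟨(v, w), h⟩).den * H.denTab k w
      | i + 1 => ((H.prob ⟨(v, w), h⟩).den - (H.prob ⟨(v, w), h⟩).num) * H.numTab M m k w (m - 1) +
        (H.prob ⟨(v, w), h⟩).num * (if i = 0 ∧ M w = true then 0 else H.numTab M m k w (i - 1))
      else 1 := by
  unfold contribution probEntry
  by_cases h : (v, w) ∈ H.graph.edges
  · simp only [h, dite_true]
    rw [List.range_succ_eq_map, List.map_cons, List.map_cons, List.map_map, List.map_map]
    simp only [Function.comp_def, rowEntry]
    congr 1
    rw [shiftRow_map, headD_reverse_map_range, binSub_eq (RatProb.num_le_den _), List.map_map]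
    refine List.map_congr_left fun i hi => ?_
    have : m ≠ 0 := by
      have := List.mem_range.1 hi
      omega
    simp only [Function.comp_def, this, if_false]
  · simp only [h, dite_false]

/-- Denominator and numerators share a row, the denominator at index `0`, so componentwise products
update both tables at once. -/
theorem tabStep_iterate {n : ℕ} (H : ProbGraph σ (Fin n)) (M : Fin n → Bool) (m k : ℕ) :
    (tabStep ((List.range (m + 1)).map fun _ => 1) (toRows (probEntry H))
      ((List.finRange n).map M))^[k]
      ((toRows (probEntry H)).map fun _ => (List.range (m + 1)).map fun _ => 1) =
    (List.finRange n).map fun v => (List.range (m + 1)).map (rowEntry H M m k v) := by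
  induction k with
  | zero =>
    simp only [Function.iterate_zero, id, toRows, List.map_map, Function.comp_def]
    refine List.map_congr_left fun v _ => List.map_congr_left fun j _ => ?_
    cases j <;> rfl
  | succ k ih =>
    rw [Function.iterate_succ_apply', ih]
    simp only [tabStep, toRows, List.map_map, Function.comp_def, List.zip_map']
    refine List.map_congr_left fun v _ => ?_
    simp only [contribution_eq]
    rw [rowProd_map]
    refine List.map_congr_left fun j _ => ?_
    rw [← Fin.prod_univ_def]
    cases j with
    | zero =>
      rw [rowEntry, ProbGraph.denTab]
      refine Finset.prod_congr rfl fun w _ => ?_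
      by_cases h : (v, w) ∈ H.graph.edges <;> simp only [h, dite_true, dite_false]
    | succ i =>
      rw [rowEntry, ProbGraph.numTab]
      refine Finset.prod_congr rfl fun w _ => ?_
      by_cases h : (v, w) ∈ H.graph.edges <;> simp only [h, dite_true, dite_false]

/-- The algorithm is not told the root; it finds it as the vertex whose column is empty. -/
theorem allNone_iff {n : ℕ} {H : ProbGraph σ (Fin n)} (T : H.graph.TreeData) (v : Fin n) :
    allNone ((List.finRange n).map fun u => probEntry H u v) = true ↔ v = T.root := by
  simp only [allNone, List.all_map, List.all_eq_true, List.mem_finRange, true_implies,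
    Function.comp_def, Option.isNone_iff_eq_none]
  constructor
  · intro h
    by_contra hv
    have h1 := LabeledGraph.mem_edges.2 (T.edge_par hv)
    have h2 := h (T.par v)
    simp [probEntry, h1] at h2
  · rintro rfl u
    have : ¬ (u, T.root) ∈ H.graph.edges := by
      rw [LabeledGraph.mem_edges, T.edge_root]
      simp
    simp [probEntry, this]

theorem rootRow_eq {n : ℕ} {H : ProbGraph σ (Fin n)} (T : H.graph.TreeData)
    (f : Fin n → List ℕ) :
    rootRow (toRows fun v u => probEntry H u v) ((List.finRange n).map f) = f T.root := by
  have : ∀ l : List (Fin n), T.root ∈ l → (l.map fun v =>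
      ((List.finRange n).map fun u => probEntry H u v, f v)).foldr
      (fun p s => bif allNone p.1 then p.2 else s) [] = f T.root := by
    intro l
    induction l with
    | nil => simp
    | cons v l ih =>
      intro hl
      rw [List.map_cons, List.foldr_cons]
      by_cases hv : v = T.root
      · simp only [hv, (allNone_iff T T.root).2 rfl, cond_true]
      · have h1 : allNone ((List.finRange n).map fun u => probEntry H u v) = false := by
          rw [← Bool.not_eq_true, allNone_iff T]
          exact hv
        simp only [h1, cond_false]
        exact ih ((List.mem_cons.1 hl).resolve_left fun h => hv h.symm)
  rw [rootRow, toRows, List.zip_map']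
  exact this _ (List.mem_finRange _)

theorem exists_ratProb_of_alg (x : PHomInput σ (fun _ G => G.IsOneWayPath)
    (fun _ H => H.IsDownwardTree)) : ∃ p : RatProb, p.val = ProbGraph.homProb x.query x.inst ∧
    phomAlg (toRows (graphEntry x.query)) (toRows (probEntry x.inst)) = (p.num, p.den) := by
  obtain ⟨m, a, R, hG⟩ := x.query_mem
  obtain ⟨T⟩ := LabeledGraph.IsDownwardTree.nonempty_treeData x.inst_mem
  have hN : m + 1 = x.querySize := by simpa using Fintype.card_congr a
  have hones : ((toRows (graphEntry x.query)).map fun _ => 1) =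
      (List.range (m + 1)).map fun _ => 1 := by
    simp [toRows, hN, Function.comp_def]
  have hl : (toRows (probEntry x.inst)).length = x.instSize := by simp [toRows]
  have halg : phomAlg (toRows (graphEntry x.query)) (toRows (probEntry x.inst)) =
      rowFraction ((List.range (m + 1)).map
        (rowEntry x.inst (endTab x.query x.inst) m x.instSize T.root)) := by
    rw [phomAlg, transposeRows_toRows x.instSize_pos, transposeRows_toRows x.querySize_pos,
      endRow_eq x.querySize_pos, hones, tabRows, foldl_const, hl]
    change rowFraction (rootRow _ ((tabStep _ _ ((List.finRange x.instSize).map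
      (endTab x.query x.inst)))^[x.instSize] _)) = _
    rw [tabStep_iterate, rootRow_eq T]
  have hprob := ProbGraph.homProb_eq_tab (endTab x.query x.inst) T hG
    (endTab_iff hG x.inst) (n := x.instSize) (by simp)
  rw [halg, List.range_succ_eq_map, List.map_cons, List.map_map, rowFraction]
  simp only [Function.comp_def]
  rw [headD_reverse_map_range]
  have hpos := x.inst.denTab_pos x.instSize T.root
  have hle : (if m = 0 then 0 else rowEntry x.inst (endTab x.query x.inst) m x.instSize T.root
      (m - 1 + 1)) ≤ x.inst.denTab x.instSize T.root := by
    split_ifs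
    · exact Nat.zero_le _
    · exact ProbGraph.numTab_le_denTab ..
  -- The fraction is output unreduced, over the denominator found at the root.
  refine ⟨⟨_, x.inst.denTab x.instSize T.root, hpos, Nat.sub_le _ (if m = 0 then 0 else
    rowEntry x.inst (endTab x.query x.inst) m x.instSize T.root (m - 1 + 1))⟩, ?_, ?_⟩
  · rw [RatProb.val, hprob]
    have : (x.inst.denTab x.instSize T.root : ℚ) ≠ 0 := by exact_mod_cast hpos.ne'
    simp only
    rw [Nat.cast_sub hle, sub_div, div_self this]
    split_ifs <;> simp [rowEntry]
  · simp only [rowEntry] at hle ⊢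
    rw [binSub_eq hle]

end Algorithm

/-! ### The algorithm takes polynomial time -/

section Complexity

open Enc

attribute [local irreducible] PolyT binSub

variable {σ : Type} [Fintype σ] {α : Type} [Enc α]

noncomputable instance {𝒢 ℋ : GraphClass σ} : Enc (PHomInput σ 𝒢 ℋ) :=
  ⟨fun x => enc (encodePHomInput x).reverse⟩

theorem Nat.size_mul_le (m n : ℕ) : (m * n).size ≤ m.size + n.size := by
  rw [Nat.size_le, pow_add]
  exact Nat.mul_lt_mul'' (Nat.lt_size_self m) (Nat.lt_size_self n)

theorem Nat.size_prod_le {ι : Type} (s : Finset ι) (f : ι → ℕ) :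
    (∏ i ∈ s, f i).size ≤ ∑ i ∈ s, (f i).size + 1 := by
  classical
  induction s using Finset.induction_on with
  | empty => simp
  | insert i s hi ih =>
    rw [Finset.prod_insert hi, Finset.sum_insert hi, add_assoc]
    exact (Nat.size_mul_le _ _).trans (Nat.add_le_add_left ih _)

theorem sz_natBit_le (b : Bool) (n : ℕ) : sz (Nat.bit b n) ≤ sz n + 4 := by
  by_cases h : n = 0 → b = true
  · have h1 : sz (Nat.bit b n) = sz (b :: n.bits) := by
      rw [← Nat.bits_append_bit n b h]
      rfl
    have h2 : sz n = sz n.bits := rfl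
    have := sz_bool_le b
    rw [h1, h2, sz_cons]
    omega
  · push Not at h
    obtain ⟨rfl, hb⟩ := h
    cases b
    · decide
    · exact absurd rfl hb

-- The list serves as a round counter, so a bound valid for all iterates covers every prefix.
omit [Fintype σ] in
theorem foldl_prefix_const {β γ : Type} (f : γ → γ) (a : γ) {l' l : List β} (P : γ → Prop)
    (h : ∀ k, P (f^[k] a)) (_ : l' <+: l) : P (l'.foldl (fun s _ => f s) a) := by
  rw [foldl_const]
  exact h _

namespace PolyT

theorem symEq : PolyT σ fun p : TapeSymbol σ × TapeSymbol σ => _root_.symEq p.1 p.2 :=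
  finCases (f := fun a b => _root_.symEq a b) fun a =>
    (finCases (f := fun b (_ : Unit) => _root_.symEq a b) fun _ => const _).comp (pair PolyT.id (const ()))

theorem addEntry {f : α → Entry σ} {g : α → RowMat (Entry σ)} (hf : PolyT σ f) (hg : PolyT σ g) :
    PolyT σ fun x => _root_.addEntry (f x) (g x) :=
  (listCase hg (const []) (h := fun x r rs => (f x :: r) :: rs)
    (cons (cons (hf.comp snd) (fst.comp fst)) (snd.comp fst))).of_eq fun x => by
      cases g x <;> rfl

theorem sz_addEntry_le (e : Entry σ) (l : RowMat (Entry σ)) :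
    sz (_root_.addEntry e l) ≤ sz e + sz l + 1 := by
  cases l with
  | nil => simp [_root_.addEntry]
  | cons r rs => simp [_root_.addEntry]; omega

theorem parseStep :
    PolyT σ fun p : TapeSymbol σ × ParseState σ => _root_.parseStep p.1 p.2 := by
  refine finCases (f := _root_.parseStep) fun a => ?_
  have nums : PolyT σ fun s : ParseState σ => s.1 := fst
  have rows : PolyT σ fun s : ParseState σ => s.2.1 := fst.comp snd
  have mats : PolyT σ fun s : ParseState σ => s.2.2 := snd.comp snd
  cases a with
  | bit b => exact pair (pair (natBit (const b) (fst.comp nums)) (snd.comp nums)) snd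
  | label R =>
    exact pair (const (0, 0)) (pair (addEntry (some (pair (const (TapeSymbol.label R)) nums)) rows) mats)
  | noEdge => exact pair nums (pair (addEntry (const none) rows) mats)
  | endNumber => exact pair (pair (const 0) (fst.comp nums)) snd
  | endRow => exact pair nums (pair (cons (const []) rows) mats)
  | endGraph => exact pair nums (pair (const []) (cons rows mats))

/-- One symbol enlarges the parser state by at most its own size plus a constant, the growth that
`foldl_of_le` asks for. -/
theorem sz_parseStep_le (a : TapeSymbol σ) (s : ParseState σ) : sz (_root_.parseStep a s) ≤
    sz s + sz a + (2 * Fintype.card (TapeSymbol σ) + 20) := by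
  obtain ⟨⟨m, n⟩, rows, mats⟩ := s
  have h0 : sz (0 : ℕ) = 1 := rfl
  have hn := sz_pos n
  have hm := sz_pos m
  have hr := sz_pos rows
  cases a with
  | bit b =>
    have := sz_natBit_le b m
    simp only [_root_.parseStep, sz_prod]
    omega
  | label R =>
    have h1 := sz_addEntry_le (.some (.label R, (m, n))) rows
    have h2 := sz_symbol_le (TapeSymbol.label R)
    simp only [_root_.parseStep, sz_prod, sz_some, h0] at h1 ⊢
    omega
  | noEdge =>
    have h1 := sz_addEntry_le (σ := σ) none rows
    simp only [_root_.parseStep, sz_prod, sz_none] at h1 ⊢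
    omega
  | endNumber =>
    simp only [_root_.parseStep, sz_prod, h0]
    omega
  | endRow =>
    simp only [_root_.parseStep, sz_prod, sz_cons, sz_nil]
    omega
  | endGraph =>
    simp only [_root_.parseStep, sz_prod, sz_cons, sz_nil]
    omega

theorem parse {𝒢 ℋ : GraphClass σ} : PolyT σ fun x : PHomInput σ 𝒢 ℋ =>
    (encodePHomInput x).foldr _root_.parseStep ((0, 0), [], []) := by
  have h : PolyT σ fun x : PHomInput σ 𝒢 ℋ => (encodePHomInput x).reverse :=
    PolyT.id.congr_enc fun _ => rfl
  have hs : PolyT σ fun p : PHomInput σ 𝒢 ℋ × ParseState σ × TapeSymbol σ =>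
      _root_.parseStep p.2.2 p.2.1 := parseStep.comp (pair (snd.comp snd) (fst.comp snd))
  have hf := foldl_of_le h (const (((0, 0), [], []) : ParseState σ))
    (step := fun _ s a => _root_.parseStep a s) hs _ fun _ s a => sz_parseStep_le a s
  exact hf.of_eq fun x => List.foldl_reverse

theorem queryRows {𝒢 ℋ : GraphClass σ} :
    PolyT σ fun x : PHomInput σ 𝒢 ℋ => toRows (graphEntry x.query) :=
  ((fst.comp snd).comp parse).of_eq fun x => by rw [parse_encodePHomInput]

theorem instRows {𝒢 ℋ : GraphClass σ} :
    PolyT σ fun x : PHomInput σ 𝒢 ℋ => toRows (probEntry x.inst) :=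
  (headD ((snd.comp snd).comp parse) (const [])).of_eq fun x => by
    rw [parse_encodePHomInput]
    rfl

theorem entryHas {f : α → TapeSymbol σ} {g : α → Entry σ} (hf : PolyT σ f) (hg : PolyT σ g) :
    PolyT σ fun x => _root_.entryHas (f x) (g x) :=
  (optionCase hg (const false) (g := fun x q => _root_.symEq (f x) q.1)
    (symEq.comp (pair (hf.comp fst) (fst.comp snd)))).of_eq fun x => by cases g x <;> rfl

theorem edgeMatch {e : α → Entry σ} {c : α → List (Entry σ)} {l : α → List Bool}
    (he : PolyT σ e) (hc : PolyT σ c) (hl : PolyT σ l) :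
    PolyT σ fun x => _root_.edgeMatch (e x) (c x) (l x) := by
  have h1 : PolyT σ fun y : (α × TapeSymbol σ × ℕ × ℕ) × Entry σ × Bool =>
      y.2.2 && _root_.entryHas y.1.2.1 y.2.1 :=
    and (snd.comp snd) (entryHas (fst.comp (snd.comp fst)) (fst.comp snd))
  have h2 : PolyT σ fun x : α × TapeSymbol σ × ℕ × ℕ =>
      ((c x.1).zip (l x.1)).any fun p => p.2 && _root_.entryHas x.2.1 p.1 :=
    any (zip (hc.comp fst) (hl.comp fst))
      (g := fun (x : α × TapeSymbol σ × ℕ × ℕ) (p : Entry σ × Bool) =>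
        p.2 && _root_.entryHas x.2.1 p.1) h1
  refine (optionCase he (const true) (g := fun x (q : TapeSymbol σ × ℕ × ℕ) =>
    ((c x).zip (l x)).any fun p => p.2 && _root_.entryHas q.1 p.1) h2).of_eq fun x => ?_
  unfold _root_.edgeMatch
  cases e x <;> rfl

theorem homStep {G H : α → RowMat (Entry σ)} {A : α → RowMat Bool} (hG : PolyT σ G)
    (hH : PolyT σ H) (hA : PolyT σ A) : PolyT σ fun x => _root_.homStep (G x) (H x) (A x) := by
  have h1 : PolyT σ fun y : ((α × List (Entry σ)) × List (Entry σ)) × Entry σ × List Bool =>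
      _root_.edgeMatch y.2.1 y.1.2 y.2.2 :=
    edgeMatch (fst.comp snd) (snd.comp fst) (snd.comp snd)
  have h2 : PolyT σ fun y : (α × List (Entry σ)) × List (Entry σ) =>
      (y.1.2.zip (A y.1.1)).all fun p => _root_.edgeMatch p.1 y.2 p.2 :=
    all (zip (snd.comp fst) (hA.comp (fst.comp fst)))
      (g := fun y (p : Entry σ × List Bool) => _root_.edgeMatch p.1 y.2 p.2) h1
  have h3 : PolyT σ fun y : α × List (Entry σ) => (H y.1).map fun d =>
      (y.2.zip (A y.1)).all fun p => _root_.edgeMatch p.1 d p.2 :=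
    map (hH.comp fst) (g := fun (y : α × List (Entry σ)) (d : List (Entry σ)) =>
      (y.2.zip (A y.1)).all fun p => _root_.edgeMatch p.1 d p.2) h2
  exact map hG (g := fun x (c : List (Entry σ)) => (H x).map fun d =>
      (c.zip (A x)).all fun p => _root_.edgeMatch p.1 d p.2) h3

theorem homRows {G H : α → RowMat (Entry σ)} (hG : PolyT σ G) (hH : PolyT σ H) :
    PolyT σ fun x => _root_.homRows (G x) (H x) := by
  refine foldl (step := fun x A _ => _root_.homStep (G x) (H x) A) hG
    (map hG (g := fun x _ => (H x).map fun _ => true)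
      (map (hH.comp fst) (g := fun _ _ => true) (const true)))
    (homStep (hG.comp fst) (hH.comp fst) (fst.comp snd))
    (B := fun x => sz (G x) * (sz (H x) * 4 + 2) + 1)
    ((hG.polyBd.mul ((hH.polyBd.mul (.const 4)).add (.const 2))).add (.const 1)) fun x l' hl' => ?_
  refine foldl_prefix_const (_root_.homStep (G x) (H x)) _ (fun A => sz A ≤ _) (fun k => ?_) hl'
  -- Every iterate is a Boolean matrix of the same dimensions, so its size does not depend on the
  -- round.
  obtain ⟨g, hg⟩ : ∃ g : List (Entry σ) → List (Entry σ) → Bool,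
      (_root_.homStep (G x) (H x))^[k] ((G x).map fun _ => (H x).map fun _ => true) =
        (G x).map fun c => (H x).map (g c) := by
    cases k with
    | zero => exact ⟨fun _ _ => true, rfl⟩
    | succ k =>
      rw [Function.iterate_succ_apply']
      exact ⟨_, rfl⟩
  rw [hg]
  refine (sz_le_mul _ ((H x).length * 4 + 1) fun r hr => ?_).trans ?_
  · obtain ⟨c, -, rfl⟩ := List.mem_map.1 hr
    refine (sz_le_mul _ 3 fun b _ => sz_bool_le b).trans ?_
    rw [List.length_map]
  · rw [List.length_map]
    have h1 := (length_lt_sz (G x)).le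
    have h2 := (length_lt_sz (H x)).le
    have h3 : (H x).length * 4 + 1 + 1 ≤ sz (H x) * 4 + 2 := by omega
    exact Nat.add_le_add_right (Nat.mul_le_mul h1 h3) 1

theorem allNone {f : α → List (Entry σ)} (hf : PolyT σ f) :
    PolyT σ fun x => _root_.allNone (f x) := by
  have h : PolyT σ fun y : α × Entry σ => y.2.isNone :=
    (optionCase snd (const true) (g := fun _ _ => false) (const false)).of_eq fun y => by
      cases y.2 <;> rfl
  exact all hf (g := fun _ (e : Entry σ) => e.isNone) h

theorem endRow {G GT HT : α → RowMat (Entry σ)} (hG : PolyT σ G) (hGT : PolyT σ GT)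
    (hHT : PolyT σ HT) : PolyT σ fun x => _root_.endRow (G x) (GT x) (HT x) := by
  have h1 : PolyT σ fun y : (α × List Bool) × List (Entry σ) × Bool =>
      y.2.2 && _root_.allNone y.2.1 := and (snd.comp snd) (allNone (fst.comp snd))
  have h2 : PolyT σ fun y : α × List Bool =>
      ((G y.1).zip y.2).any fun p => p.2 && _root_.allNone p.1 :=
    any (zip (hG.comp fst) snd)
      (g := fun _ (p : List (Entry σ) × Bool) => p.2 && _root_.allNone p.1) h1
  exact map (transpose (homRows hGT hHT)) (g := fun x (l : List Bool) =>
    ((G x).zip l).any fun p => p.2 && _root_.allNone p.1) h2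

omit [Fintype σ] in
theorem shiftRow {b : α → Bool} {f : α → List ℕ} (hb : PolyT σ b) (hf : PolyT σ f) :
    PolyT σ fun x => _root_.shiftRow (b x) (f x) :=
  (listCase hf (const []) (h := fun x h t => (bif b x then 0 else h) :: (h :: t).reverse.tail.reverse)
    (cons (cond (hb.comp snd) (const 0) (fst.comp fst))
      (reverse (tail (reverse (cons (fst.comp fst) (snd.comp fst))))))).of_eq fun x => by
        cases f x <;> rfl

theorem contribution {ones : α → List ℕ} {e : α → Entry σ} {r : α → List ℕ} {b : α → Bool}
    (ho : PolyT σ ones) (he : PolyT σ e) (hr : PolyT σ r) (hb : PolyT σ b) :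
    PolyT σ fun x => _root_.contribution (ones x) (e x, r x, b x) := by
  have num : PolyT σ fun y : ((ℕ × List ℕ) × α × TapeSymbol σ × ℕ × ℕ) × ℕ => y.1.2.2.2.1 :=
    fst.comp (snd.comp (snd.comp (snd.comp fst)))
  have den : PolyT σ fun y : ((ℕ × List ℕ) × α × TapeSymbol σ × ℕ × ℕ) × ℕ => y.1.2.2.2.2 :=
    snd.comp (snd.comp (snd.comp (snd.comp fst)))
  have h1 : PolyT σ fun y : ((ℕ × List ℕ) × α × TapeSymbol σ × ℕ × ℕ) × ℕ =>
      binSub y.1.2.2.2.2 y.1.2.2.2.1 * y.1.1.2.reverse.headD 0 + y.1.2.2.2.1 * y.2 :=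
    add (mul (sub den num) (headD (reverse (snd.comp (fst.comp fst))) (const 0))) (mul num snd)
  have h2 : PolyT σ fun y : (ℕ × List ℕ) × α × TapeSymbol σ × ℕ × ℕ =>
      (_root_.shiftRow (b y.2.1) y.1.2).map fun s =>
        binSub y.2.2.2.2 y.2.2.2.1 * y.1.2.reverse.headD 0 + y.2.2.2.1 * s :=
    map (shiftRow (hb.comp (fst.comp snd)) (snd.comp fst))
      (g := fun (y : (ℕ × List ℕ) × α × TapeSymbol σ × ℕ × ℕ) (s : ℕ) =>
        binSub y.2.2.2.2 y.2.2.2.1 * y.1.2.reverse.headD 0 + y.2.2.2.1 * s) h1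
  have h3 : PolyT σ fun y : (ℕ × List ℕ) × α × TapeSymbol σ × ℕ × ℕ => y.2.2.2.2 * y.1.1 :=
    mul (snd.comp (snd.comp (snd.comp snd))) (fst.comp fst)
  have h4 : PolyT σ fun y : α × TapeSymbol σ × ℕ × ℕ => match r y.1 with
      | [] => []
      | D :: t => (y.2.2.2 * D) :: (_root_.shiftRow (b y.1) t).map fun s =>
          binSub y.2.2.2 y.2.2.1 * t.reverse.headD 0 + y.2.2.1 * s := by
    refine (listCase (hr.comp fst) (const []) (cons h3 h2)
      (h := fun (y : α × TapeSymbol σ × ℕ × ℕ) D t => (y.2.2.2 * D) ::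
        (_root_.shiftRow (b y.1) t).map fun s =>
          binSub y.2.2.2 y.2.2.1 * t.reverse.headD 0 + y.2.2.1 * s)).of_eq fun y => ?_
    cases r y.1 <;> rfl
  have h5 := optionCase he ho (g := fun x (q : TapeSymbol σ × ℕ × ℕ) => match r x with
    | [] => []
    | D :: t => (q.2.2 * D) :: (_root_.shiftRow (b x) t).map fun s =>
        binSub q.2.2 q.2.1 * t.reverse.headD 0 + q.2.1 * s) h4
  refine h5.of_eq fun x => ?_
  unfold _root_.contribution
  cases e x with
  | none => rfl
  | some q => cases r x <;> rfl

omit [Fintype σ] in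
theorem sz_natList_le (l : List ℕ) : sz l ≤ 4 * ((l.map Nat.size).sum + l.length) + 1 := by
  induction l with
  | nil => simp
  | cons n l ih =>
    have := sz_nat_le n
    simp only [sz_cons, List.map_cons, List.sum_cons, List.length_cons]
    omega

theorem sum_size_add_length_le_sz (l : List ℕ) : (l.map Nat.size).sum + l.length ≤ sz l := by
  induction l with
  | nil => simp
  | cons n l ih =>
    have := size_le_sz n
    simp only [sz_cons, List.map_cons, List.sum_cons, List.length_cons]
    omega

/-- Digits add under multiplication. With the total digit count plus the length as measure,
componentwise products therefore grow additively. -/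
theorem sum_size_zipWith_mul_le (l : List ℕ) : ∀ s : List ℕ,
    ((l.zipWith (fun x y => x * y) s).map Nat.size).sum + (l.zipWith (fun x y => x * y) s).length ≤
      ((s.map Nat.size).sum + s.length) + ((l.map Nat.size).sum + l.length) := by
  induction l with
  | nil => simp
  | cons n l ih =>
    intro s
    cases s with
    | nil => simp
    | cons m s =>
      have h1 := ih s
      have h2 := Nat.size_mul_le n m
      simp only [List.zipWith_cons_cons, List.map_cons, List.sum_cons, List.length_cons]
      omega

omit [Fintype σ] in
theorem rowProd {ones : α → List ℕ} {l : α → List (List ℕ)} (ho : PolyT σ ones)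
    (hl : PolyT σ l) : PolyT σ fun x => _root_.rowProd (ones x) (l x) := by
  refine foldr_of_growth (step := fun _ a s => a.zipWith (fun x y => x * y) s) hl ho
    (zipWith (fst.comp snd) (snd.comp snd) (h := fun _ x y => x * y)
      (mul (fst.comp snd) (snd.comp snd)))
    (fun l => (l.map Nat.size).sum + l.length) (4 * .X + 1) (fun s => ?_) ho.polyBd
    (PolyBd.const 0) (fun x => sum_size_add_length_le_sz _) fun x s b => ?_
  · simpa using sz_natList_le s
  · have h1 := sum_size_zipWith_mul_le b s
    have h2 := sum_size_add_length_le_sz b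
    omega

theorem tabStep {ones : α → List ℕ} {H : α → RowMat (Entry σ)} {M : α → List Bool}
    {T : α → List (List ℕ)} (ho : PolyT σ ones) (hH : PolyT σ H) (hM : PolyT σ M)
    (hT : PolyT σ T) : PolyT σ fun x => _root_.tabStep (ones x) (H x) (M x) (T x) := by
  have h1 : PolyT σ fun y : (α × List (Entry σ)) × Entry σ × List ℕ × Bool =>
      _root_.contribution (ones y.1.1) (y.2.1, y.2.2.1, y.2.2.2) :=
    contribution (ho.comp (fst.comp fst)) (fst.comp snd) (fst.comp (snd.comp snd))
      (snd.comp (snd.comp snd))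
  have h2 : PolyT σ fun y : α × List (Entry σ) =>
      (y.2.zip ((T y.1).zip (M y.1))).map fun p => _root_.contribution (ones y.1) p :=
    map (zip snd (zip (hT.comp fst) (hM.comp fst)))
      (g := fun y (p : Entry σ × List ℕ × Bool) => _root_.contribution (ones y.1) p) h1
  exact map hH (g := fun x (r : List (Entry σ)) => _root_.rowProd (ones x)
      ((r.zip ((T x).zip (M x))).map (_root_.contribution (ones x)))) (rowProd (ho.comp fst) h2)

theorem rootRow {H : α → RowMat (Entry σ)} {T : α → List (List ℕ)} (hH : PolyT σ H)
    (hT : PolyT σ T) : PolyT σ fun x => _root_.rootRow (H x) (T x) := by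
  have h : PolyT σ fun y : α × (List (Entry σ) × List ℕ) × List ℕ =>
      bif _root_.allNone y.2.1.1 then y.2.1.2 else y.2.2 :=
    cond (allNone (fst.comp (fst.comp snd))) (snd.comp (fst.comp snd)) (snd.comp snd)
  exact foldr_of_le (step := fun _ (p : List (Entry σ) × List ℕ) (s : List ℕ) =>
    bif _root_.allNone p.1 then p.2 else s) (zip hH hT) (const []) h 0 fun x s b => by
      cases _root_.allNone b.1 <;> simp only [cond_true, cond_false, sz_prod] <;> omega

omit [Fintype σ] in
theorem rowFraction {f : α → List ℕ} (hf : PolyT σ f) : PolyT σ fun x => _root_.rowFraction (f x) :=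
  (listCase hf (const (0, 0)) (h := fun _ D r => (binSub D (r.reverse.headD 0), D))
    (pair (sub (fst.comp fst) (headD (reverse (snd.comp fst)) (const 0))) (fst.comp fst))).of_eq
    fun x => by cases f x <;> rfl

theorem writeFraction {f : α → ℕ × ℕ} (hf : PolyT σ f) :
    PolyT σ fun x => _root_.writeFraction (σ := σ) (f x) := by
  have hb : ∀ {g : α → ℕ}, PolyT σ g →
      PolyT σ fun x => (g x).bits.map (TapeSymbol.bit (σ := σ)) ++ [.endNumber] := fun hg =>
    append (map hg.bits (g := fun _ b => TapeSymbol.bit b)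
      ((cond snd (const (.bit true)) (const (.bit false))).of_eq fun p => by
        cases p.2 <;> rfl)) (const _)
  exact append (hb (fst.comp hf)) (hb (snd.comp hf))

end PolyT

namespace ProbGraph

/-- The denominators of the table have polynomially many digits. -/
theorem size_denTab_le {n : ℕ} {H : ProbGraph σ (Fin n)} (T : H.graph.TreeData) (k : ℕ)
    (v : Fin n) : (H.denTab k v).size ≤ n * n * sz (toRows (probEntry H)) + 1 := by
  classical
  refine (Nat.size_le_size (denTab_le T k v)).trans ((Nat.size_prod_le _ _).trans ?_)
  -- Each denominator is written in the input matrix, and there are at most `n * n` edges.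
  have hden : ∀ e, (H.prob e).den.size ≤ sz (toRows (probEntry H)) := by
    rintro ⟨⟨u, w⟩, h⟩
    have h1 : sz (probEntry H u w) ≤ sz ((List.finRange n).map fun w => probEntry H u w) :=
      sz_le_of_mem (List.mem_map.2 ⟨w, List.mem_finRange _, rfl⟩)
    have h2 : sz ((List.finRange n).map fun w => probEntry H u w) ≤ sz (toRows (probEntry H)) :=
      sz_le_of_mem (List.mem_map.2 ⟨u, List.mem_finRange _, rfl⟩)
    refine le_trans ?_ (h1.trans h2)
    rw [probEntry, dif_pos h, sz_some]
    have := size_le_sz (H.prob ⟨(u, w), h⟩).den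
    simp only [sz_prod]
    omega
  gcongr
  refine (Finset.sum_le_card_nsmul _ _ _ fun e _ => hden e).trans ?_
  rw [smul_eq_mul]
  gcongr
  refine (Finset.card_le_univ _).trans ?_
  rw [Fintype.card_coe]
  exact (Finset.card_le_univ _).trans (by simp)

end ProbGraph

/-- The table of probabilities is multiplied in every round, so no general growth bound applies. Its
entries are instead identified with `denTab` and `numTab`, whose digits are bounded because the
instance is a tree. -/
theorem PolyT.phomAlg : PolyT σ fun x : PHomInput σ (fun _ G => G.IsOneWayPath)
    (fun _ H => H.IsDownwardTree) =>
      _root_.phomAlg (toRows (graphEntry x.query)) (toRows (probEntry x.inst)) := by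
  have hG := PolyT.queryRows (σ := σ) (𝒢 := fun _ G => G.IsOneWayPath)
    (ℋ := fun _ H => H.IsDownwardTree)
  have hH := PolyT.instRows (σ := σ) (𝒢 := fun _ G => G.IsOneWayPath)
    (ℋ := fun _ H => H.IsDownwardTree)
  have ho := PolyT.map hG (g := fun _ _ => (1 : ℕ)) (const 1)
  have hM := PolyT.endRow hG (transpose hG) (transpose hH)
  refine rowFraction (rootRow (transpose hH) ?_)
  let S : PHomInput σ (fun _ G => G.IsOneWayPath) (fun _ H => H.IsDownwardTree) → ℕ :=
    fun x => sz (toRows (probEntry x.inst))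
  have hS : PolyBd S := hH.polyBd
  have hQ := hG.polyBd
  refine PolyT.foldl (step := fun x T _ => _root_.tabStep _ _ _ T) hH
    (PolyT.map hH (g := fun x _ => (toRows (graphEntry x.query)).map fun _ => 1) (ho.comp fst))
    (tabStep (ho.comp fst) (hH.comp fst) (hM.comp fst) (fst.comp snd))
    -- At most `S x` rows, each with one entry per query vertex, each entry having at most `S x * S
    -- x * S x + 1` binary digits.
    (B := fun x => S x * (sz (toRows (graphEntry x.query)) * (4 * (S x * S x * S x + 1) + 2) + 2) + 1)
    ((hS.mul ((hQ.mul (((PolyBd.const 4).mul (((hS.mul hS).mul hS).add (.const 1))).add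
      (.const 2))).add (.const 2))).add (.const 1)) fun x l' hl' => ?_
  refine foldl_prefix_const (_root_.tabStep _ _ _) _ (fun A => sz A ≤ _) (fun k => ?_) hl'
  obtain ⟨m, a, R, hR⟩ := x.query_mem
  obtain ⟨T⟩ := LabeledGraph.IsDownwardTree.nonempty_treeData x.inst_mem
  have hN : m + 1 = x.querySize := by simpa using Fintype.card_congr a
  have hones : ((toRows (graphEntry x.query)).map fun _ => 1) =
      (List.range (m + 1)).map fun _ => 1 := by
    simp [toRows, hN, Function.comp_def]
  rw [transposeRows_toRows x.instSize_pos, transposeRows_toRows x.querySize_pos,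
    endRow_eq x.querySize_pos, hones]
  change sz ((_root_.tabStep _ _ ((List.finRange x.instSize).map
      (endTab x.query x.inst)))^[k] _) ≤ _
  rw [tabStep_iterate]
  have hn : x.instSize ≤ S x := by
    have := length_lt_sz (toRows (probEntry x.inst))
    simp only [toRows, List.length_map, List.length_finRange] at this
    exact this.le
  have hm : m + 1 ≤ sz (toRows (graphEntry x.query)) := by
    have := length_lt_sz (toRows (graphEntry x.query))
    simp only [toRows, List.length_map, List.length_finRange, ← hN] at this
    exact this.le
  have hsize : ∀ v j, (rowEntry x.inst (endTab x.query x.inst) m k v j).size ≤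
      S x * S x * S x + 1 := by
    intro v j
    have h1 : rowEntry x.inst (endTab x.query x.inst) m k v j ≤ x.inst.denTab k v := by
      cases j with
      | zero => exact le_rfl
      | succ i => exact ProbGraph.numTab_le_denTab ..
    refine (Nat.size_le_size h1).trans ((ProbGraph.size_denTab_le T k v).trans ?_)
    gcongr
  refine (sz_le_mul _ ((m + 1) * (4 * (S x * S x * S x + 1) + 2) + 1) fun r hr => ?_).trans ?_
  · obtain ⟨v, -, rfl⟩ := List.mem_map.1 hr
    refine (sz_le_mul _ (4 * (S x * S x * S x + 1) + 1) fun b hb => ?_).trans ?_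
    · obtain ⟨j, -, rfl⟩ := List.mem_map.1 hb
      exact (sz_nat_le _).trans (by have := hsize v j; omega)
    · rw [List.length_map, List.length_range]
  · rw [List.length_map, List.length_finRange]
    have h := Nat.mul_le_mul_right (4 * (S x * S x * S x + 1) + 2) hm
    exact Nat.add_le_add_right (Nat.mul_le_mul hn (by omega)) 1

/-- The probability of a one-way path query on a downward tree is computed in polynomial time. -/
theorem phomInPTIME_oneWayPath_downwardTree :
    PHomInPTIME σ (fun _ G => G.IsOneWayPath) (fun _ H => H.IsDownwardTree) := by
  choose f hf halg using exists_ratProb_of_alg (σ := σ)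
  refine ⟨f, hf, PolyT.computable _ _ f ?_⟩
  exact (PolyT.writeFraction PolyT.phomAlg).of_eq fun x => by
    rw [halg, encodeRatProb_eq]

end Complexity

theorem mainTheorem2 (σ : Type) [Fintype σ] (hσ : 1 < Fintype.card σ) :
    PHomInPTIME σ (fun _ G => G.IsOneWayPath) (fun _ H => H.IsDownwardTree) ∧
    ∀ (U V : Type) [Fintype V] (G : LabeledGraph σ U) (H : ProbGraph σ V)
      (m : ℕ) (a : Fin (m + 1) ≃ U) (R : Fin m → σ),
      G.IsOneWayPathAlong a R → H.graph.IsDownwardTree →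
        H.graph.CapturesLineage (H.graph.pathDNF R) G ∧
        (H.graph.pathDNF R).IsBetaAcyclic ∧
        (H.graph.pathDNF R).prob (fun e => (H.prob e).val) = ProbGraph.homProb G H := by
  refine ⟨phomInPTIME_oneWayPath_downwardTree, fun U V _ G H m a R hG hH => ⟨LabeledGraph.capturesLineage_pathDNF hG H.graph,
    LabeledGraph.isBetaAcyclic_pathDNF hH R, ProbGraph.homProb_eq_prob hG H⟩⟩
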